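/- **Setting.** An \emph{occupied surface} $(\Sigma,V)$ is a compact oriented surface $\Sigma$ (possibly disconnected or empty), each component of which has non-empty boundary, with a finite set $V=V_+\sqcup V_-\subset\partial\Sigma$ of signed vertices that meets every boundary component and alternates in sign along it. The arcs of $\partial\Sigma$ between consecutive vertices are the boundary edges, oriented from $V_-$ to $V_+$; fix a point in the interior of each, and let $F$ be the set of these points. A disc with two (four) vertices is a \emph{vacuum} (\emph{square}). A \emph{set of sutures} $\Gamma$ is a properly embedded $1$-submanifold with $\partial\Gamma=\Gamma\cap\partial\Sigma=F$ such that $\Sigma\setminus\Gamma=R_+\sqcup R_-$, each point of $\Gamma$ having $R_+$ on one side and $R_-$ on the other, and $V_\pm\subset R_\pm$; its Euler class is $e(\Gamma)=\chi(R_+)-\chi(R_-)$. Isotopies of sutures are relative to the boundary. On a square, $\Gamma_+$ (resp. $\Gamma_-$) consists of two arcs cutting off the two positive (resp. negative) corners. A \emph{morphism} $\phi:(\Sigma,V)\to(\Sigma',V')$ is a continuous map which embeds $\mathrm{Int}\,\Sigma$ into $\mathrm{Int}\,\Sigma'$ preserving orientation, respects signs of vertices, and embeds each boundary edge, onto a boundary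 edge of $\Sigma'$ or, apart from its endpoints, into $\mathrm{Int}\,\Sigma'$; the images of two boundary edges coincide (respecting orientations) or are disjoint except possibly at endpoints; points of $F$ are matched whenever edges are. The complement of its image is again an occupied surface (pinches at vertices being resolved). A \emph{decorated morphism} $(\phi,\Gamma_c)$ is a morphism with a set of sutures $\Gamma_c$ on the complement of its image; it takes $\Gamma$ to $\Gamma\cup\Gamma_c$ (short for $\phi(\Gamma)\cup\Gamma_c$). The composite of $(\phi,\Gamma_c)$ followed by $(\phi',\Gamma_c')$ is $(\phi'\circ\phi,\ \phi'(\Gamma_c)\cup\Gamma'_c)$. \emph{Decorated isotopy} is generated by continuous families $(\phi_t,\Gamma_t)$ of decorated morphisms, in which vacuum components of the complement that carry a single arc may be removed or created by collapsing. A \emph{quadrangulation} presents $(\Sigma,V)$ as squares glued along edges, all vertices of the squares going to $V$ (vacuum components of $\Sigma$ are left without squares); $\Gamma$ is \emph{basic} for it if it restricts to $\Gamma_+$ or $\Gamma_-$ on each square, and to a single arc on each vacuum component. A \emph{twisted SQFT} $(\mathcal D,c)$ assigns * to each $(\Sigma,V)$ a graded $\mathbb Z[H_1(\Sigma)]$-module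 $\mathcal V(\Sigma,V)=\bigoplus_{e\in\mathbb Z}\mathcal V(\Sigma,V;e)$, with finitely many non-zero summands; * to each decorated-isotopy class of decorated morphisms $(\phi,\Gamma_c):(\Sigma,V)\to(\Sigma',V')$ a graded homomorphism $\mathcal D_{\phi,\Gamma_c}:\mathcal V(\Sigma,V)\to\mathcal V(\Sigma',V')$ of some degree over $\phi_*:\mathbb Z[H_1(\Sigma)]\to\mathbb Z[H_1(\Sigma')]$, defined up to multiplication by a unit of $\mathbb Z[H_1(\Sigma')]$ on each graded summand separately; * to each isotopy class of sutures $\Gamma$ on $(\Sigma,V)$ a $\mathbb Z[H_1(\Sigma)]^\times$-orbit $c(\Gamma)\subset\mathcal V(\Sigma,V)$; such that: (i) identities and composites are respected, up to units; (ii) each quadrangulation with squares $(\Sigma_i^\square,V_i^\square)$ has an isomorphism $\mathcal V(\Sigma,V)\cong\mathbb Z[H_1(\Sigma)]\otimes_{\mathbb Z}\bigotimes_i\mathcal V(\Sigma_i^\square,V_i^\square)$ of graded modules (the coefficient ring in degree $0$), under which $c(\Gamma)=\mathbb Z[H_1(\Sigma)]^\times\otimes\bigotimes_ic(\Gamma_i)$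 for each basic $\Gamma$ with restrictions $\Gamma_i$ to the squares; (iii) $\mathcal D_{\phi,\Gamma_c}(c(\Gamma))\subseteq c(\Gamma\cup\Gamma_c)$; (iv) for a square, $c(\Gamma_-)=\{\pm\mathbf 0\}$ and $c(\Gamma_+)=\{\pm\mathbf 1\}$, where $\mathbf 0,\mathbf 1$ form a $\mathbb Z$-basis of its module and have degrees $-1$ and $1$; (v) every element of $c(\Gamma)$ has degree $e(\Gamma)$. Three sets of sutures on $(\Sigma,V)$ form a \emph{bypass triple} if, up to isotopy and in some order, they coincide outside a disc in $\mathrm{Int}\,\Sigma$ whose boundary circle they cross in six points, and inside it they are respectively three parallel chords and the images of these under the rotations by $120^\circ$ and $240^\circ$; that is, the second and third are the results of the two bypass surgeries on the first along the arc joining the outer chords. **Proposition.** In any twisted SQFT, if $\Gamma_0,\Gamma_1,\Gamma_2$ form a bypass triple of sets of sutures on an occupied surface, then there exist $c_0\in c(\Gamma_0)$, $c_1\in c(\Gamma_1)$, $c_2\in c(\Gamma_2)$ with $c_0+c_1+c_2=0$. -/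

import Mathlib

open Set Topology
open scoped unitInterval TensorProduct

noncomputable section

namespace TwistedSQFT

/-! ### Coefficients: singular homology and group rings -/

/-- Singular homology with integer coefficients. -/
abbrev Homology (n : ℕ) (X : Type) [TopologicalSpace X] : Type :=
  ((AlgebraicTopology.singularHomologyFunctor (ModuleCat.{0} ℤ) n).obj
    (ModuleCat.of ℤ ℤ)).obj (TopCat.of X)

/-- The homomorphism induced on singular homology by a continuous map. -/
def homologyMap (n : ℕ) {X Y : Type} [TopologicalSpace X] [TopologicalSpace Y] (f : C(X, Y)) :
    Homology n X →+ Homology n Y :=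
  (((AlgebraicTopology.singularHomologyFunctor (ModuleCat.{0} ℤ) n).obj
    (ModuleCat.of ℤ ℤ)).map (TopCat.ofHom f)).hom.toAddMonoidHom

/-- The group ring `ℤ[H₁(X)]`. -/
abbrev CoeffRing (X : Type) [TopologicalSpace X] : Type :=
  AddMonoidAlgebra ℤ (Homology 1 X)

/-- The ring homomorphism `ℤ[H₁(X)] → ℤ[H₁(Y)]` induced by a continuous map. -/
def coeffMap {X Y : Type} [TopologicalSpace X] [TopologicalSpace Y] (f : C(X, Y)) :
    CoeffRing X →+* CoeffRing Y :=
  AddMonoidAlgebra.mapDomainRingHom ℤ (homologyMap 1 f)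

/-- The Euler characteristic of a two-dimensional space, i.e. one without homology above
degree two (such as a surface or an open subset of one). -/
def eulerChar (X : Type) [TopologicalSpace X] : ℤ :=
  (Module.finrank ℤ (Homology 0 X) : ℤ) - Module.finrank ℤ (Homology 1 X)
    + Module.finrank ℤ (Homology 2 X)

/-! ### Occupied surfaces -/

/-- The closed upper half plane. -/
abbrev HalfPlane : Type := {z : ℂ // 0 ≤ z.im}

/-- A map between planar domains (defined and injective near `z`) preserves orientation at `z`:
the image of each small positively oriented circle about `z` winds once, positively,
around the image of `z`. -/
def PosAt (f : ℂ → ℂ) (z : ℂ) : Prop :=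
  ∀ᶠ r : ℝ in 𝓝[>] 0, ∃ g : ℝ → ℝ, Continuous g ∧ g (2 * Real.pi) = g 0 + 2 * Real.pi ∧
    ∀ θ : ℝ, f (z + r * Complex.exp (θ * Complex.I)) - f z =
      ‖f (z + r * Complex.exp (θ * Complex.I)) - f z‖ * Complex.exp (g θ * Complex.I)

/-- An occupied surface: a compact oriented surface, every component of which has non-empty
boundary, whose boundary is cut by finitely many vertices into arcs (the boundary edges), each
running from a negative vertex to a positive one; so there are vertices on every boundary
component and their signs alternate along it. The boundary edges are oriented from their
negative to their positive vertex. The midpoint of the parametrisation of each boundary edge is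
the point in which sutures are to cross it; so an occupied surface carries with it the
corresponding sutured background. -/
structure OccupiedSurface where
  carrier : Type
  [top : TopologicalSpace carrier]
  [compact : CompactSpace carrier]
  [hausdorff : T2Space carrier]
  /-- the index set of the boundary edges -/
  Edge : Type
  [finite_edge : Finite Edge]
  /-- the boundary edges -/
  edge : Edge → C(I, carrier)
  edge_injective : ∀ i, Function.Injective (edge i)
  edge_disjoint : ∀ i j, i ≠ j → ∀ s ∈ Ioo (0 : I) 1, ∀ t, edge i s ≠ edge j t
  /-- no vertex is both negative and positive -/
  sign_ne : ∀ i j, edge i 0 ≠ edge j 1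
  /-- charts near boundary points, the boundary being the union of the boundary edges -/
  boundary_chart : ∀ x ∈ ⋃ i, range (edge i), ∃ a : OpenPartialHomeomorph carrier HalfPlane,
    x ∈ a.source ∧ ∀ y ∈ a.source, y ∈ ⋃ i, range (edge i) ↔ (a y).1.im = 0
  /-- an oriented atlas of the interior -/
  atlas : Set (OpenPartialHomeomorph carrier ℂ)
  atlas_interior : ∀ a ∈ atlas, Disjoint a.source (⋃ i, range (edge i))
  atlas_cover : ∀ x ∉ ⋃ i, range (edge i), ∃ a ∈ atlas, x ∈ a.source
  atlas_oriented : ∀ a ∈ atlas, ∀ b ∈ atlas, ∀ x ∈ a.source ∩ b.source,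
    PosAt (b ∘ a.symm) (a x)
  component_boundary : ∀ x, (connectedComponent x ∩ ⋃ i, range (edge i)).Nonempty

namespace OccupiedSurface

instance : CoeSort OccupiedSurface Type := ⟨carrier⟩

attribute [instance] top compact hausdorff finite_edge

variable (S : OccupiedSurface)

/-- The boundary of the surface. -/
def bdry : Set S := ⋃ i, range (S.edge i)

/-- The interior of the surface. -/
def inner : Set S := S.bdryᶜ

/-- The negative vertices. -/
def Vneg : Set S := range fun i => S.edge i 0

/-- The positive vertices. -/
def Vpos : Set S := range fun i => S.edge i 1

/-- The midpoint of an interval. -/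
def mid : I := ⟨1 / 2, by norm_num, by norm_num⟩

/-- The endpoints of sutures: one in each boundary edge. -/
def F : Set S := range fun i => S.edge i mid

/-- A disc with two vertices. -/
def IsVacuum : Prop :=
  Nonempty (S ≃ₜ Metric.closedBall (0 : ℂ) 1) ∧ (S.Vneg ∪ S.Vpos).ncard = 2

/-- A disc with four vertices. -/
def IsSquare : Prop :=
  Nonempty (S ≃ₜ Metric.closedBall (0 : ℂ) 1) ∧ (S.Vneg ∪ S.Vpos).ncard = 4

end OccupiedSurface

open OccupiedSurface

/-! ### Sutures -/

/-- A set of sutures on an occupied surface, given by the regions `R₊` and `R₋` into which it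
cuts the surface. The sutures form the complement of the regions; this is a properly embedded
1-manifold with boundary `F`, each point of which has `R₊` on one side and `R₋` on the other;
it is oriented as the boundary of `R₊`. Positive vertices lie in `R₊`, negative ones in `R₋`. -/
structure Sutures (S : OccupiedSurface) where
  pos : Set S
  neg : Set S
  isOpen_pos : IsOpen pos
  isOpen_neg : IsOpen neg
  disjoint : Disjoint pos neg
  Vpos_subset : S.Vpos ⊆ pos
  Vneg_subset : S.Vneg ⊆ neg
  inter_bdry : (pos ∪ neg)ᶜ ∩ S.bdry = S.F
  inner_chart : ∀ x ∈ (pos ∪ neg)ᶜ, x ∈ S.inner → ∃ a : OpenPartialHomeomorph S ℂ,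
    x ∈ a.source ∧ a.source ⊆ S.inner ∧
      ∀ y ∈ a.source, (y ∈ pos ↔ 0 < (a y).im) ∧ (y ∈ neg ↔ (a y).im < 0)
  bdry_chart : ∀ x ∈ (pos ∪ neg)ᶜ, x ∈ S.bdry → ∃ a : OpenPartialHomeomorph S HalfPlane,
    x ∈ a.source ∧
      ∀ y ∈ a.source, (y ∈ S.bdry ↔ (a y).1.im = 0) ∧
        (y ∈ pos ↔ 0 < (a y).1.re) ∧ (y ∈ neg ↔ (a y).1.re < 0)

namespace Sutures

variable {S : OccupiedSurface}

/-- The union of the sutures. -/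
def curve (Γ : Sutures S) : Set S := (Γ.pos ∪ Γ.neg)ᶜ

/-- The Euler class `χ(R₊) - χ(R₋)`. -/
def eulerClass (Γ : Sutures S) : ℤ := eulerChar Γ.pos - eulerChar Γ.neg

/-- Ambient isotopy of sutures, relative to the boundary. -/
def Isotopic (Γ Γ' : Sutures S) : Prop :=
  ∃ h : I → S ≃ₜ S, Continuous (fun p : I × S => h p.1 p.2) ∧ (∀ x, h 0 x = x) ∧
    (∀ t, ∀ x ∈ S.bdry, h t x = x) ∧ h 1 '' Γ.curve = Γ'.curve

/-- On a square: the standard positive sutures `Γ₊`, i.e. two arcs (and no closed curve)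
cutting the square into two positive corners and a negative strip. -/
def IsStdPos (Γ : Sutures S) : Prop :=
  IsConnected Γ.neg ∧ Nat.card (ConnectedComponents Γ.pos) = 2

/-- On a square: the standard negative sutures `Γ₋`, i.e. two arcs (and no closed curve)
cutting the square into two negative corners and a positive strip. -/
def IsStdNeg (Γ : Sutures S) : Prop :=
  IsConnected Γ.pos ∧ Nat.card (ConnectedComponents Γ.neg) = 2

/-- On a vacuum: the vacuum sutures, i.e. one arc (and no closed curve). -/
def IsVacuumSutures (Γ : Sutures S) : Prop :=
  IsConnected Γ.pos ∧ IsConnected Γ.neg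

end Sutures

/-! ### Morphisms -/

/-- Two oriented arcs with the same image, endpoints and midpoint. -/
def EdgeMatch {X : Type} (α β : I → X) : Prop :=
  range α = range β ∧ α 0 = β 0 ∧ α mid = β mid ∧ α 1 = β 1

/-- A morphism of occupied surfaces: a continuous map that embeds the interior, preserving
orientation; boundary edges are embedded, any two of them have images which coincide
(respecting orientations) or else are disjoint except possibly at endpoints, and each
goes either onto a boundary edge of the target or into its interior, again except possibly for
its endpoints; signs of vertices are respected. -/
structure Morphism (S T : OccupiedSurface) where
  map : C(S, T)
  map_inner : ∀ x ∈ S.inner, map x ∈ T.inner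
  embedding : IsOpenEmbedding fun x : S.inner => map x
  oriented : ∀ a ∈ S.atlas, ∀ b ∈ T.atlas, ∀ x ∈ a.source, map x ∈ b.source →
    PosAt (b ∘ map ∘ a.symm) (a x)
  edge_injective : ∀ i, Function.Injective (map ∘ S.edge i)
  edge_edge : ∀ i j, EdgeMatch (map ∘ S.edge i) (map ∘ S.edge j) ∨
    ∀ s ∈ Ioo (0 : I) 1, ∀ t, map (S.edge i s) ≠ map (S.edge j t)
  edge_bdry : ∀ i, (∃ j, EdgeMatch (map ∘ S.edge i) (T.edge j)) ∨
    ∀ s ∈ Ioo (0 : I) 1, map (S.edge i s) ∈ T.inner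
  map_Vneg : ∀ v ∈ S.Vneg, map v ∈ T.bdry → map v ∈ T.Vneg
  map_Vpos : ∀ v ∈ S.Vpos, map v ∈ T.bdry → map v ∈ T.Vpos
  sign_ne : ∀ v ∈ S.Vneg, ∀ w ∈ S.Vpos, map v ≠ map w

/-- Two morphisms to the same surface which together form a morphism from the disjoint union. -/
def Compatible {S S' T : OccupiedSurface} (φ : Morphism S T) (ψ : Morphism S' T) : Prop :=
  Disjoint (φ.map '' S.inner) (ψ.map '' S'.inner) ∧
  (∀ i j, EdgeMatch (φ.map ∘ S.edge i) (ψ.map ∘ S'.edge j) ∨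
    ∀ s ∈ Ioo (0 : I) 1, ∀ t, φ.map (S.edge i s) ≠ ψ.map (S'.edge j t) ∧
      φ.map (S.edge i t) ≠ ψ.map (S'.edge j s)) ∧
  (∀ v ∈ S.Vneg, ∀ w ∈ S'.Vpos, φ.map v ≠ ψ.map w) ∧
  (∀ v ∈ S.Vpos, ∀ w ∈ S'.Vneg, φ.map v ≠ ψ.map w)

/-- The occupied surface `C`, mapped to `T` by `κ`, is the complement of the image of `φ`:
glued to the image of `φ` it makes up `T`, and no two of its own edges are glued together.
(If the complement is pinched at vertices then `C` is the complement with these pinches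
resolved.) -/
def IsComplement {S C T : OccupiedSurface} (φ : Morphism S T) (κ : Morphism C T) : Prop :=
  Compatible φ κ ∧ range φ.map ∪ range κ.map = univ ∧
    ∀ i j, EdgeMatch (κ.map ∘ C.edge i) (κ.map ∘ C.edge j) → i = j

/-- A decorated morphism: a morphism with a set of sutures on the complement of its image. -/
structure DecoratedMorphism (S T : OccupiedSurface) where
  φ : Morphism S T
  C : OccupiedSurface
  κ : Morphism C T
  isComplement : IsComplement φ κ
  Γc : Sutures C

namespace DecoratedMorphism

variable {S T U : OccupiedSurface}

/-- The complementary sutures, as a subset of the target. -/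
def curve (d : DecoratedMorphism S T) : Set T := d.κ.map '' d.Γc.curve

/-- `Γ' = Γ ∪ Γ_c`: the decorated morphism takes the sutures `Γ` to the sutures `Γ'`. -/
def Sends (d : DecoratedMorphism S T) (Γ : Sutures S) (Γ' : Sutures T) : Prop :=
  Γ'.curve = d.φ.map '' Γ.curve ∪ d.curve

/-- `d` is (underlain by) the identity morphism. -/
def IsIdentity (d : DecoratedMorphism S S) : Prop := ∀ x, d.φ.map x = x

/-- `d''` is the composite of `d` followed by `d'`. -/
def IsComposite (d : DecoratedMorphism S T) (d' : DecoratedMorphism T U)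
    (d'' : DecoratedMorphism S U) : Prop :=
  (∀ x, d''.φ.map x = d'.φ.map (d.φ.map x)) ∧ d''.curve = d'.φ.map '' d.curve ∪ d'.curve

/-- The component of the complement containing `y` is a vacuum, with vacuum sutures
(a single arc) on it. -/
def IsVacuumAt (d : DecoratedMorphism S T) (y : d.C) : Prop :=
  Nonempty (connectedComponent y ≃ₜ Metric.closedBall (0 : ℂ) 1) ∧
    ((d.C.Vneg ∪ d.C.Vpos) ∩ connectedComponent y).ncard = 2 ∧
    IsConnected (d.Γc.curve ∩ connectedComponent y)

/-- A family of decorated morphisms `δ t` from `d` to `d'` in which the maps, and the embedded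
complementary sutures `γ t`, vary continuously with `t`, except that at time `1` the vacua
containing a set `A` of complementary sutures may be removed: these vacua collapse,
and the sutures in `A` collapse to points. If `A` is empty this is a non-singular isotopy. -/
def IsotopyStep (d d' : DecoratedMorphism S T) : Prop :=
  ∃ (δ : I → DecoratedMorphism S T) (γ : I → d.curve → T) (A : Set d.curve),
    δ 0 = d ∧ δ 1 = d' ∧
    Continuous (fun p : I × S => (δ p.1).φ.map p.2) ∧
    Continuous (fun p : I × d.curve => γ p.1 p.2) ∧
    (∀ x, γ 0 x = x) ∧
    (∀ t, t ≠ 1 → Function.Injective (γ t) ∧ range (γ t) = (δ t).curve) ∧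
    IsClopen A ∧ InjOn (γ 1) Aᶜ ∧ γ 1 '' Aᶜ = d'.curve ∧
    (∀ t, t ≠ 1 → ∀ x ∈ A, ∀ y, (δ t).κ.map y = γ t x → (δ t).IsVacuumAt y) ∧
    (∀ x ∈ A, ∀ y ∈ connectedComponent x, γ 1 y = γ 1 x)

/-- Decorated isotopy: isotopy, where vacua may be removed and created. -/
def Isotopic : DecoratedMorphism S T → DecoratedMorphism S T → Prop :=
  Relation.EqvGen IsotopyStep

end DecoratedMorphism

/-! ### Quadrangulations -/

/-- A quadrangulation of an occupied surface: squares, glued along edges into the surface, with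
vertices only at the vertices of the surface. Components of the surface which are vacua are
covered by no squares but by themselves (the null quadrangulation). -/
structure Quadrangulation (S : OccupiedSurface) where
  /-- the index set of the squares -/
  ι : Type
  [fintype_ι : Fintype ι]
  /-- the index set of the vacuum components -/
  ν : Type
  [fintype_ν : Fintype ν]
  piece : ι ⊕ ν → OccupiedSurface
  isSquare : ∀ i, (piece (.inl i)).IsSquare
  isVacuum : ∀ j, (piece (.inr j)).IsVacuum
  q : ∀ p, Morphism (piece p) S
  compatible : ∀ p p', p ≠ p' → Compatible (q p) (q p')
  cover : ⋃ p, range (q p).map = univ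
  map_vertex : ∀ p, ∀ v ∈ (piece p).Vneg ∪ (piece p).Vpos, (q p).map v ∈ S.bdry
  /-- the image of a vacuum is a component -/
  vacuum_bdry : ∀ j, ∀ x ∈ (piece (.inr j)).bdry, (q (.inr j)).map x ∈ S.bdry

attribute [instance] Quadrangulation.fintype_ι Quadrangulation.fintype_ν

/-- The sutures `Γ` are basic for the quadrangulation, and restrict to `Δ p` on each piece. -/
def Quadrangulation.IsBasic {S : OccupiedSurface} (Q : Quadrangulation S) (Γ : Sutures S)
    (Δ : ∀ p, Sutures (Q.piece p)) : Prop :=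
  (∀ p, (Δ p).curve = (Q.q p).map ⁻¹' Γ.curve) ∧
  (∀ i, (Δ (.inl i)).IsStdPos ∨ (Δ (.inl i)).IsStdNeg) ∧
  ∀ j, (Δ (.inr j)).IsVacuumSutures

/-! ### Graded modules and twisted SQFTs -/

/-- `M` is the direct sum of the submodules `M e`, only finitely many of which are non-zero. -/
def IsGrading {R M : Type*} [Ring R] [AddCommGroup M] [Module R M]
    (gr : ℤ → Submodule R M) : Prop :=
  DirectSum.IsInternal gr ∧ {e | gr e ≠ ⊥}.Finite

/-- `f` is a graded module homomorphism over the ring homomorphism `ρ`, of some degree. -/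
def IsGradedHom {R R' M M' : Type*} [CommRing R] [CommRing R'] [AddCommGroup M] [AddCommGroup M']
    [Module R M] [Module R' M'] (ρ : R →+* R') (gr : ℤ → Submodule R M)
    (gr' : ℤ → Submodule R' M') (f : M →+ M') : Prop :=
  (∀ r m, f (r • m) = ρ r • f m) ∧ ∃ n : ℤ, ∀ e, ∀ m ∈ gr e, f m ∈ gr' (e + n)

/-- The class of `f` up to multiplication by units, with a separate unit in each graded
summand. -/
def unitClass {R R' M M' : Type*} [CommRing R] [CommRing R'] [AddCommGroup M] [AddCommGroup M']
    [Module R M] [Module R' M'] (gr : ℤ → Submodule R M) (f : M →+ M') : Set (M →+ M') :=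
  {g | ∃ z : ℤ → R'ˣ, ∀ e, ∀ m ∈ gr e, g m = (z e : R') • f m}

/-- The orbit of an element under the units of the coefficient ring. -/
def unitOrbit (R : Type*) {M : Type*} [CommRing R] [AddCommGroup M] [Module R M] (x : M) : Set M :=
  {y | ∃ u : Rˣ, y = (u : R) • x}

/-- A twisted sutured quadrangulated field theory. -/
structure Theory where
  /-- the module of an occupied surface -/
  V : OccupiedSurface → Type*
  [addCommGroup : ∀ S : OccupiedSurface, AddCommGroup (V S)]
  [module : ∀ S : OccupiedSurface, Module (CoeffRing S) (V S)]
  /-- the graded summands -/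
  gr : ∀ S : OccupiedSurface, ℤ → Submodule (CoeffRing S) (V S)
  isGrading : ∀ S, IsGrading (gr S)
  /-- the class of graded module homomorphisms of a decorated morphism -/
  D : ∀ {S T : OccupiedSurface}, DecoratedMorphism S T → Set (V S →+ V T)
  D_class : ∀ {S T : OccupiedSurface} (d : DecoratedMorphism S T),
    ∃ f : V S →+ V T, IsGradedHom (coeffMap d.φ.map) (gr S) (gr T) f ∧
      D d = unitClass (R' := CoeffRing T) (gr S) f
  D_isotopic : ∀ {S T : OccupiedSurface} (d d' : DecoratedMorphism S T),
    d.Isotopic d' → D d = D d'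
  /-- the suture elements of a set of sutures -/
  c : ∀ {S : OccupiedSurface}, Sutures S → Set (V S)
  c_orbit : ∀ {S : OccupiedSurface} (Γ : Sutures S), ∃ x, c Γ = unitOrbit (CoeffRing S) x
  c_isotopic : ∀ {S : OccupiedSurface} (Γ Γ' : Sutures S), Γ.Isotopic Γ' → c Γ = c Γ'
  /-- identity morphisms are respected, up to units -/
  D_identity : ∀ {S : OccupiedSurface} (d : DecoratedMorphism S S), d.IsIdentity →
    AddMonoidHom.id (V S) ∈ D d
  /-- composition is respected, up to units -/
  D_composite : ∀ {S T U : OccupiedSurface} (d : DecoratedMorphism S T)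
    (d' : DecoratedMorphism T U) (d'' : DecoratedMorphism S U), d.IsComposite d' d'' →
    ∀ f ∈ D d, ∀ g ∈ D d', g.comp f ∈ D d''
  /-- quadrangulations give tensor decompositions, compatible with the suture elements of basic
  sutures and with the grading -/
  tensor : ∀ {S : OccupiedSurface} (Q : Quadrangulation S),
    ∃ Ψ : V S ≃ₗ[CoeffRing S] (CoeffRing S ⊗[ℤ] PiTensorProduct ℤ fun i => V (Q.piece (.inl i))),
      (∀ Γ Δ, Q.IsBasic Γ Δ → Ψ '' c Γ =
        {y | ∃ (u : (CoeffRing S)ˣ) (x : ∀ i, V (Q.piece (.inl i))),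
          (∀ i, x i ∈ c (Δ (.inl i))) ∧ y = (u : CoeffRing S) ⊗ₜ[ℤ] PiTensorProduct.tprod ℤ x}) ∧
      ∀ e, (gr S e).map Ψ.toLinearMap = Submodule.span (CoeffRing S)
        {y | ∃ (n : Q.ι → ℤ) (x : ∀ i, V (Q.piece (.inl i))),
          (∑ i, n i = e) ∧ (∀ i, x i ∈ gr (Q.piece (.inl i)) (n i)) ∧
          y = (1 : CoeffRing S) ⊗ₜ[ℤ] PiTensorProduct.tprod ℤ x}
  /-- suture elements are respected -/
  D_suture : ∀ {S T : OccupiedSurface} (d : DecoratedMorphism S T) (Γ : Sutures S)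
    (Γ' : Sutures T), d.Sends Γ Γ' → ∀ f ∈ D d, ∀ x ∈ c Γ, f x ∈ c Γ'
  /-- basic sutures on a square give a basis, in degrees `-1` and `1` -/
  square : ∀ S : OccupiedSurface, S.IsSquare → ∃ x₀ x₁ : V S,
    (∀ Γ : Sutures S, Γ.IsStdNeg → c Γ = {x₀, -x₀}) ∧
    (∀ Γ : Sutures S, Γ.IsStdPos → c Γ = {x₁, -x₁}) ∧
    LinearIndependent ℤ ![x₀, x₁] ∧ Submodule.span ℤ {x₀, x₁} = ⊤ ∧
    x₀ ∈ gr S (-1) ∧ x₁ ∈ gr S 1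
  /-- suture elements are graded by Euler class -/
  c_grade : ∀ {S : OccupiedSurface} (Γ : Sutures S), ∀ x ∈ c Γ, x ∈ gr S Γ.eulerClass

attribute [instance] Theory.addCommGroup Theory.module

/-! ### Bypass triples -/

/-- The six points `exp (i (π / 6 + k π / 3))` of the unit circle. -/
def hexPoint (k : ℕ) : ℂ :=
  Complex.exp (((Real.pi / 6 + k * (Real.pi / 3) : ℝ) : ℂ) * Complex.I)

/-- The sutures before bypass surgery, near the attaching arc (which is the part of the real axis
between the two outer chords): three parallel chords of the unit disc, extended radially. -/
def bypassCurve₀ : Set ℂ :=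
  segment ℝ (hexPoint 0) (hexPoint 5) ∪ segment ℝ (hexPoint 1) (hexPoint 4) ∪
    segment ℝ (hexPoint 2) (hexPoint 3) ∪ {z | ∃ k < 6, ∃ r : ℝ, 1 ≤ r ∧ z = r * hexPoint k}

/-- The local picture of the three sets of sutures of a bypass triple: they differ by rotation
through a third of a full turn. -/
def bypassCurve (i : Fin 3) : Set ℂ :=
  (fun z => Complex.exp (((2 * Real.pi / 3 * (i : ℕ) : ℝ) : ℂ) * Complex.I) * z) '' bypassCurve₀

/-- Three sets of sutures forming a bypass triple, in any order: up to isotopy they coincide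
outside a disc in the interior of the surface, and in a neighbourhood of this disc they are as in
the standard local picture. -/
def IsBypassTriple {S : OccupiedSurface} (Γ : Fin 3 → Sutures S) : Prop :=
  ∃ (Γ' : Fin 3 → Sutures S) (τ : Equiv.Perm (Fin 3)) (e : ℂ → S),
    (∀ i, (Γ i).Isotopic (Γ' i)) ∧
    IsOpenEmbedding e ∧ range e ⊆ S.inner ∧
    (∀ b ∈ S.atlas, ∀ z, e z ∈ b.source → PosAt (b ∘ e) z) ∧
    (∀ i, e ⁻¹' (Γ' i).curve = bypassCurve (τ i)) ∧
    ∀ i j, (Γ' i).curve \ e '' Metric.ball 0 1 = (Γ' j).curve \ e '' Metric.ball 0 1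

end TwistedSQFT

end

open Set Topology
open scoped unitInterval TensorProduct

noncomputable section

namespace TwistedSQFT

open OccupiedSurface

/-! ### Linear algebra of the hexagon -/

/-! The statement is local. The disc of a bypass triple is an occupied surface with six vertices,
the hexagon, on which the three sets of sutures are the three families of parallel chords. The
sutures outside the disc are common to the triple, so including the hexagon with them as
complementary sutures is one decorated morphism which sends the three hexagon sutures to the three
given ones (`EmbeddedPlane.decorated_sends`). Any representative of its class is additive and
carries suture elements to suture elements, so it suffices to find the relation on the hexagon
(`Theory.hexagon_relation`).

Each of the three long diagonals of the hexagon cuts it into two squares. Two of the three chord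
families cross a given diagonal once and are basic for that quadrangulation, restricting to (plus,
minus) and (minus, plus); the third crosses it three times. Since the basis vectors of a square have
degrees -1 and 1, the degree 0 part of the tensor product is free on the two mixed tensors
(`Theory.two_squares`). Hence any two of the three suture elements form a basis of the same rank two
module. Writing one in terms of the other two, both coefficients must be units
(`exists_unit_relation`), and units may be absorbed into the suture elements.

The geometry is made explicit with cubes. The vertices are the cube roots of 1 (positive) and of -1
(negative). For a cube root of unity `u`, the chords are the zeros of `cheb (tcoord u z)`, the third
Chebyshev polynomial of the real part of `conj u * z`. On the unit circle this equals the real part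
of `z³` for every `u`, so the three families have the same signs on the boundary. In the plane
around the disc the outer sutures are the zeros of `re z³`, and connectedness fixes the signs of
their regions up to one global sign (`exists_signAt_outside`); the half turn `z ↦ -z` corrects that
sign (`exists_normalised_plane`). -/

theorem exists_unit_relation {R M : Type*} [CommRing R] [AddCommGroup M] [Module R M]
    {x y z : M} (hxy : LinearIndependent R ![x, y]) (hz : z ∈ Submodule.span R {x, y})
    (hx : x ∈ Submodule.span R {z, y}) (hy : y ∈ Submodule.span R {z, x}) :
    ∃ a b : Rˣ, (a : R) • x + (b : R) • y + z = 0 := by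
  rw [LinearIndependent.pair_iff] at hxy
  obtain ⟨a, b, rfl⟩ := Submodule.mem_span_pair.1 hz
  obtain ⟨p, q, hpq⟩ := Submodule.mem_span_pair.1 hx
  obtain ⟨r, s, hrs⟩ := Submodule.mem_span_pair.1 hy
  -- Substituting `z = a x + b y` into `x = p z + q y` and comparing coefficients of `x` gives `p a
  -- = 1`; likewise `r b = 1`. So `a` and `b` are units.
  have ha := (hxy (p * a - 1) (p * b + q)
    (by rw [← sub_eq_zero.2 hpq]; module)).1
  have hb := (hxy (r * a + s) (r * b - 1)
    (by rw [← sub_eq_zero.2 hrs]; module)).2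
  have ha' : a * p = 1 := by linear_combination ha
  have hb' : b * r = 1 := by linear_combination hb
  refine ⟨-Units.mkOfMulEqOne a p ha', -Units.mkOfMulEqOne b r hb', ?_⟩
  simp only [Units.val_neg, Units.val_mkOfMulEqOne]
  module

/-- Independence of the graded summands makes a homogeneous element of the module of a square a
multiple of the one basis vector of its degree, or zero. This lists the pure tensors of a given
total degree. -/
theorem IsGrading.eq_of_mem {R M : Type*} [Ring R] [AddCommGroup M] [Module R M]
    {gr : ℤ → Submodule R M} (h : IsGrading gr) {x₀ x₁ : M} (h₀ : x₀ ∈ gr (-1)) (h₁ : x₁ ∈ gr 1)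
    {n a b : ℤ} (hn : a • x₀ + b • x₁ ∈ gr n) :
    (n = -1 ∧ b • x₁ = 0) ∨ (n = 1 ∧ a • x₀ = 0) ∨ a • x₀ + b • x₁ = 0 := by
  have hi := h.1.submodule_iSupIndep
  by_cases h1 : n = -1
  · subst h1
    refine .inl ⟨rfl, ?_⟩
    have := (hi.pairwiseDisjoint (show (-1 : ℤ) ≠ 1 by decide))
    refine Submodule.disjoint_def.1 this _ ?_ (zsmul_mem h₁ _)
    simpa using sub_mem hn (zsmul_mem h₀ a)
  by_cases h2 : n = 1
  · subst h2
    refine .inr (.inl ⟨rfl, ?_⟩)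
    have := (hi.pairwiseDisjoint (show (-1 : ℤ) ≠ 1 by decide))
    refine Submodule.disjoint_def.1 this _ (zsmul_mem h₀ _) ?_
    simpa using sub_mem hn (zsmul_mem h₁ b)
  · refine .inr (.inr ?_)
    refine Submodule.disjoint_def.1 (hi n) _ hn (add_mem ?_ ?_)
    · exact Submodule.mem_iSup_of_mem (-1) (Submodule.mem_iSup_of_mem (Ne.symm h1) (zsmul_mem h₀ _))
    · exact Submodule.mem_iSup_of_mem 1 (Submodule.mem_iSup_of_mem (Ne.symm h2) (zsmul_mem h₁ _))

/-- Products of coordinate functionals, extended to `R`, separate the mixed tensors; this gives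
linear independence without a basis of the whole tensor product. -/
theorem exists_tensor_functional {R ι : Type*} [CommRing R] [Fintype ι] {V : ι → Type*}
    [∀ i, AddCommGroup (V i)] (α : ∀ i, V i →ₗ[ℤ] ℤ) :
    ∃ F : (R ⊗[ℤ] PiTensorProduct ℤ V) →ₗ[R] R,
      ∀ r x, F (r ⊗ₜ PiTensorProduct.tprod ℤ x) = r * ((∏ i, α i (x i) : ℤ) : R) := by
  refine ⟨(TensorProduct.AlgebraTensorModule.rid ℤ R R).toLinearMap ∘ₗ
    (PiTensorProduct.lift ((MultilinearMap.mkPiAlgebra ℤ ι ℤ).compLinearMap α)).baseChange R, ?_⟩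
  intro r x
  simp [PiTensorProduct.lift.tprod, mul_comm]

theorem exists_coord {V : Type*} [AddCommGroup V] {x₀ x₁ : V}
    (h : LinearIndependent ℤ ![x₀, x₁]) (hs : Submodule.span ℤ {x₀, x₁} = ⊤) :
    ∃ α₀ α₁ : V →ₗ[ℤ] ℤ, α₀ x₀ = 1 ∧ α₀ x₁ = 0 ∧ α₁ x₀ = 0 ∧ α₁ x₁ = 1 := by
  let b := Module.Basis.mk h (by rw [← hs]; simp [Matrix.range_cons, Set.pair_comm])
  have h0 : b 0 = x₀ := by simp [b]
  have h1 : b 1 = x₁ := by simp [b]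
  refine ⟨b.coord 0, b.coord 1, ?_, ?_, ?_, ?_⟩ <;> simp [← h0, ← h1]

/-- Each factor of a basic suture element is known only up to sign; the signs multiply to a single
one, which a unit of the coefficient ring absorbs. -/
theorem tprod_smul_or_neg {ι : Type*} [Fintype ι] {V : ι → Type*}
    [∀ i, AddCommGroup (V i)] {w x : ∀ i, V i} (h : ∀ i, x i = w i ∨ x i = -w i) :
    ∃ ε : ℤˣ, PiTensorProduct.tprod ℤ x = (ε : ℤ) • PiTensorProduct.tprod ℤ w := by
  have : ∀ i, ∃ ε : ℤˣ, x i = (ε : ℤ) • w i := fun i => by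
    rcases h i with h | h
    exacts [⟨1, by simp [h]⟩, ⟨-1, by simp [h]⟩]
  choose ε hε using this
  refine ⟨∏ i, ε i, ?_⟩
  rw [show x = fun i => (ε i : ℤ) • w i from funext hε, MultilinearMap.map_smul_univ]
  simp

/-- With two squares, total degree 0 forces one factor of degree 1 and one of degree -1, so the
degree 0 part is spanned by the two mixed tensors `W` and `W'`. Up to units these are the images of
the suture elements of `Γ` and `Γ'`. -/
theorem Theory.two_squares (𝒟 : Theory) {S : OccupiedSurface} (Q : Quadrangulation S)
    {p q : Q.ι} (hpq : p ≠ q) (hι : ∀ i, i = p ∨ i = q) {Γ Γ' : Sutures S}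
    {Δ Δ' : ∀ i, Sutures (Q.piece i)} (hΓ : Q.IsBasic Γ Δ) (hΓ' : Q.IsBasic Γ' Δ')
    (h₁ : (Δ (.inl p)).IsStdPos) (h₂ : (Δ (.inl q)).IsStdNeg)
    (h₁' : (Δ' (.inl p)).IsStdNeg) (h₂' : (Δ' (.inl q)).IsStdPos)
    {x y : 𝒟.V S} (hx : x ∈ 𝒟.c Γ) (hy : y ∈ 𝒟.c Γ') :
    LinearIndependent (CoeffRing S) ![x, y] ∧
      Submodule.span (CoeffRing S) {x, y} = 𝒟.gr S 0 := by
  classical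
  obtain ⟨Ψ, hc, hgr⟩ := 𝒟.tensor Q
  choose x₀ x₁ hneg hpos hli hspan hg₀ hg₁ using fun i => 𝒟.square _ (Q.isSquare i)
  choose α₀ α₁ h00 h01 h10 h11 using fun i => exists_coord (hli i) (hspan i)
  let w : ∀ i, 𝒟.V (Q.piece (.inl i)) := fun i => if i = p then x₁ i else x₀ i
  let w' : ∀ i, 𝒟.V (Q.piece (.inl i)) := fun i => if i = p then x₀ i else x₁ i
  let W : CoeffRing S ⊗[ℤ] PiTensorProduct ℤ fun i => 𝒟.V (Q.piece (.inl i)) :=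
    1 ⊗ₜ PiTensorProduct.tprod ℤ w
  let W' : CoeffRing S ⊗[ℤ] PiTensorProduct ℤ fun i => 𝒟.V (Q.piece (.inl i)) :=
    1 ⊗ₜ PiTensorProduct.tprod ℤ w'
  have key : ∀ (u : (CoeffRing S)ˣ) (ε : ℤˣ) (z : PiTensorProduct ℤ fun i =>
      𝒟.V (Q.piece (.inl i))), ∃ v : (CoeffRing S)ˣ,
        (u : CoeffRing S) ⊗ₜ[ℤ] ((ε : ℤ) • z) = (v : CoeffRing S) • ((1 : CoeffRing S) ⊗ₜ[ℤ] z) := by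
    intro u ε z
    rcases Int.units_eq_one_or ε with rfl | rfl
    · exact ⟨u, by simp [TensorProduct.smul_tmul']⟩
    · exact ⟨-u, by simp [TensorProduct.smul_tmul', TensorProduct.tmul_neg]⟩
  have hΨx : ∃ u : (CoeffRing S)ˣ, Ψ x = (u : CoeffRing S) • W := by
    have : Ψ x ∈ Ψ '' 𝒟.c Γ := mem_image_of_mem _ hx
    rw [hc Γ Δ hΓ] at this
    obtain ⟨u, x', hx', he⟩ := this
    obtain ⟨ε, hε⟩ := tprod_smul_or_neg (w := w) (x := x') (fun i => by
      have := hx' i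
      rcases hι i with rfl | rfl
      · rw [hpos _ _ h₁] at this
        simpa [w] using this
      · rw [hneg _ _ h₂] at this
        simpa [w, hpq.symm] using this)
    rw [he, hε]
    exact key _ _ _
  have hΨy : ∃ u : (CoeffRing S)ˣ, Ψ y = (u : CoeffRing S) • W' := by
    have : Ψ y ∈ Ψ '' 𝒟.c Γ' := mem_image_of_mem _ hy
    rw [hc Γ' Δ' hΓ'] at this
    obtain ⟨u, x', hx', he⟩ := this
    obtain ⟨ε, hε⟩ := tprod_smul_or_neg (w := w') (x := x') (fun i => by
      have := hx' i
      rcases hι i with rfl | rfl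
      · rw [hneg _ _ h₁'] at this
        simpa [w'] using this
      · rw [hpos _ _ h₂'] at this
        simpa [w', hpq.symm] using this)
    rw [he, hε]
    exact key _ _ _
  obtain ⟨u, hu⟩ := hΨx
  obtain ⟨u', hu'⟩ := hΨy
  have huniv : (Finset.univ : Finset Q.ι) = {p, q} := by
    ext i; simpa using hι i
  obtain ⟨F, hF⟩ := exists_tensor_functional (R := CoeffRing S) fun i => if i = p then α₁ i else α₀ i
  obtain ⟨F', hF'⟩ := exists_tensor_functional (R := CoeffRing S) fun i =>
    if i = p then α₀ i else α₁ i
  -- The two product functionals are dual to `W`, `W'`.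
  have hFW : F W = 1 ∧ F W' = 0 ∧ F' W = 0 ∧ F' W' = 1 := by
    simp only [W, W', hF, hF', huniv, Finset.prod_pair hpq]
    simp [w, w', hpq.symm, h00, h01, h10, h11]
  have hspanW : Submodule.span (CoeffRing S) {W, W'} = (𝒟.gr S 0).map Ψ.toLinearMap := by
    rw [hgr]
    apply le_antisymm
    · rw [Submodule.span_le]
      rintro _ (rfl | rfl) <;> apply Submodule.subset_span
      · refine ⟨fun i => if i = p then 1 else -1, w, ?_, ?_, rfl⟩
        · rw [huniv, Finset.sum_pair hpq]; simp [hpq.symm]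
        · intro i
          by_cases h : i = p
          · subst h; simpa [w] using hg₁ i
          · simpa [w, h] using hg₀ i
      · refine ⟨fun i => if i = p then -1 else 1, w', ?_, ?_, rfl⟩
        · rw [huniv, Finset.sum_pair hpq]; simp [hpq.symm]
        · intro i
          by_cases h : i = p
          · subst h; simpa [w'] using hg₀ i
          · simpa [w', h] using hg₁ i
    · rw [Submodule.span_le]
      rintro _ ⟨n, z, hn, hz, rfl⟩
      have hz' : ∀ i, (n i = -1 ∧ ∃ a : ℤ, z i = a • x₀ i) ∨ (n i = 1 ∧ ∃ a : ℤ, z i = a • x₁ i) ∨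
          z i = 0 := by
        intro i
        obtain ⟨a, b, hab⟩ := Submodule.mem_span_pair.1
          (show z i ∈ Submodule.span ℤ {x₀ i, x₁ i} by rw [hspan]; trivial)
        have h := hz i
        rw [← hab] at h ⊢
        rcases (𝒟.isGrading _).eq_of_mem (hg₀ i) (hg₁ i) h with ⟨h, h'⟩ | ⟨h, h'⟩ | h
        · exact .inl ⟨h, a, by simp [h']⟩
        · exact .inr (.inl ⟨h, b, by simp [h']⟩)
        · exact .inr (.inr h)
      have hzero : (∃ i, z i = 0) → (1 : CoeffRing S) ⊗ₜ[ℤ] PiTensorProduct.tprod ℤ z ∈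
          Submodule.span (CoeffRing S) {W, W'} := by
        rintro ⟨i, hi⟩
        rw [MultilinearMap.map_coord_zero _ i hi, TensorProduct.tmul_zero]
        exact zero_mem _
      have hmul : ∀ (v : ∀ i, 𝒟.V (Q.piece (.inl i))) (a b : ℤ), z p = a • v p → z q = b • v q →
          (1 : CoeffRing S) ⊗ₜ[ℤ] PiTensorProduct.tprod ℤ z =
            ((a * b : ℤ) : CoeffRing S) • ((1 : CoeffRing S) ⊗ₜ[ℤ] PiTensorProduct.tprod ℤ v) := by
        intro v a b ha hb
        have : z = fun i => (if i = p then a else b) • v i := by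
          funext i
          rcases hι i with rfl | rfl
          · simp [ha]
          · simp [hb, hpq.symm]
        rw [this, MultilinearMap.map_smul_univ, huniv, Finset.prod_pair hpq]
        simp only [if_true, if_neg hpq.symm, TensorProduct.tmul_smul]
        rw [Int.cast_smul_eq_zsmul]
      -- Equal degrees on the two squares would sum to -2 or 2. What remains is a multiple of `W` or
      -- `W'`, or a tensor with a zero factor.
      rw [huniv, Finset.sum_pair hpq] at hn
      rcases hz' p with ⟨hp, a, ha⟩ | ⟨hp, a, ha⟩ | hp
      · rcases hz' q with ⟨hq, b, hb⟩ | ⟨hq, b, hb⟩ | hq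
        · omega
        · rw [hmul w' a b (by simp [w', ha]) (by simp [w', hb, hpq.symm])]
          exact Submodule.smul_mem _ _ (Submodule.subset_span (by simp [W']))
        · exact hzero ⟨_, hq⟩
      · rcases hz' q with ⟨hq, b, hb⟩ | ⟨hq, b, hb⟩ | hq
        · rw [hmul w a b (by simp [w, ha]) (by simp [w, hb, hpq.symm])]
          exact Submodule.smul_mem _ _ (Submodule.subset_span (by simp [W]))
        · omega
        · exact hzero ⟨_, hq⟩
      · exact hzero ⟨_, hp⟩
  constructor
  · rw [LinearIndependent.pair_iff]
    intro s t hst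
    have := congrArg Ψ hst
    rw [map_add, map_smul, map_smul, hu, hu', map_zero] at this
    have e1 := congrArg F this
    have e2 := congrArg F' this
    simp only [map_add, map_smul, hFW, smul_eq_mul, mul_one, mul_zero, add_zero, zero_add,
      map_zero] at e1 e2
    exact ⟨(Units.mul_left_eq_zero u).1 e1, (Units.mul_left_eq_zero u').1 e2⟩
  · apply Submodule.map_injective_of_injective (f := Ψ.toLinearMap) Ψ.injective
    rw [← hspanW, Submodule.map_span, image_pair]
    simp only [LinearEquiv.coe_coe, hu, hu']
    apply le_antisymm
    · rw [Submodule.span_le]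
      rintro _ (rfl | rfl) <;> apply Submodule.smul_mem <;> apply Submodule.subset_span <;> simp
    · rw [Submodule.span_le]
      rintro _ (rfl | rfl)
      · exact Submodule.mem_span_pair.2 ⟨((u⁻¹ : (CoeffRing S)ˣ) : CoeffRing S), 0,
          by simp [smul_smul]⟩
      · exact Submodule.mem_span_pair.2 ⟨0, ((u'⁻¹ : (CoeffRing S)ˣ) : CoeffRing S),
          by simp [smul_smul]⟩

/-! ### Charts -/

theorem exists_subtype_chart {X Y : Type*} [TopologicalSpace X] [TopologicalSpace Y]
    (a : OpenPartialHomeomorph X Y) {A U : Set X} (hU : IsOpen U) (hUA : U ⊆ A) (x₀ : A) :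
    ∃ a' : OpenPartialHomeomorph A Y, a'.source = (↑) ⁻¹' (a.source ∩ U) ∧
      ∀ y, a' y = a y := by
  classical
  refine ⟨
    { toFun := fun y => a y
      invFun := fun w => if h : a.symm w ∈ A then ⟨a.symm w, h⟩ else x₀
      source := (↑) ⁻¹' (a.source ∩ U)
      target := a.target ∩ a.symm ⁻¹' U
      map_source' := fun y hy => ⟨a.map_source hy.1, by
        rw [mem_preimage, a.left_inv hy.1]; exact hy.2⟩
      map_target' := fun w hw => by
        rw [dif_pos (hUA hw.2)]; exact ⟨a.map_target hw.1, hw.2⟩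
      left_inv' := fun y hy => by
        have := a.left_inv hy.1
        simp [this]
      right_inv' := fun w hw => by
        rw [dif_pos (hUA hw.2)]; exact a.right_inv hw.1
      open_source := (a.open_source.inter hU).preimage continuous_subtype_val
      open_target := a.isOpen_inter_preimage_symm hU
      continuousOn_toFun := a.continuousOn.comp continuous_subtype_val.continuousOn
        fun y hy => hy.1
      continuousOn_invFun := by
        rw [Topology.IsInducing.subtypeVal.continuousOn_iff]
        refine (a.continuousOn_symm.mono inter_subset_left).congr fun w hw => ?_
        simp [hUA hw.2] }, rfl, fun y => rfl⟩

/-- Boundary charts of planar domains, and of the complement of a disc along its circle, are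
obtained in this way: it is enough to exhibit an ambient chart carrying the subset to the closed
upper half plane. -/
theorem exists_halfPlane_chart {X : Type*} [TopologicalSpace X]
    (a : OpenPartialHomeomorph X ℂ) {A : Set X} (h : ∀ y ∈ a.source, y ∈ A ↔ 0 ≤ (a y).im)
    (x₀ : A) :
    ∃ a' : OpenPartialHomeomorph A HalfPlane, a'.source = (↑) ⁻¹' a.source ∧
      ∀ y ∈ a'.source, (a' y : ℂ) = a y := by
  classical
  refine ⟨
    { toFun := fun y => if h : 0 ≤ (a y).im then ⟨a y, h⟩ else ⟨0, le_rfl⟩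
      invFun := fun w => if h : a.symm w ∈ A then ⟨a.symm w, h⟩ else x₀
      source := (↑) ⁻¹' a.source
      target := (↑) ⁻¹' a.target
      map_source' := fun y hy => by
        rw [dif_pos ((h y hy).1 y.2)]; exact a.map_source hy
      map_target' := fun w hw => by
        have : a.symm w ∈ A := (h _ (a.map_target hw)).2 (by rw [a.right_inv hw]; exact w.2)
        rw [dif_pos this]; exact a.map_target hw
      left_inv' := fun y hy => by
        have := a.left_inv hy
        simp [(h y hy).1 y.2, this]
      right_inv' := fun w hw => by
        have : a.symm w ∈ A := (h _ (a.map_target hw)).2 (by rw [a.right_inv hw]; exact w.2)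
        have h2 := a.right_inv hw
        simp [this, h2, w.2]
      open_source := a.open_source.preimage continuous_subtype_val
      open_target := a.open_target.preimage continuous_subtype_val
      continuousOn_toFun := by
        refine (Topology.IsInducing.subtypeVal
          (t := {z : ℂ | 0 ≤ z.im})).continuousOn_iff.2 ?_
        refine (a.continuousOn.comp continuous_subtype_val.continuousOn
          fun y hy => hy).congr fun y hy => ?_
        simp [(h y hy).1 y.2]
      continuousOn_invFun := by
        rw [Topology.IsInducing.subtypeVal.continuousOn_iff]
        refine (a.continuousOn_symm.comp continuous_subtype_val.continuousOn
          fun y hy => hy).congr fun w hw => ?_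
        have : a.symm w ∈ A := (h _ (a.map_target hw)).2 (by rw [a.right_inv hw]; exact w.2)
        simp [this] }, rfl, fun y hy => ?_⟩
  have : 0 ≤ (a y).im := (h y hy).1 y.2
  change ((if h : 0 ≤ (a y).im then ⟨a y, h⟩ else ⟨0, le_rfl⟩ : HalfPlane) : ℂ) = a y
  rw [dif_pos this]

theorem PosAt.congr {f g : ℂ → ℂ} {z : ℂ} (hf : PosAt f z) (h : f =ᶠ[𝓝 z] g) : PosAt g z := by
  obtain ⟨ε, hε, hb⟩ := Metric.eventually_nhds_iff.1 h
  unfold PosAt at *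
  filter_upwards [hf, Ioo_mem_nhdsGT hε] with r hr hrε
  obtain ⟨k, hk, hp, he⟩ := hr
  refine ⟨k, hk, hp, fun θ => ?_⟩
  rw [← hb (y := z) (by simpa using hε), ← hb (y := z + r * Complex.exp (θ * Complex.I)) ?_]
  · exact he θ
  · simp [Complex.norm_exp_ofReal_mul_I, abs_of_pos hrε.1, hrε.2]

theorem posAt_mul {u : ℂ} (hu : ‖u‖ = 1) (z : ℂ) : PosAt (fun w => u * w) z := by
  filter_upwards [self_mem_nhdsWithin] with r hr
  -- A rotation adds a constant to the angle.
  refine ⟨fun θ => θ + Complex.arg u, by fun_prop, by ring, fun θ => ?_⟩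
  have h1 : u = Complex.exp (Complex.arg u * Complex.I) := by
    conv_lhs => rw [← Complex.norm_mul_exp_arg_mul_I u, hu]
    simp
  have h2 : u * (z + r * Complex.exp (θ * Complex.I)) - u * z
      = r * (u * Complex.exp (θ * Complex.I)) := by ring
  rw [h2, norm_mul, norm_mul, hu, Complex.norm_exp_ofReal_mul_I]
  push_cast
  rw [add_mul, Complex.exp_add, ← h1]
  simp [abs_of_pos (show 0 < r from hr)]
  exact .inl (mul_comm _ _)

/-- The chart domain of `Φ` may be shrunk to an open set. -/
theorem exists_chart_restr {X Y : Type*} [TopologicalSpace X] [TopologicalSpace Y]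
    (a : OpenPartialHomeomorph X Y) {x : X} (hx : x ∈ a.source) {p : X → Prop}
    (hp : ∀ᶠ y in 𝓝 x, p y) :
    ∃ a' : OpenPartialHomeomorph X Y, x ∈ a'.source ∧ a'.source ⊆ a.source ∧
      (∀ y, a' y = a y) ∧ ∀ y ∈ a'.source, p y := by
  obtain ⟨U, hU, hUo, hxU⟩ := eventually_nhds_iff.1 hp
  exact ⟨a.restrOpen U hUo, ⟨hx, hxU⟩, inter_subset_left, fun _ => rfl, fun y hy => hU y hy.2⟩

/-! ### Charts of the plane -/

theorem exists_affine_homeomorph (a b c d s : ℝ) (h : a * d - b * c ≠ 0) :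
    ∃ Φ : ℂ ≃ₜ ℂ, ∀ z, (Φ z).re = a * z.re + b * z.im - s ∧ (Φ z).im = c * z.re + d * z.im := by
  refine ⟨
    { toFun := fun z => ⟨a * z.re + b * z.im - s, c * z.re + d * z.im⟩
      invFun := fun w => ⟨(d * (w.re + s) - b * w.im) / (a * d - b * c),
        (a * w.im - c * (w.re + s)) / (a * d - b * c)⟩
      left_inv := fun z => by
        apply Complex.ext <;> simp only <;> rw [div_eq_iff h] <;> ring
      right_inv := fun w => by
        generalize hD : a * d - b * c = D at h
        apply Complex.ext <;> simp only <;> field_simp <;> rw [← hD] <;> ring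
      continuous_toFun := by
        simp only [Complex.mk_eq_add_mul_I]; fun_prop
      continuous_invFun := by
        simp only [Complex.mk_eq_add_mul_I]; fun_prop }, fun z => ⟨rfl, rfl⟩⟩

/-- The chart `z ↦ re z + (1 - |z|²) i` of the upper half plane, which straightens the unit
circle. -/
def roundChart : OpenPartialHomeomorph ℂ ℂ where
  toFun z := ⟨z.re, 1 - (z.re ^ 2 + z.im ^ 2)⟩
  invFun w := ⟨w.re, √(1 - w.im - w.re ^ 2)⟩
  source := {z | 0 < z.im}
  target := {w | 0 < 1 - w.im - w.re ^ 2}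
  map_source' z hz := by
    simp only [mem_ofPred_eq] at *
    nlinarith
  map_target' w hw := Real.sqrt_pos.2 hw
  left_inv' z hz := by
    simp only [mem_ofPred_eq] at hz
    apply Complex.ext
    · rfl
    · simp only
      rw [show 1 - (1 - (z.re ^ 2 + z.im ^ 2)) - z.re ^ 2 = z.im ^ 2 by ring, Real.sqrt_sq hz.le]
  right_inv' w hw := by
    simp only [mem_ofPred_eq] at hw
    apply Complex.ext
    · rfl
    · simp only
      rw [Real.sq_sqrt hw.le]
      ring
  open_source := isOpen_lt continuous_const Complex.continuous_im
  open_target := isOpen_lt continuous_const (by fun_prop)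
  continuousOn_toFun := by
    simp only [Complex.mk_eq_add_mul_I]
    exact Continuous.continuousOn (by fun_prop)
  continuousOn_invFun := by
    simp only [Complex.mk_eq_add_mul_I]
    exact Continuous.continuousOn (by fun_prop)

/-- A chart straightening the unit circle, in which the real part is an affine coordinate. -/
theorem exists_round_chart {u : ℂ} (hu : ‖u‖ = 1) {z₀ : ℂ} (h : (u * z₀).im ≠ 0) (s : ℝ)
    {δ η : ℝ} (hδ : δ ≠ 0) (hη : η ≠ 0) :
    ∃ Φ : OpenPartialHomeomorph ℂ ℂ, z₀ ∈ Φ.source ∧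
      ∀ z, (Φ z).re = δ * ((u * z).re - s) ∧ (Φ z).im = η * (1 - ‖z‖ ^ 2) := by
  have hu' : u.re * u.re + u.im * u.im = 1 := by
    rw [← Complex.normSq_apply, Complex.normSq_eq_norm_sq, hu]; norm_num
  -- `roundChart` is defined only above the real axis. After rotation by `u`, a reflection (`ε =
  -- -1`) is inserted when `z₀` lands below it; neither changes the norm or the real part of `u *
  -- z`.
  obtain ⟨ε, hε, hε0⟩ : ∃ ε : ℝ, ε ^ 2 = 1 ∧ 0 < ε * (u * z₀).im := by
    rcases lt_or_gt_of_ne h with h | h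
    · exact ⟨-1, by norm_num, by linarith⟩
    · exact ⟨1, by norm_num, by linarith⟩
  obtain ⟨L, hL⟩ := exists_affine_homeomorph u.re (-u.im) (ε * u.im) (ε * u.re) 0 (by
    have : u.re * (ε * u.re) - -u.im * (ε * u.im) = ε := by linear_combination ε * hu'
    rw [this]; rintro rfl; norm_num at hε)
  obtain ⟨L', hL'⟩ := exists_affine_homeomorph δ 0 0 η (δ * s) (by simp [hδ, hη])
  refine ⟨(L.toOpenPartialHomeomorph.trans roundChart).trans L'.toOpenPartialHomeomorph, ?_, ?_⟩
  · have : 0 < (L z₀).im := by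
      rw [(hL z₀).2]
      simp only [Complex.mul_im] at hε0
      linarith
    simpa [roundChart] using this
  · intro z
    have h1 : (((L.toOpenPartialHomeomorph.trans roundChart).trans
      L'.toOpenPartialHomeomorph) z) = L' (roundChart (L z)) := rfl
    have h2 : (roundChart (L z)).re = (L z).re := rfl
    have h3 : (roundChart (L z)).im = 1 - ((L z).re ^ 2 + (L z).im ^ 2) := rfl
    rw [h1, (hL' _).1, (hL' _).2, h2, h3, (hL z).1, (hL z).2, ← Complex.normSq_eq_norm_sq,
      Complex.normSq_apply]
    simp only [Complex.mul_re]
    refine ⟨by ring, ?_⟩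
    linear_combination -η * (z.re ^ 2 + z.im ^ 2) * hu' - η * (u.im * z.re + u.re * z.im) ^ 2 * hε

/-- Charts straightening the frontier of a convex body in the plane. -/
theorem exists_frontier_chart {K : Set ℂ} (hK : Convex ℝ K) (hKc : IsCompact K)
    (hKi : (interior K).Nonempty) {z₀ : ℂ} (hz₀ : z₀ ∈ frontier K) :
    ∃ Φ : OpenPartialHomeomorph ℂ ℂ, z₀ ∈ Φ.source ∧
      ∀ z ∈ Φ.source, (z ∈ K ↔ 0 ≤ (Φ z).im) ∧ (z ∈ frontier K ↔ (Φ z).im = 0) := by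
  -- A homeomorphism of the plane carries the convex body to the unit disc, which leaves only the
  -- round case.
  obtain ⟨g, -, hcl, hfr⟩ :=
    exists_homeomorph_image_interior_closure_frontier_eq_unitBall hK hKi hKc.isBounded
  rw [hKc.isClosed.closure_eq] at hcl
  have h1 : ∀ z, z ∈ K ↔ ‖g z‖ ≤ 1 := fun z => by
    rw [← mem_closedBall_zero_iff, ← hcl, g.injective.mem_set_image]
  have h2 : ∀ z, z ∈ frontier K ↔ ‖g z‖ = 1 := fun z => by
    rw [← mem_sphere_zero_iff_norm, ← hfr, g.injective.mem_set_image]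
  have hg : ‖g z₀‖ = 1 := (h2 _).1 hz₀
  -- This rotation takes `g z₀` to `I`, away from the real axis.
  obtain ⟨Φ, hΦ, hΦ'⟩ := exists_round_chart (u := Complex.I * (starRingEnd ℂ) (g z₀))
    (by simp [hg]) (z₀ := g z₀) (by
      rw [mul_assoc, ← Complex.normSq_eq_conj_mul_self, Complex.normSq_eq_norm_sq, hg]; simp)
    0 one_ne_zero one_ne_zero
  refine ⟨g.toOpenPartialHomeomorph.trans Φ, by simpa using hΦ, fun z _ => ?_⟩
  have : (g.toOpenPartialHomeomorph.trans Φ) z = Φ (g z) := rfl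
  rw [this, (hΦ' _).2, h1, h2]
  have hn := norm_nonneg (g z)
  constructor
  · constructor <;> intro h <;> nlinarith
  · constructor <;> intro h
    · rw [h]; norm_num
    · nlinarith

/-! ### The cubic `4s³ - 3s` -/

/-- The third Chebyshev polynomial. -/
def cheb (s : ℝ) : ℝ := 4 * s ^ 3 - 3 * s

@[fun_prop]
theorem continuous_cheb : Continuous cheb := by unfold cheb; fun_prop

theorem cheb_eq_zero {s : ℝ} (h : cheb s = 0) : s = 0 ∨ s ^ 2 = 3 / 4 := by
  have : s * (s ^ 2 - 3 / 4) = 0 := by unfold cheb at h; linear_combination h / 4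
  rcases mul_eq_zero.1 this with h | h
  · exact .inl h
  · exact .inr (by linarith)

/-- Near a root, the sign of `cheb` is that of `δ (s - s₀)` for some `δ = ±1`. -/
theorem cheb_sign_near {s₀ : ℝ} (h : cheb s₀ = 0) :
    ∃ δ : ℝ, δ ≠ 0 ∧ ∀ᶠ s in 𝓝 s₀, (0 < cheb s ↔ 0 < δ * (s - s₀)) ∧
      (cheb s < 0 ↔ δ * (s - s₀) < 0) := by
  -- The difference quotient of `cheb` at its root `s₀`. Its value there is `12 s₀² - 3`, the
  -- derivative, which is non-zero because the roots are simple; `δ` is its sign.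
  let q : ℝ → ℝ := fun s => 4 * (s ^ 2 + s * s₀ + s₀ ^ 2) - 3
  have hq : ∀ s, cheb s = q s * (s - s₀) := fun s => by
    unfold cheb at *; simp only [q]; linear_combination h
  have hq0 : q s₀ ≠ 0 := by
    simp only [q]
    rcases cheb_eq_zero h with h | h
    · rw [h]; norm_num
    · rw [show 4 * (s₀ ^ 2 + s₀ * s₀ + s₀ ^ 2) - 3 = 12 * s₀ ^ 2 - 3 by ring, h]; norm_num
  have hqc : Continuous q := by simp only [q]; fun_prop
  rcases lt_or_gt_of_ne hq0 with h0 | h0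
  · refine ⟨-1, by norm_num, ?_⟩
    filter_upwards [hqc.continuousAt.eventually_lt_const h0] with s hs
    rw [hq]
    constructor <;> constructor <;> intro h' <;> nlinarith
  · refine ⟨1, one_ne_zero, ?_⟩
    filter_upwards [hqc.continuousAt.eventually_const_lt h0] with s hs
    rw [hq]
    constructor <;> constructor <;> intro h' <;> nlinarith

/-- The linear coordinate transverse to the chords in the direction of `u`. -/
def tcoord (u z : ℂ) : ℝ := ((starRingEnd ℂ) u * z).re

@[fun_prop]
theorem continuous_tcoord (u : ℂ) : Continuous (tcoord u) := by unfold tcoord; fun_prop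

theorem tcoord_eq (u z : ℂ) : tcoord u z = u.re * z.re + u.im * z.im := by
  simp [tcoord]

theorem norm_of_cube_eq_one {u : ℂ} (hu : u ^ 3 = 1) : ‖u‖ = 1 := by
  have : ‖u‖ ^ 3 = 1 := by rw [← norm_pow, hu, norm_one]
  exact (pow_eq_one_iff_of_nonneg (norm_nonneg _) (by norm_num)).1 this

/-- On the unit circle, `cheb (tcoord u z)` is the real part of `z³`, for each cube root of
unity `u`. -/
theorem cheb_tcoord {u z : ℂ} (hu : u ^ 3 = 1) (hz : ‖z‖ = 1) :
    cheb (tcoord u z) = (z ^ 3).re := by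
  have hn := norm_of_cube_eq_one hu
  -- `w` lies on the unit circle and has the same cube as `z`, so the triple angle formula for `w`
  -- gives the claim.
  set w := (starRingEnd ℂ) u * z with hw
  have hw3 : w ^ 3 = z ^ 3 := by
    rw [hw, mul_pow, ← map_pow, hu, map_one, one_mul]
  have hwn : w.re * w.re + w.im * w.im = 1 := by
    rw [← Complex.normSq_apply, Complex.normSq_eq_norm_sq, hw, norm_mul, Complex.norm_conj, hn, hz]
    norm_num
  rw [← hw3]
  have : tcoord u z = w.re := rfl
  rw [this, cheb]
  simp only [pow_succ, pow_zero, one_mul, Complex.mul_re, Complex.mul_im]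
  linear_combination (3 * w.re) * hwn

/-- An interior chart straightening the sutures. -/
theorem exists_tcoord_chart {u : ℂ} (hu : u ^ 3 = 1) {z₀ : ℂ} (h : cheb (tcoord u z₀) = 0) :
    ∃ Φ : OpenPartialHomeomorph ℂ ℂ, z₀ ∈ Φ.source ∧
      ∀ z ∈ Φ.source, (0 < cheb (tcoord u z) ↔ 0 < (Φ z).im) ∧
        (cheb (tcoord u z) < 0 ↔ (Φ z).im < 0) := by
  obtain ⟨δ, hδ, hs⟩ := cheb_sign_near h
  have hu' : u.re * u.re + u.im * u.im = 1 := by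
    rw [← Complex.normSq_apply, Complex.normSq_eq_norm_sq, norm_of_cube_eq_one hu]; norm_num
  obtain ⟨L, hL⟩ := exists_affine_homeomorph (δ * u.re) (δ * u.im) (-u.im) u.re
    (δ * tcoord u z₀) (by
      rw [show δ * u.re * u.re - δ * u.im * -u.im = δ by linear_combination δ * hu']; exact hδ)
  -- Swaps the coordinates: `L` has the transverse coordinate in its real part, but an interior
  -- suture chart needs it in the imaginary part.
  obtain ⟨L', hL'⟩ := exists_affine_homeomorph 0 1 1 0 0 (by norm_num)
  obtain ⟨Φ, h1, -, h2, h3⟩ := exists_chart_restr (L.trans L').toOpenPartialHomeomorph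
    (x := z₀) (mem_univ _) ((continuous_tcoord u).continuousAt.eventually hs)
  refine ⟨Φ, h1, fun z hz => ?_⟩
  have : (Φ z).im = δ * (tcoord u z - tcoord u z₀) := by
    rw [h2]
    change (L' (L z)).im = _
    rw [(hL' _).2, (hL _).1, tcoord_eq u z]; ring
  rw [this]
  exact h3 z hz

/-- A boundary chart straightening both the unit circle and the sutures. -/
theorem exists_tcoord_round_chart {u : ℂ} (hu : u ^ 3 = 1) {z₀ : ℂ} (hz₀ : ‖z₀‖ = 1)
    (h : cheb (tcoord u z₀) = 0) :
    ∃ Φ : OpenPartialHomeomorph ℂ ℂ, z₀ ∈ Φ.source ∧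
      ∀ z ∈ Φ.source, (‖z‖ ≤ 1 ↔ 0 ≤ (Φ z).im) ∧ (‖z‖ = 1 ↔ (Φ z).im = 0) ∧
        (0 < cheb (tcoord u z) ↔ 0 < (Φ z).re) ∧ (cheb (tcoord u z) < 0 ↔ (Φ z).re < 0) := by
  obtain ⟨δ, hδ, hs⟩ := cheb_sign_near h
  have hn := norm_of_cube_eq_one hu
  -- Transversality: tangency to the circle would mean `tcoord u z₀ = ±1`, which is not a root of
  -- `cheb`.
  have hw : ((starRingEnd ℂ) u * z₀).im ≠ 0 := by
    intro him
    have h1 : ‖(starRingEnd ℂ) u * z₀‖ ^ 2 = 1 := by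
      rw [norm_mul, Complex.norm_conj, hn, hz₀]; norm_num
    rw [← Complex.normSq_eq_norm_sq, Complex.normSq_apply, him] at h1
    have h2 : tcoord u z₀ * tcoord u z₀ = 1 := by simpa [tcoord] using h1
    rcases cheb_eq_zero h with h3 | h3 <;> nlinarith
  obtain ⟨Ψ, hΨ0, hΨ⟩ := exists_round_chart (u := (starRingEnd ℂ) u) (by simpa using hn) hw
    (tcoord u z₀) hδ one_ne_zero
  obtain ⟨Φ, h1, -, h2, h3⟩ := exists_chart_restr Ψ hΨ0
    ((continuous_tcoord u).continuousAt.eventually hs)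
  refine ⟨Φ, h1, fun z hz => ?_⟩
  have hre : (Φ z).re = δ * (tcoord u z - tcoord u z₀) := by rw [h2, (hΨ z).1]; rfl
  have him : (Φ z).im = 1 - ‖z‖ ^ 2 := by rw [h2, (hΨ z).2, one_mul]
  have hnn := norm_nonneg z
  rw [hre, him]
  refine ⟨⟨fun h => by nlinarith, fun h => by nlinarith⟩, ⟨fun h => by rw [h]; norm_num,
    fun h => by nlinarith⟩, h3 z hz⟩

/-! ### The edges of the hexagon -/

instance finite_cubeRoots : Finite {u : ℂ // u ^ 3 = 1} :=
  Set.Finite.to_subtype <| ((Polynomial.nthRoots 3 (1 : ℂ)).toFinset.finite_toSet).subset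
    fun u (hu : u ^ 3 = 1) => by simpa [Polynomial.mem_nthRoots] using hu

/-- The sign encoded by a Boolean. -/
def sg (b : Bool) : ℝ := if b then 1 else -1

theorem sg_sq (b : Bool) : sg b ^ 2 = 1 := by cases b <;> simp [sg]

theorem sg_ne_zero (b : Bool) : sg b ≠ 0 := by cases b <;> simp [sg]

theorem sg_mul_self (b : Bool) : sg b * sg b = 1 := by cases b <;> simp [sg]

/-- The index set of the boundary edges of the hexagon: each ends at a cube root of unity,
reaching it from one of two sides. -/
abbrev HexEdge : Type := {u : ℂ // u ^ 3 = 1} × Bool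

/-- The boundary edges of the hexagon. -/
def arc (i : HexEdge) (t : ℝ) : ℂ :=
  i.1 * Complex.exp ((sg i.2 * ((1 - t) * Real.pi / 3) : ℝ) * Complex.I)

theorem norm_arc (i : HexEdge) (t : ℝ) : ‖arc i t‖ = 1 := by
  rw [arc, norm_mul, norm_of_cube_eq_one i.1.2, Complex.norm_exp_ofReal_mul_I, one_mul]

/-- Cubing spreads each edge over half of the unit circle, from -1 to 1. The parameter is then
determined by the real part of the cube, the Boolean by the sign of its imaginary part, and the cube
root by what is left; injectivity and disjointness of the edges follow. -/
theorem arc_cube (i : HexEdge) (t : ℝ) :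
    arc i t ^ 3 = Complex.exp ((sg i.2 * ((1 - t) * Real.pi) : ℝ) * Complex.I) := by
  rw [arc, mul_pow, i.1.2, one_mul, ← Complex.exp_nat_mul]
  congr 1
  push_cast
  ring

theorem arc_cube_re (i : HexEdge) (t : ℝ) : (arc i t ^ 3).re = Real.cos ((1 - t) * Real.pi) := by
  rw [arc_cube, Complex.exp_ofReal_mul_I_re]
  cases i.2 <;> simp [sg]

theorem arc_cube_im (i : HexEdge) (t : ℝ) :
    (arc i t ^ 3).im = sg i.2 * Real.sin ((1 - t) * Real.pi) := by
  rw [arc_cube, Complex.exp_ofReal_mul_I_im]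
  cases i.2 <;> simp [sg]

theorem arc_param_inj {i j : HexEdge} {s t : ℝ} (hs : s ∈ Icc (0 : ℝ) 1) (ht : t ∈ Icc (0 : ℝ) 1)
    (h : arc i s = arc j t) : s = t := by
  have h1 := congrArg (fun z : ℂ => (z ^ 3).re) h
  simp only [arc_cube_re] at h1
  have hpi := Real.pi_pos
  have := Real.injOn_cos ⟨by nlinarith [hs.2], by nlinarith [hs.1]⟩
    ⟨by nlinarith [ht.2], by nlinarith [ht.1]⟩ h1
  nlinarith [mul_right_cancel₀ hpi.ne' this]

theorem sin_param_pos {s : ℝ} (hs : s ∈ Ioo (0 : ℝ) 1) : 0 < Real.sin ((1 - s) * Real.pi) := by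
  have hpi := Real.pi_pos
  exact Real.sin_pos_of_pos_of_lt_pi (by nlinarith [hs.2]) (by nlinarith [hs.1])

theorem arc_index_inj {i j : HexEdge} {s t : ℝ} (hs : s ∈ Ioo (0 : ℝ) 1)
    (ht : t ∈ Icc (0 : ℝ) 1) (h : arc i s = arc j t) : i = j := by
  obtain rfl := arc_param_inj (Ioo_subset_Icc_self hs) ht h
  have h1 := congrArg (fun z : ℂ => (z ^ 3).im) h
  simp only [arc_cube_im] at h1
  have h2 : sg i.2 = sg j.2 := mul_right_cancel₀ (sin_param_pos hs).ne' h1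
  have h3 : i.2 = j.2 := by
    cases hi : i.2 <;> cases hj : j.2 <;> simp [hi, hj, sg] at h2 ⊢ <;> norm_num at h2
  rw [arc, arc, h3] at h
  exact Prod.ext (Subtype.ext (mul_right_cancel₀ (Complex.exp_ne_zero _) h)) h3

/-- The absolute value of `arg z³` gives the parameter, its sign the side, and dividing `z` by the
resulting exponential the cube root of unity. -/
theorem exists_arc_eq {z : ℂ} (hz : ‖z‖ = 1) : ∃ i, ∃ t ∈ Icc (0 : ℝ) 1, arc i t = z := by
  obtain ⟨b, hb⟩ : ∃ b : Bool, |Complex.arg (z ^ 3)| = sg b * Complex.arg (z ^ 3) := by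
    rcases abs_choice (Complex.arg (z ^ 3)) with h | h
    · exact ⟨true, by simp [sg, h]⟩
    · exact ⟨false, by simp [sg, h]⟩
  have hpi := Real.pi_pos
  set t := 1 - |Complex.arg (z ^ 3)| / Real.pi with ht
  have h1 : (1 - t) * Real.pi = |Complex.arg (z ^ 3)| := by rw [ht]; field_simp; ring
  have h2 : z ^ 3 = Complex.exp ((sg b * ((1 - t) * Real.pi) : ℝ) * Complex.I) := by
    rw [h1, hb, ← mul_assoc, sg_mul_self, one_mul]
    conv_lhs => rw [← Complex.norm_mul_exp_arg_mul_I (z ^ 3), norm_pow, hz]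
    simp
  have h3 : z * Complex.exp (-((sg b * ((1 - t) * Real.pi / 3) : ℝ) * Complex.I)) *
      Complex.exp ((sg b * ((1 - t) * Real.pi / 3) : ℝ) * Complex.I) = z := by
    rw [mul_assoc, ← Complex.exp_add]; simp
  refine ⟨(⟨z * Complex.exp (-((sg b * ((1 - t) * Real.pi / 3) : ℝ) * Complex.I)), ?_⟩, b), t,
    ⟨?_, ?_⟩, h3⟩
  · rw [mul_pow, h2, ← Complex.exp_nat_mul, ← Complex.exp_add]
    rw [← Complex.exp_zero]
    congr 1
    push_cast
    ring
  · have := Complex.abs_arg_le_pi (z ^ 3)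
    rw [ht, sub_nonneg, div_le_one hpi]
    exact this
  · rw [ht]
    have : 0 ≤ |Complex.arg (z ^ 3)| / Real.pi := by positivity
    linarith

@[fun_prop]
theorem continuous_arc (i : HexEdge) : Continuous (arc i) := by unfold arc; fun_prop

/-- The boundary edges of the hexagon, together with the diameter on the real axis. -/
def edgeMap : Option HexEdge → C(I, ℂ)
  | some i => ⟨fun t => arc i t, by fun_prop⟩
  | none => ⟨fun t => ((2 * t - 1 : ℝ) : ℂ), by fun_prop⟩

theorem edgeMap_some (i : HexEdge) (t : I) : edgeMap (some i) t = arc i t := rfl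

theorem edgeMap_none (t : I) : edgeMap none t = ((2 * t - 1 : ℝ) : ℂ) := rfl

/-- A real point has real cube, whereas the cube of a point inside an edge is not real. So the
diameter can meet the edges only at their endpoints. -/
theorem arc_im_ne_zero (i : HexEdge) {t : ℝ} (ht : t ∈ Ioo (0 : ℝ) 1) : (arc i t).im ≠ 0 := by
  intro h
  have h1 := norm_arc i t
  have h2 : (arc i t ^ 3).im = 0 := by
    simp only [pow_succ, pow_zero, one_mul, Complex.mul_im, Complex.mul_re, h]
    ring
  rw [arc_cube_im] at h2
  rcases mul_eq_zero.1 h2 with h3 | h3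
  · exact sg_ne_zero _ h3
  · exact (sin_param_pos ht).ne' h3

theorem edgeMap_norm_lt (t : I) (ht : t ∈ Ioo (0 : I) 1) : ‖edgeMap none t‖ < 1 := by
  rw [edgeMap_none, Complex.norm_real, Real.norm_eq_abs, abs_lt]
  have h0 : (0 : ℝ) < t := ht.1
  have h1 : (t : ℝ) < 1 := ht.2
  constructor <;> linarith

theorem edgeMap_disjoint {i j : Option HexEdge} (hij : i ≠ j) {s : I} (hs : s ∈ Ioo (0 : I) 1)
    (t : I) : edgeMap i s ≠ edgeMap j t := by
  intro h
  rcases i with _ | i <;> rcases j with _ | j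
  · exact hij rfl
  · have := edgeMap_norm_lt s hs
    rw [h, edgeMap_some, norm_arc] at this
    exact lt_irrefl _ this
  · apply arc_im_ne_zero i (t := s) ⟨hs.1, hs.2⟩
    rw [← edgeMap_some, h, edgeMap_none, Complex.ofReal_im]
  · exact hij (congrArg some (arc_index_inj (s := s) (t := t) ⟨hs.1, hs.2⟩ t.2 h))

theorem edgeMap_injective (i : Option HexEdge) : Function.Injective (edgeMap i) := by
  intro s t h
  rcases i with _ | i
  · rw [edgeMap_none, edgeMap_none, Complex.ofReal_inj] at h
    exact Subtype.ext (by linarith)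
  · exact Subtype.ext (arc_param_inj s.2 t.2 h)

/-- The sign of a vertex is its cube, so every condition that vertices of opposite sign stay apart
reduces to `-1 ≠ 1`. -/
theorem edgeMap_zero_cube (i : Option HexEdge) : edgeMap i 0 ^ 3 = -1 := by
  rcases i with _ | i
  · rw [edgeMap_none]; norm_num
  · rw [edgeMap_some, arc_cube]
    cases i.2
    · simp [sg, Complex.exp_neg]
    · simp [sg]

theorem edgeMap_one_cube (i : Option HexEdge) : edgeMap i 1 ^ 3 = 1 := by
  rcases i with _ | i
  · rw [edgeMap_none]; norm_num
  · rw [edgeMap_some, arc_cube]; simp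

theorem cubeRoot_ne_one {u : ℂ} (hu : u ^ 3 = 1) (h : u ≠ 1) : u.re = -1 / 2 ∧ u.im ^ 2 = 3 / 4 := by
  have h1 : u ^ 2 + u + 1 = 0 := by
    have : (u - 1) * (u ^ 2 + u + 1) = 0 := by linear_combination hu
    exact (mul_eq_zero.1 this).resolve_left (sub_ne_zero.2 h)
  have hre := congrArg Complex.re h1
  have him := congrArg Complex.im h1
  simp only [pow_two, Complex.add_re, Complex.add_im, Complex.mul_re, Complex.mul_im,
    Complex.one_re, Complex.one_im, Complex.zero_re, Complex.zero_im] at hre him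
  have h2 : u.im * (2 * u.re + 1) = 0 := by linarith
  rcases mul_eq_zero.1 h2 with h3 | h3
  · rw [h3] at hre; nlinarith [sq_nonneg (u.re + 1 / 2)]
  · have h4 : u.re = -1 / 2 := by linarith
    refine ⟨h4, ?_⟩
    rw [h4] at hre
    linarith

theorem cheb_tcoord_ofReal {u : ℂ} (hu : u ^ 3 = 1) (h : u ≠ 1) (x : ℝ) :
    cheb (tcoord u x) = x * (3 - x ^ 2) / 2 := by
  rw [tcoord_eq, (cubeRoot_ne_one hu h).1, cheb]
  simp
  ring

/-- On the circle, `re z³` vanishes once along each edge. On the diameter, `u ≠ 1` gives `tcoord u x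
= -x/2`, which reaches only the root 0 of `cheb`; for `u = 1` there would be three crossings, so the
diameter must then be excluded. -/
theorem cheb_tcoord_edgeMap {u : ℂ} (hu : u ^ 3 = 1) {i : Option HexEdge}
    (hi : i = none → u ≠ 1) :
    0 < cheb (tcoord u (edgeMap i 1)) ∧ cheb (tcoord u (edgeMap i 0)) < 0 ∧
      ∀ t, cheb (tcoord u (edgeMap i t)) = 0 ↔ t = mid := by
  rcases i with _ | i
  · simp only [edgeMap_none, cheb_tcoord_ofReal hu (hi rfl)]
    refine ⟨by norm_num, by norm_num, fun t => ?_⟩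
    have h0 := t.2.1
    have h1 := t.2.2
    rw [div_eq_zero_iff, or_iff_left two_ne_zero, mul_eq_zero, or_iff_left (by nlinarith)]
    refine ⟨fun h => Subtype.ext ?_, ?_⟩
    · simp only [mid]; linarith
    · rintro rfl; simp [mid]
  · simp only [edgeMap_some, cheb_tcoord hu (norm_arc _ _), arc_cube_re]
    refine ⟨by simp, by simp, fun t => ⟨fun h => ?_, ?_⟩⟩
    · have hpi := Real.pi_pos
      have := Real.injOn_cos (x₁ := (1 - t) * Real.pi) (x₂ := Real.pi / 2)
        ⟨by nlinarith [t.2.2], by nlinarith [t.2.1]⟩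
        ⟨by positivity, by linarith⟩ (by rw [h, Real.cos_pi_div_two])
      refine Subtype.ext ?_
      simp only [mid]
      nlinarith
    · rintro rfl
      rw [show (1 - (mid : ℝ)) * Real.pi = Real.pi / 2 by simp only [mid]; ring,
        Real.cos_pi_div_two]

/-! ### Convex planar occupied surfaces -/

/-- A convex body in the plane, bounded by some of the edges of the hexagon and the diameter. -/
structure PlanarDomain where
  carrier : Set ℂ
  convex : Convex ℝ carrier
  isCompact : IsCompact carrier
  nonempty_interior : (interior carrier).Nonempty
  edges : Set (Option HexEdge)
  frontier_eq : frontier carrier = ⋃ i ∈ edges, range (edgeMap i)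

namespace PlanarDomain

variable (P : PlanarDomain)

theorem frontier_subset : frontier P.carrier ⊆ P.carrier := P.isCompact.isClosed.frontier_subset

theorem edgeMap_mem_frontier {i : Option HexEdge} (hi : i ∈ P.edges) (t : I) :
    edgeMap i t ∈ frontier P.carrier := by
  rw [P.frontier_eq]
  exact mem_biUnion hi (mem_range_self t)

theorem mem_interior_or_frontier {z : ℂ} (hz : z ∈ P.carrier) :
    z ∈ interior P.carrier ∨ z ∈ frontier P.carrier := by
  by_cases h : z ∈ interior P.carrier
  · exact .inl h
  · exact .inr ⟨subset_closure hz, h⟩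

/-- The boundary edges. -/
def edge (i : P.edges) : C(I, P.carrier) :=
  ⟨fun t => ⟨edgeMap i t, P.frontier_subset (P.edgeMap_mem_frontier i.2 t)⟩, by fun_prop⟩

theorem mem_iUnion_range_edge (x : P.carrier) :
    x ∈ ⋃ i, range (P.edge i) ↔ (x : ℂ) ∈ frontier P.carrier := by
  rw [P.frontier_eq]
  simp only [mem_iUnion, mem_range, edge, Subtype.ext_iff, ContinuousMap.coe_mk]
  simp

/-- The occupied surface on a planar domain. -/
def toSurface : OccupiedSurface where
  carrier := P.carrier
  compact := isCompact_iff_compactSpace.1 P.isCompact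
  Edge := P.edges
  edge := P.edge
  edge_injective i s t h := edgeMap_injective i (congrArg Subtype.val h)
  edge_disjoint i j hij s hs t h := edgeMap_disjoint (fun h => hij (Subtype.ext h)) hs t
    (congrArg Subtype.val h)
  sign_ne i j h := by
    have : edgeMap i 0 = edgeMap j 1 := congrArg Subtype.val h
    have h2 := edgeMap_zero_cube i
    rw [this, edgeMap_one_cube] at h2
    norm_num at h2
  boundary_chart x hx := by
    obtain ⟨Φ, h1, h2⟩ := exists_frontier_chart P.convex P.isCompact P.nonempty_interior
      ((P.mem_iUnion_range_edge x).1 hx)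
    obtain ⟨a, ha, ha'⟩ := exists_halfPlane_chart Φ (fun y hy => (h2 y hy).1) x
    have hs : ∀ y, y ∈ a.source ↔ (y : ℂ) ∈ Φ.source := fun y => by rw [ha]; rfl
    refine ⟨a, (hs x).2 h1, fun y hy => ?_⟩
    rw [P.mem_iUnion_range_edge, ha' y hy]
    exact (h2 y ((hs y).1 hy)).2
  -- Only restrictions of the identity of `ℂ` are admitted, so all transition maps are locally the
  -- identity.
  atlas := {a | (∀ y ∈ a.source, (y : ℂ) ∈ interior P.carrier) ∧ ∀ y ∈ a.source, a y = y}
  atlas_interior a ha := by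
    rw [Set.disjoint_left]
    intro y hy h
    rw [P.mem_iUnion_range_edge] at h
    exact h.2 (ha.1 y hy)
  atlas_cover x hx := by
    rw [P.mem_iUnion_range_edge] at hx
    have hx' := (P.mem_interior_or_frontier x.2).resolve_right hx
    obtain ⟨a, ha, ha'⟩ := exists_subtype_chart (OpenPartialHomeomorph.refl ℂ)
      isOpen_interior (interior_subset (s := P.carrier)) x
    refine ⟨a, ⟨fun y hy => ?_, fun y _ => ha' y⟩, ?_⟩
    · rw [ha] at hy; exact hy.2
    · rw [ha]; exact ⟨mem_univ _, hx'⟩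
  atlas_oriented a ha b hb x hx := by
    have h1 : PosAt id (a x) := by simpa [Function.id_def] using posAt_mul (u := 1) (by simp) (a x)
    refine h1.congr ?_
    have hc : ∀ᶠ z in 𝓝 (a x), a.symm z ∈ b.source := by
      refine (a.continuousAt_symm (a.map_source hx.1)).eventually_mem ?_
      rw [a.left_inv hx.1]
      exact b.open_source.mem_nhds hx.2
    filter_upwards [hc, a.open_target.mem_nhds (a.map_source hx.1)] with z hz hz'
    simp only [id_eq, Function.comp_apply]
    rw [hb.2 _ hz, ← ha.2 _ (a.map_target hz'), a.right_inv hz']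
  component_boundary x := by
    have : PreconnectedSpace P.carrier :=
      Subtype.preconnectedSpace P.convex.isPreconnected
    rw [PreconnectedSpace.connectedComponent_eq_univ, univ_inter]
    obtain ⟨z, hz⟩ : (frontier P.carrier).Nonempty := by
      refine nonempty_frontier_iff.2 ⟨⟨x, x.2⟩, ?_⟩
      intro h
      have := P.isCompact.isBounded
      rw [h] at this
      exact NormedSpace.unbounded_univ ℝ ℂ this
    exact ⟨⟨z, P.frontier_subset hz⟩, (P.mem_iUnion_range_edge _).2 hz⟩

theorem mem_bdry (x : P.toSurface) : x ∈ P.toSurface.bdry ↔ x.1 ∈ frontier P.carrier :=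
  P.mem_iUnion_range_edge x

theorem mem_inner (x : P.toSurface) : x ∈ P.toSurface.inner ↔ x.1 ∈ interior P.carrier := by
  rw [OccupiedSurface.inner, mem_compl_iff, mem_bdry]
  refine ⟨fun h => (P.mem_interior_or_frontier x.2).resolve_right h, fun h h' => h'.2 h⟩

theorem exists_eq_edgeMap {x : P.toSurface} (hx : x ∈ P.toSurface.bdry) :
    ∃ i ∈ P.edges, ∃ t, x.1 = edgeMap i t := by
  rw [mem_bdry, P.frontier_eq] at hx
  obtain ⟨i, hi, t, ht⟩ := mem_iUnion₂.1 hx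
  exact ⟨i, hi, t, ht.symm⟩

theorem mem_F (x : P.toSurface) : x ∈ P.toSurface.F ↔ ∃ i ∈ P.edges, x.1 = edgeMap i mid := by
  constructor
  · rintro ⟨i, rfl⟩
    exact ⟨_, i.2, rfl⟩
  · rintro ⟨i, hi, hx⟩
    exact ⟨⟨i, hi⟩, Subtype.ext hx.symm⟩

theorem Vneg_cube {x : P.toSurface} (hx : x ∈ P.toSurface.Vneg) : x.1 ^ 3 = -1 := by
  obtain ⟨i, rfl⟩ := hx
  exact edgeMap_zero_cube _

theorem Vpos_cube {x : P.toSurface} (hx : x ∈ P.toSurface.Vpos) : x.1 ^ 3 = 1 := by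
  obtain ⟨i, rfl⟩ := hx
  exact edgeMap_one_cube _

/-- The sutures on a planar domain formed by three parallel lines. -/
def sutures {u : ℂ} (hu : u ^ 3 = 1) (hn : none ∈ P.edges → u ≠ 1)
    (hch : ∀ i ∈ P.edges, ∃ Φ : OpenPartialHomeomorph ℂ ℂ, edgeMap i mid ∈ Φ.source ∧
      ∀ z ∈ Φ.source, (z ∈ P.carrier ↔ 0 ≤ (Φ z).im) ∧ (z ∈ frontier P.carrier ↔ (Φ z).im = 0) ∧
        (0 < cheb (tcoord u z) ↔ 0 < (Φ z).re) ∧ (cheb (tcoord u z) < 0 ↔ (Φ z).re < 0)) :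
    Sutures P.toSurface where
  pos := {x | 0 < cheb (tcoord u x.1)}
  neg := {x | cheb (tcoord u x.1) < 0}
  isOpen_pos := isOpen_lt continuous_const
    ((continuous_cheb.comp (continuous_tcoord u)).comp continuous_subtype_val)
  isOpen_neg := isOpen_lt
    ((continuous_cheb.comp (continuous_tcoord u)).comp continuous_subtype_val) continuous_const
  disjoint := by
    rw [Set.disjoint_left]
    intro x hx hx'
    rw [mem_ofPred_eq] at hx hx'
    exact lt_asymm hx hx'
  Vpos_subset := by
    rintro _ ⟨i, rfl⟩
    exact (cheb_tcoord_edgeMap hu (fun h => hn (h ▸ i.2))).1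
  Vneg_subset := by
    rintro _ ⟨i, rfl⟩
    exact (cheb_tcoord_edgeMap hu (fun h => hn (h ▸ i.2))).2.1
  inter_bdry := by
    ext x
    rw [mem_F]
    constructor
    · rintro ⟨h1, h2⟩
      obtain ⟨i, hi, t, ht⟩ := P.exists_eq_edgeMap h2
      have h0 : cheb (tcoord u x.1) = 0 := by
        by_contra h
        rcases lt_or_gt_of_ne h with h | h
        exacts [h1 (.inr h), h1 (.inl h)]
      rw [ht, (cheb_tcoord_edgeMap hu (fun h => hn (h ▸ hi))).2.2] at h0
      exact ⟨i, hi, by rw [ht, h0]⟩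
    · rintro ⟨i, hi, hx⟩
      have h0 := ((cheb_tcoord_edgeMap hu (fun h => hn (h ▸ hi))).2.2 mid).2 rfl
      rw [← hx] at h0
      refine ⟨?_, ?_⟩
      · rintro (h | h)
        exacts [ne_of_gt h h0, ne_of_lt h h0]
      · rw [mem_bdry, hx]
        exact P.edgeMap_mem_frontier hi _
  inner_chart x hx hxi := by
    have h0 : cheb (tcoord u x.1) = 0 := by
      by_contra h
      rcases lt_or_gt_of_ne h with h | h
      exacts [hx (.inr h), hx (.inl h)]
    obtain ⟨Φ, h1, h2⟩ := exists_tcoord_chart hu h0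
    obtain ⟨a, ha, ha'⟩ := exists_subtype_chart Φ isOpen_interior
      (interior_subset (s := P.carrier)) x
    have hs : ∀ y, y ∈ a.source ↔ (y : ℂ) ∈ Φ.source ∩ interior P.carrier :=
      fun y => by rw [ha]; rfl
    refine ⟨a, (hs x).2 ⟨h1, (P.mem_inner x).1 hxi⟩,
      fun y hy => (P.mem_inner y).2 ((hs y).1 hy).2, fun y hy => ?_⟩
    have h := h2 y.1 ((hs y).1 hy).1
    rw [← ha' y] at h
    exact h
  bdry_chart x hx hxb := by
    obtain ⟨i, hi, t, ht⟩ := P.exists_eq_edgeMap hxb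
    have h0 : cheb (tcoord u x.1) = 0 := by
      by_contra h
      rcases lt_or_gt_of_ne h with h | h
      exacts [hx (.inr h), hx (.inl h)]
    rw [ht, (cheb_tcoord_edgeMap hu (fun h => hn (h ▸ hi))).2.2] at h0
    subst h0
    -- Sutures meet the boundary only at midpoints of edges, where `hch` provides a chart
    -- straightening boundary and sutures together.
    obtain ⟨Φ, h1, h2⟩ := hch i hi
    obtain ⟨a, ha, ha'⟩ := exists_halfPlane_chart Φ (fun y hy => (h2 y hy).1) x
    have hs : ∀ y, y ∈ a.source ↔ (y : ℂ) ∈ Φ.source := fun y => by rw [ha]; rfl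
    refine ⟨a, (hs x).2 (by rw [ht]; exact h1), fun y hy => ?_⟩
    have h := (h2 y.1 ((hs y).1 hy)).2
    rw [← ha' y hy, ← P.mem_bdry y] at h
    exact h

end PlanarDomain

/-! ### The hexagon and its half discs -/

/-- The unit disc, with six edges. -/
def disc : PlanarDomain where
  carrier := Metric.closedBall 0 1
  convex := convex_closedBall 0 1
  isCompact := isCompact_closedBall 0 1
  nonempty_interior := ⟨0, by rw [interior_closedBall _ one_ne_zero]; simp⟩
  edges := range some
  frontier_eq := by
    rw [frontier_closedBall _ one_ne_zero]
    ext z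
    rw [mem_sphere_zero_iff_norm, mem_iUnion₂]
    constructor
    · intro hz
      obtain ⟨i, t, ht, h⟩ := exists_arc_eq hz
      exact ⟨some i, mem_range_self i, ⟨t, ht⟩, h⟩
    · rintro ⟨_, ⟨i, rfl⟩, t, rfl⟩
      exact norm_arc _ _

theorem mem_disc {z : ℂ} : z ∈ disc.carrier ↔ ‖z‖ ≤ 1 := mem_closedBall_zero_iff

theorem mem_interior_disc {z : ℂ} : z ∈ interior disc.carrier ↔ ‖z‖ < 1 := by
  rw [disc, interior_closedBall _ one_ne_zero, mem_ball_zero_iff]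

theorem mem_frontier_disc {z : ℂ} : z ∈ frontier disc.carrier ↔ ‖z‖ = 1 := by
  rw [disc, frontier_closedBall _ one_ne_zero, mem_sphere_zero_iff_norm]

/-- The disc with six vertices. -/
abbrev hexagon : OccupiedSurface := disc.toSurface

/-- The three sets of sutures on the hexagon consisting of parallel chords. -/
def hexSutures {u : ℂ} (hu : u ^ 3 = 1) : Sutures hexagon :=
  disc.sutures hu (fun h => by simp [disc] at h) (by
    rintro _ ⟨i, rfl⟩
    have hi : (some i) = none → u ≠ 1 := by simp
    obtain ⟨Φ, h1, h2⟩ := exists_tcoord_round_chart hu (norm_arc i mid)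
      (((cheb_tcoord_edgeMap hu hi).2.2 mid).2 rfl)
    refine ⟨Φ, h1, fun z hz => ?_⟩
    rw [mem_disc, mem_frontier_disc]
    exact h2 z hz)

theorem halfDisc_interior (b : Bool) :
    interior {z : ℂ | ‖z‖ ≤ 1 ∧ 0 ≤ sg b * z.im} = {z | ‖z‖ < 1 ∧ 0 < sg b * z.im} := by
  have h1 : {z : ℂ | ‖z‖ ≤ 1 ∧ 0 ≤ sg b * z.im} =
      Metric.closedBall 0 1 ∩ {z | 0 ≤ sg b * z.im} := by
    ext z; simp
  have h2 : interior {z : ℂ | 0 ≤ sg b * z.im} = {z | 0 < sg b * z.im} := by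
    cases b
    · simp [sg]
    · simp [sg]
  rw [h1, interior_inter, h2, interior_closedBall _ one_ne_zero]
  ext z; simp

theorem continuous_sg_im (b : Bool) : Continuous fun z : ℂ => sg b * z.im := by fun_prop

/-- An arc of the hexagon does not cross the real axis. -/
theorem arc_im_nonneg {b : Bool} {i : HexEdge} {t : ℝ} (ht : t ∈ Icc (0 : ℝ) 1)
    (h : 0 < sg b * (arc i t).im) {t' : ℝ} (ht' : t' ∈ Icc (0 : ℝ) 1) :
    0 ≤ sg b * (arc i t').im := by
  by_contra! hc
  have hcont : Continuous fun s => sg b * (arc i s).im := by fun_prop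
  obtain ⟨s, hs, hs0⟩ := intermediate_value_uIcc (a := t) (b := t') hcont.continuousOn
    (show (0 : ℝ) ∈ uIcc _ _ from by rw [mem_uIcc]; exact .inr ⟨hc.le, h.le⟩)
  have hst : s ≠ t := by rintro rfl; exact h.ne' hs0
  have hst' : s ≠ t' := by rintro rfl; exact hc.ne hs0
  refine arc_im_ne_zero i (t := s) ?_ ((mul_eq_zero.1 hs0).resolve_left (sg_ne_zero b))
  rcases mem_uIcc.1 hs with hs | hs
  · exact ⟨ht.1.trans_lt (lt_of_le_of_ne hs.1 hst.symm), (lt_of_le_of_ne hs.2 hst').trans_le ht'.2⟩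
  · exact ⟨ht'.1.trans_lt (lt_of_le_of_ne hs.1 hst'.symm), (lt_of_le_of_ne hs.2 hst).trans_le ht.2⟩

theorem halfDisc_isClosed (b : Bool) : IsClosed {z : ℂ | ‖z‖ ≤ 1 ∧ 0 ≤ sg b * z.im} :=
  (isClosed_le continuous_norm continuous_const).inter
    (isClosed_le continuous_const (continuous_sg_im b))

theorem halfDisc_mem_frontier {b : Bool} {z : ℂ} :
    z ∈ frontier {z : ℂ | ‖z‖ ≤ 1 ∧ 0 ≤ sg b * z.im} ↔
      (‖z‖ ≤ 1 ∧ 0 ≤ sg b * z.im) ∧ (‖z‖ = 1 ∨ z.im = 0) := by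
  rw [(halfDisc_isClosed b).frontier_eq, halfDisc_interior, mem_sdiff, mem_ofPred_eq,
    mem_ofPred_eq, and_congr_right_iff]
  rintro ⟨h1, h2⟩
  rw [not_and_or, not_lt, not_lt]
  refine or_congr ⟨fun h => le_antisymm h1 h, fun h => h.ge⟩ ⟨fun h => ?_, fun h => by simp [h]⟩
  exact (mul_eq_zero.1 (le_antisymm h h2)).resolve_left (sg_ne_zero b)

/-- The upper and lower half of the unit disc, with four edges each. -/
def halfDisc (b : Bool) : PlanarDomain where
  carrier := {z | ‖z‖ ≤ 1 ∧ 0 ≤ sg b * z.im}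
  convex := by
    have h1 : {z : ℂ | ‖z‖ ≤ 1 ∧ 0 ≤ sg b * z.im} =
        Metric.closedBall 0 1 ∩ {z | 0 ≤ (sg b • Complex.imLm) z} := by
      ext z; simp
    rw [h1]
    exact (convex_closedBall 0 1).inter (convex_halfSpace_ge (LinearMap.isLinear _) 0)
  isCompact := by
    refine Metric.isCompact_of_isClosed_isBounded (halfDisc_isClosed b)
      (Metric.isBounded_closedBall (x := (0 : ℂ)) (r := 1) |>.subset fun z hz => ?_)
    exact mem_closedBall_zero_iff.2 hz.1
  nonempty_interior := by
    rw [halfDisc_interior]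
    refine ⟨(sg b / 2 : ℝ) * Complex.I, ?_⟩
    cases b <;> simp [sg] <;> norm_num
  -- The edges contained in the half disc: the diameter and the three arcs on this side.
  edges := {i | ∀ t, ‖edgeMap i t‖ ≤ 1 ∧ 0 ≤ sg b * (edgeMap i t).im}
  frontier_eq := by
    ext z
    rw [halfDisc_mem_frontier, mem_iUnion₂]
    constructor
    · rintro ⟨⟨h1, h2⟩, h3⟩
      -- Real frontier points lie on the diameter. Any other lies on an arc, which stays in this
      -- half because it does not cross the axis.
      by_cases him : z.im = 0
      · have hz : z = (z.re : ℂ) := Complex.ext rfl (by simp [him])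
        have hre : |z.re| ≤ 1 := by
          rwa [hz, Complex.norm_real, Real.norm_eq_abs] at h1
        rw [abs_le] at hre
        refine ⟨none, fun t => ?_, ⟨(z.re + 1) / 2, by linarith, by linarith⟩, ?_⟩
        · rw [edgeMap_none, Complex.norm_real, Real.norm_eq_abs, abs_le, Complex.ofReal_im]
          exact ⟨⟨by linarith [t.2.1], by linarith [t.2.2]⟩, by simp⟩
        · rw [edgeMap_none]
          conv_rhs => rw [hz]
          congr 1
          ring
      · obtain ⟨i, t, ht, rfl⟩ := exists_arc_eq (h3.resolve_right him)
        refine ⟨some i, fun t' => ⟨(norm_arc i t').le, arc_im_nonneg ht ?_ t'.2⟩, ⟨t, ht⟩, rfl⟩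
        exact lt_of_le_of_ne h2 (mul_ne_zero (sg_ne_zero b) him).symm
    · rintro ⟨i, hi, t, rfl⟩
      refine ⟨hi t, ?_⟩
      rcases i with _ | i
      · exact .inr (by rw [edgeMap_none, Complex.ofReal_im])
      · exact .inl (norm_arc i t)

theorem mem_halfDisc {b : Bool} {z : ℂ} :
    z ∈ (halfDisc b).carrier ↔ ‖z‖ ≤ 1 ∧ 0 ≤ sg b * z.im := Iff.rfl

theorem mem_interior_halfDisc {b : Bool} {z : ℂ} :
    z ∈ interior (halfDisc b).carrier ↔ ‖z‖ < 1 ∧ 0 < sg b * z.im := by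
  rw [halfDisc, halfDisc_interior]; rfl

theorem mem_frontier_halfDisc {b : Bool} {z : ℂ} :
    z ∈ frontier (halfDisc b).carrier ↔
      (‖z‖ ≤ 1 ∧ 0 ≤ sg b * z.im) ∧ (‖z‖ = 1 ∨ z.im = 0) := halfDisc_mem_frontier

/-- The sutures on a half disc cut out by three parallel lines. -/
def halfSutures (b : Bool) {u : ℂ} (hu : u ^ 3 = 1) (h1 : u ≠ 1) :
    Sutures (halfDisc b).toSurface :=
  (halfDisc b).sutures hu (fun _ => h1) (by
    intro i hi
    have h0 := ((cheb_tcoord_edgeMap (i := i) hu fun _ => h1).2.2 mid).2 rfl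
    rcases i with _ | i
    · obtain ⟨δ, hδ, hs⟩ := cheb_sign_near (s₀ := 0) (by simp [cheb])
      have hre := (cubeRoot_ne_one hu h1).1
      -- At the midpoint of the diameter the sutures are transverse to the real axis because `u.re =
      -- -1/2` is non-zero. The chart is then restricted to the open unit disc, where the frontier
      -- of the half disc is just the diameter.
      obtain ⟨L, hL⟩ := exists_affine_homeomorph (δ * u.re) (δ * u.im) 0 (sg b) 0 (by
        rw [hre]; simp [hδ, sg_ne_zero])
      have hm : edgeMap none mid = 0 := by simp [edgeMap_none, mid]
      have ht : tcoord u 0 = 0 := by simp [tcoord]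
      have hs' : ∀ᶠ s in 𝓝 (tcoord u 0), (0 < cheb s ↔ 0 < δ * (s - 0)) ∧
          (cheb s < 0 ↔ δ * (s - 0) < 0) := by rw [ht]; exact hs
      obtain ⟨Φ, h2, -, h3, h4⟩ := exists_chart_restr L.toOpenPartialHomeomorph
        (x := 0) (mem_univ _) (((continuous_tcoord u).continuousAt.eventually hs').and
          (Metric.ball_mem_nhds (0 : ℂ) one_pos))
      refine ⟨Φ, by rw [hm]; exact h2, fun z hz => ?_⟩
      have hre' : (Φ z).re = δ * (tcoord u z - 0) := by
        rw [h3]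
        change (L z).re = _
        rw [(hL z).1, tcoord_eq]; ring
      have him' : (Φ z).im = sg b * z.im := by
        rw [h3]
        change (L z).im = _
        rw [(hL z).2]; ring
      have hn : ‖z‖ < 1 := mem_ball_zero_iff.1 (h4 z hz).2
      rw [hre', him', mem_halfDisc, mem_frontier_halfDisc]
      refine ⟨by simp [hn.le], ?_, (h4 z hz).1⟩
      rw [or_iff_right hn.ne, mul_eq_zero, or_iff_right (sg_ne_zero b)]
      exact ⟨fun h => h.2, fun h => ⟨⟨hn.le, by simp [h]⟩, h⟩⟩
    · have him : 0 < sg b * (arc i mid).im :=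
        lt_of_le_of_ne (hi mid).2 (mul_ne_zero (sg_ne_zero b)
          (arc_im_ne_zero i (by norm_num [mid]))).symm
      -- The midpoint of an arc lies off the diameter, and near it the half disc coincides with the
      -- disc.
      obtain ⟨Ψ, h2, h3⟩ := exists_tcoord_round_chart hu (norm_arc i mid) h0
      obtain ⟨Φ, h4, h5, h6, h7⟩ := exists_chart_restr Ψ h2
        ((continuous_sg_im b).continuousAt.eventually_const_lt him)
      refine ⟨Φ, h4, fun z hz => ?_⟩
      obtain ⟨ha, hb, hc⟩ := h3 z (h5 hz)
      have hp := h7 z hz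
      have hne : z.im ≠ 0 := by rintro h; rw [h, mul_zero] at hp; exact lt_irrefl _ hp
      rw [h6, mem_halfDisc, mem_frontier_halfDisc, ← ha, ← hb, or_iff_left hne]
      exact ⟨by simp [hp.le], ⟨fun h => h.2, fun h => ⟨⟨h.le, hp.le⟩, h⟩⟩, hc⟩)

/-! ### The half discs are squares -/

theorem edgeMap_cube_eq_neg_one {i : Option HexEdge} {t : I} (h : edgeMap i t ^ 3 = -1) :
    t = 0 := by
  rcases i with _ | i
  · have h1 : (2 * (t : ℝ) - 1) ^ 3 = -1 := by
      rw [edgeMap_none] at h; exact_mod_cast h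
    have h2 : (2 * (t : ℝ) - 1) = -1 :=
      (show Odd 3 by decide).strictMono_pow.injective (h1.trans (by norm_num))
    exact Subtype.ext (show (t : ℝ) = 0 by linarith)
  · have h1 := congrArg Complex.re h
    rw [edgeMap_some, arc_cube_re, Complex.neg_re, Complex.one_re] at h1
    have hpi := Real.pi_pos
    have := Real.injOn_cos (x₁ := (1 - t) * Real.pi) (x₂ := Real.pi)
      ⟨by nlinarith [t.2.2], by nlinarith [t.2.1]⟩ ⟨hpi.le, le_rfl⟩ (by rw [h1, Real.cos_pi])
    exact Subtype.ext (show (t : ℝ) = 0 by nlinarith)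

theorem edgeMap_cube_eq_one {i : Option HexEdge} {t : I} (h : edgeMap i t ^ 3 = 1) :
    t = 1 := by
  rcases i with _ | i
  · have h1 : (2 * (t : ℝ) - 1) ^ 3 = 1 := by
      rw [edgeMap_none] at h; exact_mod_cast h
    have h2 : (2 * (t : ℝ) - 1) = 1 :=
      (show Odd 3 by decide).strictMono_pow.injective (h1.trans (by norm_num))
    exact Subtype.ext (show (t : ℝ) = 1 by linarith)
  · have h1 := congrArg Complex.re h
    rw [edgeMap_some, arc_cube_re, Complex.one_re] at h1
    have hpi := Real.pi_pos
    have := Real.injOn_cos (x₁ := (1 - t) * Real.pi) (x₂ := 0)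
      ⟨by nlinarith [t.2.2], by nlinarith [t.2.1]⟩ ⟨le_rfl, hpi.le⟩ (by rw [h1, Real.cos_zero])
    exact Subtype.ext (show (t : ℝ) = 1 by nlinarith)

/-- The cube takes the value -1 on an edge only at its start, so the negative vertices can be
recognised without naming an edge. -/
theorem PlanarDomain.mem_Vneg (P : PlanarDomain) (x : P.toSurface) :
    x ∈ P.toSurface.Vneg ↔ x ∈ P.toSurface.bdry ∧ x.1 ^ 3 = -1 := by
  refine ⟨fun h => ⟨?_, P.Vneg_cube h⟩, ?_⟩
  · obtain ⟨i, rfl⟩ := h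
    exact mem_iUnion.2 ⟨i, mem_range_self _⟩
  · rintro ⟨hb, hc⟩
    obtain ⟨i, hi, t, ht⟩ := P.exists_eq_edgeMap hb
    rw [ht] at hc
    obtain rfl := edgeMap_cube_eq_neg_one hc
    exact ⟨⟨i, hi⟩, Subtype.ext ht.symm⟩

theorem PlanarDomain.mem_Vpos (P : PlanarDomain) (x : P.toSurface) :
    x ∈ P.toSurface.Vpos ↔ x ∈ P.toSurface.bdry ∧ x.1 ^ 3 = 1 := by
  refine ⟨fun h => ⟨?_, P.Vpos_cube h⟩, ?_⟩
  · obtain ⟨i, rfl⟩ := h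
    exact mem_iUnion.2 ⟨i, mem_range_self _⟩
  · rintro ⟨hb, hc⟩
    obtain ⟨i, hi, t, ht⟩ := P.exists_eq_edgeMap hb
    rw [ht] at hc
    obtain rfl := edgeMap_cube_eq_one hc
    exact ⟨⟨i, hi⟩, Subtype.ext ht.symm⟩

theorem PlanarDomain.homeomorph_closedBall (P : PlanarDomain) :
    Nonempty (P.toSurface ≃ₜ Metric.closedBall (0 : ℂ) 1) := by
  obtain ⟨g, -, hcl, -⟩ := exists_homeomorph_image_interior_closure_frontier_eq_unitBall
    P.convex P.nonempty_interior P.isCompact.isBounded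
  rw [P.isCompact.isClosed.closure_eq] at hcl
  exact ⟨(g.image P.carrier).trans (Homeomorph.setCongr hcl)⟩

theorem cube_eq_one_iff {b : Bool} {z : ℂ} :
    (z ^ 3 = 1 ∧ 0 ≤ sg b * z.im) ↔ z = 1 ∨ z = ⟨-1 / 2, sg b * (√3 / 2)⟩ := by
  have h3 : √3 ^ 2 = 3 := Real.sq_sqrt (by norm_num)
  have h30 : 0 < √3 := by positivity
  constructor
  · rintro ⟨h, hi⟩
    by_cases h1 : z = 1
    · exact .inl h1
    obtain ⟨hr, hm⟩ := cubeRoot_ne_one h h1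
    have : sg b * z.im = √3 / 2 := by
      have h4 : (sg b * z.im) ^ 2 = (√3 / 2) ^ 2 := by
        rw [mul_pow, sg_sq, hm, div_pow, h3]; norm_num
      exact (pow_left_inj₀ hi (by positivity) two_ne_zero).1 h4
    refine .inr (Complex.ext hr ?_)
    simp only
    rw [← this, ← mul_assoc, sg_mul_self, one_mul]
  · rintro (rfl | rfl)
    · simp
    · constructor
      · have hb := sg_sq b
        apply Complex.ext
        · simp only [pow_succ, pow_zero, one_mul, Complex.mul_re, Complex.mul_im, Complex.one_re]
          linear_combination (3 / 8 : ℝ) * √3 ^ 2 * hb + (3 / 8 : ℝ) * h3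
        · simp only [pow_succ, pow_zero, one_mul, Complex.mul_re, Complex.mul_im, Complex.one_im]
          linear_combination (-(1 / 8) : ℝ) * sg b * √3 * √3 ^ 2 * hb -
            (1 / 8 : ℝ) * sg b * √3 * h3
      · simp only
        rw [← mul_assoc, sg_mul_self, one_mul]
        positivity

theorem halfDisc_isSquare (b : Bool) : (halfDisc b).toSurface.IsSquare := by
  refine ⟨(halfDisc b).homeomorph_closedBall, ?_⟩
  have hv : (fun x : (halfDisc b).toSurface => x.1) ''
      ((halfDisc b).toSurface.Vneg ∪ (halfDisc b).toSurface.Vpos) =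
      {1, ⟨-1 / 2, sg b * (√3 / 2)⟩, -1, ⟨1 / 2, sg b * (√3 / 2)⟩} := by
    ext z
    -- Negation takes the negative vertices of this half disc to the cube roots of unity in the
    -- other half, so `cube_eq_one_iff` counts both signs.
    have hz : z ∈ (fun x : (halfDisc b).toSurface => x.1) ''
        ((halfDisc b).toSurface.Vneg ∪ (halfDisc b).toSurface.Vpos) ↔
        (z ^ 3 = 1 ∧ 0 ≤ sg b * z.im) ∨ ((-z) ^ 3 = 1 ∧ 0 ≤ sg (!b) * (-z).im) := by
      have hb : sg (!b) * (-z).im = sg b * z.im := by cases b <;> simp [sg]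
      have hc : (-z) ^ 3 = 1 ↔ z ^ 3 = -1 := by
        rw [show (-z) ^ 3 = -z ^ 3 by ring, neg_eq_iff_eq_neg]
      rw [hb, hc, ← or_and_right]
      constructor
      · rintro ⟨x, hx | hx, rfl⟩
        · exact ⟨.inr ((PlanarDomain.mem_Vneg _ x).1 hx).2, x.2.2⟩
        · exact ⟨.inl ((PlanarDomain.mem_Vpos _ x).1 hx).2, x.2.2⟩
      · rintro ⟨h, hi⟩
        have hn : ‖z‖ = 1 := by
          rcases h with h | h
          · exact norm_of_cube_eq_one h
          · rw [← norm_neg]; exact norm_of_cube_eq_one (hc.2 h)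
        refine ⟨⟨z, hn.le, hi⟩, ?_, rfl⟩
        have hbd : (⟨z, hn.le, hi⟩ : (halfDisc b).toSurface) ∈ (halfDisc b).toSurface.bdry :=
          (PlanarDomain.mem_bdry _ _).2 (mem_frontier_halfDisc.2 ⟨⟨hn.le, hi⟩, .inl hn⟩)
        rcases h with h | h
        · exact .inr ((PlanarDomain.mem_Vpos _ _).2 ⟨hbd, h⟩)
        · exact .inl ((PlanarDomain.mem_Vneg _ _).2 ⟨hbd, h⟩)
    rw [hz, cube_eq_one_iff, cube_eq_one_iff, neg_eq_iff_eq_neg, neg_eq_iff_eq_neg]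
    have : -(⟨-1 / 2, sg (!b) * (√3 / 2)⟩ : ℂ) = ⟨1 / 2, sg b * (√3 / 2)⟩ := by
      cases b <;> apply Complex.ext <;> norm_num [sg]
    rw [this]
    simp only [mem_insert_iff, mem_singleton_iff]
    tauto
  rw [← Set.ncard_image_of_injective (f := fun x : (halfDisc b).toSurface => x.1) _
    Subtype.val_injective, hv,
    Set.ncard_insert_of_notMem, Set.ncard_insert_of_notMem, Set.ncard_insert_of_notMem,
    Set.ncard_singleton]
  all_goals simp [Complex.ext_iff]
  all_goals norm_num [sg_ne_zero]

/-! ### Basic sutures on the half discs -/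

theorem isConnected_preimage_val {X : Type*} [TopologicalSpace X] {A K : Set X} (hA : IsConnected A)
    (h : A ⊆ K) : IsConnected ((↑) ⁻¹' A : Set K) := by
  have himg : ((↑) : K → X) '' ((↑) ⁻¹' A) = A := by
    rw [Subtype.image_preimage_coe, inter_eq_right.2 h]
  refine ⟨?_, ?_⟩
  · rw [← image_nonempty (f := ((↑) : K → X)), himg]
    exact hA.nonempty
  · rw [← Topology.IsInducing.subtypeVal.isPreconnected_image, himg]
    exact hA.isPreconnected

theorem card_connectedComponents_eq_two {X : Type*} [TopologicalSpace X] {A B : Set X}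
    (hA : IsConnected A) (hB : IsConnected B) (hAo : IsOpen A) (hBo : IsOpen B)
    (hAB : Disjoint A B) : Nat.card (ConnectedComponents ↥(A ∪ B)) = 2 := by
  have hA' := isConnected_preimage_val hA (subset_union_left (t := B))
  have hB' := isConnected_preimage_val hB (subset_union_right (s := A))
  have hcl : IsClopen ((↑) ⁻¹' A : Set ↥(A ∪ B)) := by
    refine ⟨?_, hAo.preimage continuous_subtype_val⟩
    rw [← isOpen_compl_iff]
    convert hBo.preimage (continuous_subtype_val (p := (· ∈ A ∪ B))) using 1
    ext x
    exact ⟨fun h => x.2.resolve_left h, fun h h' => Set.disjoint_left.1 hAB h' h⟩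
  obtain ⟨a, ha⟩ := hA'.nonempty
  obtain ⟨b, hb⟩ := hB'.nonempty
  rw [Nat.card_eq_two_iff]
  refine ⟨a, b, fun h => ?_, eq_univ_of_forall fun c => ?_⟩
  · rw [ConnectedComponents.coe_eq_coe'] at h
    exact hcl.compl.connectedComponent_subset
      (fun hb' => Set.disjoint_left.1 hAB hb' hb) h ha
  · obtain ⟨c, rfl⟩ := ConnectedComponents.surjective_coe c
    rcases c.2 with hc | hc
    · exact .inl (ConnectedComponents.coe_eq_coe'.2
        (hA'.isPreconnected.subset_connectedComponent ha hc))
    · exact .inr (ConnectedComponents.coe_eq_coe'.2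
        (hB'.isPreconnected.subset_connectedComponent hb hc))

theorem cheb_neg (s : ℝ) : cheb (-s) = -cheb s := by unfold cheb; ring

/-- As `r > 1/2`, the factor `s + r` is positive for `s ≥ -1/2`; only the roots 0 and `r` remain.
Geometrically, the third chord misses the half disc, leaving a strip and two corners. -/
theorem cheb_signs {r s : ℝ} (hr : 0 < r) (hr2 : r ^ 2 = 3 / 4) (hs : -1 / 2 ≤ s) :
    (cheb s < 0 ↔ 0 < s ∧ s < r) ∧ (0 < cheb s ↔ s < 0 ∨ r < s) := by
  have h : cheb s = 4 * s * (s - r) * (s + r) := by unfold cheb; linear_combination (4 * s) * hr2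
  have hr3 : 1 / 2 < r := by nlinarith
  have hp : 0 < s + r := by linarith
  rw [h]
  refine ⟨⟨fun h0 => ?_, fun h0 => ?_⟩, ⟨fun h0 => ?_, fun h0 => ?_⟩⟩
  · have h1 : s * (s - r) < 0 := by
      by_contra! hc
      nlinarith [mul_nonneg hc hp.le]
    rcases mul_neg_iff.1 h1 with h2 | h2
    · exact ⟨h2.1, by linarith [h2.2]⟩
    · linarith [h2.1, h2.2]
  · have := mul_pos (mul_pos h0.1 (sub_pos.2 h0.2)) hp
    nlinarith
  · have h1 : 0 < s * (s - r) := by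
      by_contra! hc
      nlinarith [mul_nonneg (neg_nonneg.2 hc) hp.le]
    rcases mul_pos_iff.1 h1 with h2 | h2
    · exact .inr (by linarith [h2.2])
    · exact .inl h2.1
  · rcases h0 with h0 | h0
    · have := mul_pos (mul_pos (neg_pos.2 h0) (show 0 < r - s by linarith)) hp
      nlinarith
    · have := mul_pos (mul_pos (hr.trans h0) (sub_pos.2 h0)) hp
      nlinarith

/-- A half disc is cut by the sutures into a strip and two corners, of signs determined by `ε`. -/
theorem halfDisc_strip (b : Bool) {u : ℂ} (hu : u ^ 3 = 1) {ε : ℝ} (hε : ε ^ 2 = 1)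
    (h : 0 < ε * (sg b * u.im)) :
    IsConnected {x : (halfDisc b).toSurface | ε * cheb (tcoord u x.1) < 0} ∧
      Nat.card (ConnectedComponents
        ↥{x : (halfDisc b).toSurface | 0 < ε * cheb (tcoord u x.1)}) = 2 := by
  have h1 : u ≠ 1 := by rintro rfl; simp at h
  obtain ⟨hre, him⟩ := cubeRoot_ne_one hu h1
  have hn := norm_of_cube_eq_one hu
  set r := ε * (sg b * u.im) with hr
  have hr2 : r ^ 2 = 3 / 4 := by rw [hr, mul_pow, mul_pow, hε, sg_sq, him]; norm_num
  have hr3 : 1 / 2 < r := by nlinarith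
  -- `cheb` is odd, so the sign `ε` can be moved into its argument and both signs are treated at
  -- once.
  have hcube : ∀ s, ε * cheb s = cheb (ε * s) := fun s => by
    unfold cheb; linear_combination (-4 * ε * s ^ 3) * hε
  have huu : u.re * u.re + u.im * u.im = 1 := by
    rw [← Complex.normSq_apply, Complex.normSq_eq_norm_sq, hn]; norm_num
  let ℓ : ℂ →ₗ[ℝ] ℝ := ε • (u.re • Complex.reLm + u.im • Complex.imLm)
  have hℓ : ∀ z, ℓ z = ε * tcoord u z := fun z => by
    rw [tcoord_eq]; simp [ℓ, mul_add]
  have hlc : Continuous ℓ := by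
    have : ⇑ℓ = fun z => ε * tcoord u z := funext hℓ
    rw [this]; fun_prop
  have hεabs : |ε| = 1 := by
    rw [← sq_eq_sq₀ (abs_nonneg _) zero_le_one, sq_abs, hε]; norm_num
  have hge : ∀ z ∈ (halfDisc b).carrier, -1 / 2 ≤ ℓ z := by
    rintro z ⟨hz1, hz2⟩
    have e1 : ε * (u.im * z.im) = r * (sg b * z.im) := by
      rw [hr]; linear_combination (-ε * u.im * z.im) * sg_sq b
    have e2 : |ε * z.re| ≤ 1 := by
      rw [abs_mul, hεabs, one_mul]; exact (Complex.abs_re_le_norm z).trans hz1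
    rw [hℓ, tcoord_eq, mul_add, e1, hre]
    have := mul_nonneg h.le hz2
    have := (abs_le.1 e2).2
    nlinarith
  -- The strip is `0 < ℓ < r` and the corners are `ℓ < 0` and `r < ℓ`. Each is the intersection of
  -- the half disc with a convex set, hence connected once it is non-empty.
  have hsgn : ∀ z ∈ (halfDisc b).carrier, (ε * cheb (tcoord u z) < 0 ↔ 0 < ℓ z ∧ ℓ z < r) ∧
      (0 < ε * cheb (tcoord u z) ↔ ℓ z < 0 ∨ r < ℓ z) := fun z hz => by
    rw [hcube, ← hℓ]; exact cheb_signs h hr2 (hge z hz)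
  -- Source of witnesses: the point `c ε u` has `ℓ = c`. Then `c = 1/2` lies in the strip and `c =
  -- 1` in the corner beyond `r`; the point `ε`, with `ℓ = -1/2`, lies in the other corner.
  have hmul : ∀ c : ℝ, ℓ ((c * ε : ℝ) * u) = c := fun c => by
    rw [hℓ, tcoord_eq]
    simp only [Complex.re_ofReal_mul, Complex.im_ofReal_mul]
    linear_combination (c * ε ^ 2) * huu + c * hε
  have hmem : ∀ c ∈ Icc (0 : ℝ) 1, ((c * ε : ℝ) * u) ∈ (halfDisc b).carrier := fun c hc => by
    rw [mem_halfDisc, norm_mul, hn, Complex.norm_real, Real.norm_eq_abs, abs_mul, hεabs,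
      abs_of_nonneg hc.1, mul_one, mul_one, Complex.im_ofReal_mul]
    refine ⟨hc.2, ?_⟩
    rw [show sg b * (c * ε * u.im) = c * r by rw [hr]; ring]
    exact mul_nonneg hc.1 h.le
  have hconv := (halfDisc b).convex
  have hconn : ∀ {A : Set ℂ}, Convex ℝ A → ((halfDisc b).carrier ∩ A).Nonempty →
      IsConnected {x : (halfDisc b).toSurface | x.1 ∈ A} := by
    intro A hA hne
    have h2 := isConnected_preimage_val ((hconv.inter hA).isConnected hne) inter_subset_left
    rwa [show ((↑) ⁻¹' ((halfDisc b).carrier ∩ A) : Set (halfDisc b).carrier) = {x | x.1 ∈ A} from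
      ext fun x => ⟨fun hx => hx.2, fun hx => ⟨x.2, hx⟩⟩] at h2
  constructor
  · have : {x : (halfDisc b).toSurface | ε * cheb (tcoord u x.1) < 0} =
        {x | x.1 ∈ {z | 0 < ℓ z} ∩ {z | ℓ z < r}} := by
      ext x
      exact (hsgn x.1 x.2).1
    rw [this]
    exact hconn (A := {z | 0 < ℓ z} ∩ {z | ℓ z < r}) ((convex_halfSpace_gt ℓ.isLinear 0).inter
      (convex_halfSpace_lt ℓ.isLinear r))
      ⟨((1 / 2 * ε : ℝ) * u), hmem _ (by norm_num), by
        constructor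
        · rw [mem_ofPred_eq, hmul]; norm_num
        · rw [mem_ofPred_eq, hmul]; exact hr3⟩
  · have hA := hconn (A := {z | ℓ z < 0}) (convex_halfSpace_lt ℓ.isLinear 0)
      ⟨(ε : ℂ), by simp [mem_halfDisc, hεabs], by
        rw [mem_ofPred_eq, hℓ, tcoord_eq, hre]
        simp only [Complex.ofReal_re, Complex.ofReal_im]
        nlinarith⟩
    have hB := hconn (A := {z | r < ℓ z}) (convex_halfSpace_gt ℓ.isLinear r)
      ⟨((1 * ε : ℝ) * u), hmem _ (by norm_num), by
        rw [mem_ofPred_eq, hmul]; nlinarith⟩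
    have hcont : Continuous fun x : (halfDisc b).toSurface => ℓ x.1 :=
      hlc.comp continuous_subtype_val
    rw [← card_connectedComponents_eq_two hA hB (isOpen_lt hcont continuous_const)
      (isOpen_lt continuous_const hcont) (by
        rw [Set.disjoint_left]
        intro x hx hx'
        rw [mem_ofPred_eq, mem_ofPred_eq] at hx hx'
        linarith)]
    have : {x : (halfDisc b).toSurface | 0 < ε * cheb (tcoord u x.1)} =
        {x | x.1 ∈ {z | ℓ z < 0}} ∪ {x | x.1 ∈ {z | r < ℓ z}} := by
      ext x
      exact (hsgn x.1 x.2).2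
    rw [this]

theorem halfSutures_isStdPos {b : Bool} {u : ℂ} (hu : u ^ 3 = 1) (h1 : u ≠ 1)
    (h : 0 < sg b * u.im) : (halfSutures b hu h1).IsStdPos := by
  have := halfDisc_strip b hu (ε := 1) (by norm_num) (by simpa using h)
  have e1 : (halfSutures b hu h1).neg = {x | 1 * cheb (tcoord u x.1) < 0} := by
    simp only [one_mul]; rfl
  have e2 : (halfSutures b hu h1).pos = {x | 0 < 1 * cheb (tcoord u x.1)} := by
    simp only [one_mul]; rfl
  rw [Sutures.IsStdPos, e1, e2]
  exact this

theorem halfSutures_isStdNeg {b : Bool} {u : ℂ} (hu : u ^ 3 = 1) (h1 : u ≠ 1)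
    (h : sg b * u.im < 0) : (halfSutures b hu h1).IsStdNeg := by
  have := halfDisc_strip b hu (ε := -1) (by norm_num) (by simpa using h)
  have e1 : (halfSutures b hu h1).pos = {x | -1 * cheb (tcoord u x.1) < 0} := by
    simp only [neg_one_mul, neg_neg_iff_pos]; rfl
  have e2 : (halfSutures b hu h1).neg = {x | 0 < -1 * cheb (tcoord u x.1)} := by
    simp only [neg_one_mul, neg_pos]; rfl
  rw [Sutures.IsStdNeg, e1, e2]
  exact this

theorem PlanarDomain.mem_curve (P : PlanarDomain) {u : ℂ} (hu : u ^ 3 = 1) (hn) (hch)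
    (x : P.toSurface) : x ∈ (P.sutures hu hn hch).curve ↔ cheb (tcoord u x.1) = 0 := by
  have h : x ∈ (P.sutures hu hn hch).curve ↔
    ¬(0 < cheb (tcoord u x.1) ∨ cheb (tcoord u x.1) < 0) := Iff.rfl
  rw [h, not_or, not_lt, not_lt]
  exact ⟨fun h => le_antisymm h.1 h.2, fun h => ⟨h.le, h.ge⟩⟩

/-! ### Quadrangulations of the hexagon -/

theorem EdgeMatch.of_eq {X : Type} {α β : I → X} (h : α = β) : EdgeMatch α β := by
  subst h; exact ⟨rfl, rfl, rfl, rfl⟩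

/-- The rotation of the edges of the hexagon by a cube root of unity. -/
def rotEdge {v : ℂ} (hv : v ^ 3 = 1) (i : HexEdge) : HexEdge :=
  (⟨v * i.1, by rw [mul_pow, hv, i.1.2, one_mul]⟩, i.2)

theorem arc_rotEdge {v : ℂ} (hv : v ^ 3 = 1) (i : HexEdge) (t : ℝ) :
    arc (rotEdge hv i) t = v * arc i t := by
  simp only [arc, rotEdge, mul_assoc]

theorem PlanarDomain.isOpenEmbedding_inner (P : PlanarDomain) :
    IsOpenEmbedding fun x : P.toSurface.inner => (x.1.1 : ℂ) := by
  have h : IsEmbedding fun x : P.toSurface.inner => (x.1.1 : ℂ) :=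
    IsEmbedding.subtypeVal.comp IsEmbedding.subtypeVal
  refine ⟨h, ?_⟩
  have : range (fun x : P.toSurface.inner => (x.1.1 : ℂ)) = interior P.carrier := by
    ext z
    constructor
    · rintro ⟨x, rfl⟩
      exact (P.mem_inner x.1).1 x.2
    · intro hz
      exact ⟨⟨⟨z, interior_subset hz⟩, (P.mem_inner _).2 hz⟩, rfl⟩
  rw [this]
  exact isOpen_interior

/-- The embedding of a half disc into the hexagon, followed by a rotation. -/
def halfMap (b : Bool) {v : ℂ} (hv : v ^ 3 = 1) : C((halfDisc b).toSurface, hexagon) :=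
  ⟨fun x => ⟨v * x.1, mem_disc.2 (by
    rw [norm_mul, norm_of_cube_eq_one hv, one_mul]; exact x.2.1)⟩, by
      exact Continuous.subtype_mk (continuous_const.mul continuous_subtype_val) _⟩

/-- The embedding of a half disc into the hexagon, as a morphism. -/
def halfMorphism (b : Bool) {v : ℂ} (hv : v ^ 3 = 1) :
    Morphism (halfDisc b).toSurface hexagon where
  map := halfMap b hv
  map_inner x hx := by
    refine (disc.mem_inner _).2 (mem_interior_disc.2 ?_)
    change ‖v * x.1‖ < 1
    rw [norm_mul, norm_of_cube_eq_one hv, one_mul]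
    exact (mem_interior_halfDisc.1 ((PlanarDomain.mem_inner _ _).1 hx)).1
  embedding := by
    have hv0 : v ≠ 0 := by rintro rfl; norm_num at hv
    have h1 := (Homeomorph.mulLeft₀ v hv0).isOpenEmbedding.comp (halfDisc b).isOpenEmbedding_inner
    have hr : ∀ x : (halfDisc b).toSurface.inner, v * x.1.1 ∈ disc.carrier := fun x =>
      mem_disc.2 (by rw [norm_mul, norm_of_cube_eq_one hv, one_mul]; exact x.1.2.1)
    have h2 : IsOpenEmbedding fun x : (halfDisc b).toSurface.inner =>
        (⟨v * x.1.1, hr x⟩ : disc.carrier) := by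
      refine ⟨IsEmbedding.of_comp ?_ continuous_subtype_val h1.isEmbedding, ?_⟩
      · exact Continuous.subtype_mk h1.continuous _
      · convert h1.isOpen_range.preimage (continuous_subtype_val (p := (· ∈ disc.carrier))) using 1
        ext y
        constructor
        · rintro ⟨x, rfl⟩
          exact ⟨x, rfl⟩
        · rintro ⟨x, hx⟩
          exact ⟨x, Subtype.ext hx⟩
    exact h2
  oriented a ha c hc x hx hxc := by
    refine (posAt_mul (norm_of_cube_eq_one hv) (a x)).congr ?_
    have : ∀ᶠ z in 𝓝 (a x), halfMap b hv (a.symm z) ∈ c.source := by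
      refine ((halfMap b hv).continuous.continuousAt.comp
        (a.continuousAt_symm (a.map_source hx))).eventually_mem ?_
      rw [Function.comp_apply, a.left_inv hx]
      exact c.open_source.mem_nhds hxc
    filter_upwards [this, a.open_target.mem_nhds (a.map_source hx)] with z hz hz'
    have e1 := hc.2 _ hz
    have e2 : z = (a.symm z).1 := (a.right_inv hz').symm.trans (ha.2 _ (a.map_target hz'))
    exact (congrArg (v * ·) e2).trans e1.symm
  edge_injective i s t h := by
    have hv0 : v ≠ 0 := by rintro rfl; norm_num at hv
    exact edgeMap_injective i.1 (mul_left_cancel₀ hv0 (congrArg Subtype.val h))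
  edge_edge i j := by
    by_cases hij : i = j
    · exact .inl (EdgeMatch.of_eq (by rw [hij]))
    · refine .inr fun s hs t h => ?_
      have hv0 : v ≠ 0 := by rintro rfl; norm_num at hv
      exact edgeMap_disjoint (fun h => hij (Subtype.ext h)) hs t
        (mul_left_cancel₀ hv0 (congrArg Subtype.val h))
  edge_bdry := by
    rintro ⟨_ | i, hi⟩
    · refine .inr fun s hs => ?_
      refine (disc.mem_inner _).2 (mem_interior_disc.2 ?_)
      change ‖v * edgeMap none s‖ < 1
      rw [norm_mul, norm_of_cube_eq_one hv, one_mul]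
      exact edgeMap_norm_lt s hs
    · refine .inl ⟨⟨some (rotEdge hv i), mem_range_self _⟩, EdgeMatch.of_eq ?_⟩
      funext t
      exact Subtype.ext (arc_rotEdge hv i t).symm
  map_Vneg x hx hb := by
    refine (disc.mem_Vneg _).2 ⟨hb, ?_⟩
    change (v * x.1) ^ 3 = -1
    rw [mul_pow, hv, one_mul, PlanarDomain.Vneg_cube _ hx]
  map_Vpos x hx hb := by
    refine (disc.mem_Vpos _).2 ⟨hb, ?_⟩
    change (v * x.1) ^ 3 = 1
    rw [mul_pow, hv, one_mul, PlanarDomain.Vpos_cube _ hx]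
  sign_ne x hx y hy h := by
    have h1 : v * x.1 = v * y.1 := congrArg Subtype.val h
    have h2 : x.1 ^ 3 = y.1 ^ 3 := by
      have := congrArg (· ^ 3) h1
      simpa [mul_pow, hv] using this
    rw [PlanarDomain.Vneg_cube _ hx, PlanarDomain.Vpos_cube _ hy] at h2
    norm_num at h2

theorem halfMorphism_coe (b : Bool) {v : ℂ} (hv : v ^ 3 = 1) (x : (halfDisc b).toSurface) :
    ((halfMorphism b hv).map x).1 = v * x.1 := rfl

theorem halfMorphism_compatible {b c : Bool} (hbc : b ≠ c) {v : ℂ} (hv : v ^ 3 = 1) :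
    Compatible (halfMorphism b hv) (halfMorphism c hv) := by
  have hv0 : v ≠ 0 := by rintro rfl; norm_num at hv
  refine ⟨?_, fun i j => ?_, fun x hx y hy h => ?_, fun x hx y hy h => ?_⟩
  · rw [Set.disjoint_left]
    rintro _ ⟨x, hx, rfl⟩ ⟨y, hy, h⟩
    have h1 : y.1 = x.1 := mul_left_cancel₀ hv0 (congrArg Subtype.val h)
    have h2 := (mem_interior_halfDisc.1 ((PlanarDomain.mem_inner _ _).1 hx)).2
    have h3 := (mem_interior_halfDisc.1 ((PlanarDomain.mem_inner _ _).1 hy)).2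
    rw [h1] at h3
    cases b <;> cases c <;> simp [sg] at * <;> linarith
  -- Edges with equal index, as for the diameter along which the halves are glued, have the same
  -- image; any others are disjoint away from endpoints.
  · by_cases hij : i.1 = j.1
    · refine .inl (EdgeMatch.of_eq ?_)
      funext t
      refine Subtype.ext ?_
      change v * edgeMap i.1 t = v * edgeMap j.1 t
      rw [hij]
    · exact .inr fun s hs t => ⟨fun h => edgeMap_disjoint hij hs t
        (mul_left_cancel₀ hv0 (congrArg Subtype.val h)), fun h => edgeMap_disjoint (Ne.symm hij) hs t
        (mul_left_cancel₀ hv0 (congrArg Subtype.val h)).symm⟩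
  all_goals
    have h1 : x.1 = y.1 := mul_left_cancel₀ hv0 (congrArg Subtype.val h)
    have h2 : x.1 ^ 3 = y.1 ^ 3 := by rw [h1]
  · rw [PlanarDomain.Vneg_cube _ hx, PlanarDomain.Vpos_cube _ hy] at h2
    norm_num at h2
  · rw [PlanarDomain.Vneg_cube _ hy, PlanarDomain.Vpos_cube _ hx] at h2
    norm_num at h2

/-- The quadrangulation of the hexagon by two squares, for each of the three diagonals. -/
def hexQuadrangulation {v : ℂ} (hv : v ^ 3 = 1) : Quadrangulation hexagon where
  ι := Bool
  ν := Empty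
  piece := Sum.elim (fun b => (halfDisc b).toSurface) Empty.elim
  isSquare b := halfDisc_isSquare b
  isVacuum e := e.elim
  q
    | .inl b => halfMorphism b hv
    | .inr e => e.elim
  compatible := by
    rintro (b | e) (c | e') h
    · exact halfMorphism_compatible (fun h' => h (congrArg _ h')) hv
    · exact e'.elim
    · exact e.elim
    · exact e.elim
  cover := by
    have hv0 : v ≠ 0 := by rintro rfl; norm_num at hv
    refine eq_univ_of_forall fun x => ?_
    have hn : ‖v⁻¹ * x.1‖ ≤ 1 := by
      rw [norm_mul, norm_inv, norm_of_cube_eq_one hv, inv_one, one_mul]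
      exact mem_disc.1 x.2
    obtain ⟨b, hb⟩ : ∃ b, 0 ≤ sg b * (v⁻¹ * x.1).im := by
      generalize v⁻¹ * x.1 = w
      rcases le_total 0 w.im with h | h
      · exact ⟨true, by simpa [sg] using h⟩
      · exact ⟨false, by simpa [sg] using h⟩
    refine mem_iUnion.2 ⟨.inl b, ⟨v⁻¹ * x.1, hn, hb⟩, Subtype.ext ?_⟩
    exact mul_inv_cancel_left₀ hv0 x.1
  map_vertex := by
    rintro (b | e) x hx
    · refine (disc.mem_bdry _).2 (mem_frontier_disc.2 ?_)
      change ‖v * x.1‖ = 1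
      rw [norm_mul, norm_of_cube_eq_one hv, one_mul]
      rcases hx with hx | hx
      · rw [← norm_neg]
        apply norm_of_cube_eq_one
        have := PlanarDomain.Vneg_cube _ hx
        rw [show (-x.1) ^ 3 = -x.1 ^ 3 by ring, this, neg_neg]
      · exact norm_of_cube_eq_one (PlanarDomain.Vpos_cube _ hx)
    · exact e.elim
  vacuum_bdry e := e.elim

/-- Rotation by `v` turns the lines of `u` into those of `v u`, as `tcoord (v u) (v z) = tcoord u
z`. So `u ≠ 1` says that the sutures of `w` are not those of `v`, the family crossing the diagonal
three times. -/
theorem hexSutures_isBasic {u v w : ℂ} (hu : u ^ 3 = 1) (h1 : u ≠ 1) (hv : v ^ 3 = 1)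
    (hw : w ^ 3 = 1) (h : w = v * u) :
    (hexQuadrangulation hv).IsBasic (hexSutures hw)
      (fun | .inl b => halfSutures b hu h1
           | .inr e => e.elim) := by
  subst h
  refine ⟨?_, fun b => ?_, fun e => e.elim⟩
  · rintro (b | e)
    · ext x
      refine (PlanarDomain.mem_curve _ hu _ _ x).trans
        (Iff.trans ?_ (PlanarDomain.mem_curve disc hw _ _ ((halfMorphism b hv).map x)).symm)
      have hvv : (starRingEnd ℂ) v * v = 1 := by
        rw [← Complex.normSq_eq_conj_mul_self, Complex.normSq_eq_norm_sq, norm_of_cube_eq_one hv]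
        norm_num
      have : tcoord (v * u) (v * x.1) = tcoord u x.1 := by
        rw [tcoord, tcoord, map_mul]
        congr 1
        linear_combination (starRingEnd ℂ) u * x.1 * hvv
      rw [halfMorphism_coe b hv x, this]
    · exact e.elim
  · have h2 := (cubeRoot_ne_one hu h1).2
    have h3 : sg b * u.im ≠ 0 := mul_ne_zero (sg_ne_zero b) (by intro h; norm_num [h] at h2)
    rcases lt_or_gt_of_ne h3 with h | h
    · exact .inr (halfSutures_isStdNeg hu h1 h)
    · exact .inl (halfSutures_isStdPos hu h1 h)

/-! ### Three bases of the degree zero summand of the hexagon -/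

theorem Theory.hexagon_basis (𝒟 : Theory) {u u' v w w' : ℂ} (hu : u ^ 3 = 1) (hu' : u' ^ 3 = 1)
    (hi : 0 < u.im) (hi' : u'.im < 0) (hv : v ^ 3 = 1) (hw : w ^ 3 = 1) (hw' : w' ^ 3 = 1)
    (h : w = v * u) (h' : w' = v * u') {x y : 𝒟.V hexagon}
    (hx : x ∈ 𝒟.c (hexSutures hw)) (hy : y ∈ 𝒟.c (hexSutures hw')) :
    LinearIndependent (CoeffRing hexagon) ![x, y] ∧
      Submodule.span (CoeffRing hexagon) {x, y} = 𝒟.gr hexagon 0 := by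
  have h1 : u ≠ 1 := by rintro rfl; simp at hi
  have h1' : u' ≠ 1 := by rintro rfl; simp at hi'
  -- The sign of the imaginary part decides which half receives the positive square sutures: for `u`
  -- the upper half, for `u'` the lower one.
  refine 𝒟.two_squares (hexQuadrangulation hv) (p := true) (q := false)
    (show (true : Bool) ≠ false by decide) (fun b => by cases b; exacts [.inr rfl, .inl rfl]) (hexSutures_isBasic hu h1 hv hw h)
    (hexSutures_isBasic hu' h1' hv hw' h') ?_ ?_ ?_ ?_ hx hy
  · exact halfSutures_isStdPos hu h1 (by simpa [sg] using hi)
  · exact halfSutures_isStdNeg hu h1 (by simpa [sg] using hi)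
  · exact halfSutures_isStdNeg hu' h1' (by simpa [sg] using hi')
  · exact halfSutures_isStdPos hu' h1' (by simpa [sg] using hi')

/-- The primitive cube root of unity in the upper half plane. -/
def zeta : ℂ := Complex.exp (((2 * Real.pi / 3 : ℝ) : ℂ) * Complex.I)

theorem zeta_cube : zeta ^ 3 = 1 := by
  rw [zeta, ← Complex.exp_nat_mul, ← Complex.exp_two_pi_mul_I]
  congr 1
  push_cast
  ring

theorem zeta_pow_cube (k : ℕ) : (zeta ^ k) ^ 3 = 1 := by
  rw [← pow_mul, mul_comm, pow_mul, zeta_cube, one_pow]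

theorem zeta_im_pos : 0 < zeta.im := by
  rw [zeta, Complex.exp_ofReal_mul_I_im]
  have := Real.pi_pos
  exact Real.sin_pos_of_pos_of_lt_pi (by positivity) (by linarith)

theorem zeta_sq_im_neg : (zeta ^ 2).im < 0 := by
  have h := zeta_im_pos
  have hr := (cubeRoot_ne_one zeta_cube (by intro h1; simp [h1] at h)).1
  rw [pow_two, Complex.mul_im, hr]
  linarith

/-- The suture elements of the three sets of parallel sutures on the hexagon satisfy the bypass
relation. -/
theorem Theory.hexagon_relation (𝒟 : Theory) :
    ∃ x : Fin 3 → 𝒟.V hexagon, (∀ k : Fin 3, x k ∈ 𝒟.c (hexSutures (zeta_pow_cube k))) ∧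
      x 0 + x 1 + x 2 = 0 := by
  have hne : ∀ Γ : Sutures hexagon, ∃ x, 𝒟.c Γ = unitOrbit (CoeffRing hexagon) x := 𝒟.c_orbit
  choose x hx using fun k : Fin 3 => hne (hexSutures (zeta_pow_cube k))
  have hmem : ∀ k : Fin 3, x k ∈ 𝒟.c (hexSutures (zeta_pow_cube k)) := fun k => by
    rw [hx]; exact ⟨1, by simp⟩
  have hz2 := zeta_pow_cube 2
  -- The diagonal in the direction of `zeta ^ k` gives a basis made of the suture elements of the
  -- other two families; multiplying by `zeta` permutes the families cyclically.
  have b0 := 𝒟.hexagon_basis zeta_cube hz2 zeta_im_pos zeta_sq_im_neg (v := 1) (by norm_num)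
    (zeta_pow_cube (1 : Fin 3)) (zeta_pow_cube (2 : Fin 3)) (by simp) (by simp) (hmem 1) (hmem 2)
  have b1 := 𝒟.hexagon_basis zeta_cube hz2 zeta_im_pos zeta_sq_im_neg (v := zeta) zeta_cube
    (zeta_pow_cube (2 : Fin 3)) (zeta_pow_cube (0 : Fin 3)) (by simp [pow_two])
    (by rw [← pow_succ', zeta_cube]; simp) (hmem 2) (hmem 0)
  have b2 := 𝒟.hexagon_basis zeta_cube hz2 zeta_im_pos zeta_sq_im_neg (v := zeta ^ 2) hz2
    (zeta_pow_cube (0 : Fin 3)) (zeta_pow_cube (1 : Fin 3))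
    (by rw [← pow_succ, zeta_cube]; simp)
    (by rw [← pow_add, show 2 + 2 = 3 + 1 from rfl, pow_succ, zeta_cube]; simp) (hmem 0) (hmem 1)
  have hg : ∀ k : Fin 3, x k ∈ 𝒟.gr hexagon 0 := by
    intro k
    fin_cases k
    · rw [← b1.2]; exact Submodule.subset_span (.inr rfl)
    · rw [← b0.2]; exact Submodule.subset_span (.inl rfl)
    · rw [← b0.2]; exact Submodule.subset_span (.inr rfl)
  -- All three elements lie in degree 0, and each of the three pairs spans it; these are the
  -- memberships needed.
  obtain ⟨a, b, hab⟩ := exists_unit_relation b0.1 (z := x 0) (b0.2 ▸ hg 0)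
    (by rw [Set.pair_comm, b1.2]; exact hg 1) (by rw [b2.2]; exact hg 2)
  -- A suture element times a unit is again one, so `a` and `b` are absorbed.
  refine ⟨![x 0, (a : CoeffRing hexagon) • x 1, (b : CoeffRing hexagon) • x 2], ?_, ?_⟩
  · intro k
    fin_cases k
    · exact hmem 0
    · change _ ∈ 𝒟.c (hexSutures (zeta_pow_cube (1 : Fin 3)))
      rw [hx]; exact ⟨a, rfl⟩
    · change _ ∈ 𝒟.c (hexSutures (zeta_pow_cube (2 : Fin 3)))
      rw [hx]; exact ⟨b, rfl⟩
  · simp only [Matrix.cons_val_zero, Matrix.cons_val_one, Matrix.cons_val]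
    rw [add_assoc, add_comm]
    exact hab

/-! ### The bypass curves -/

theorem hexPoint_eq (k : ℕ) : hexPoint k =
    ⟨Real.cos (Real.pi / 6 + k * (Real.pi / 3)), Real.sin (Real.pi / 6 + k * (Real.pi / 3))⟩ := by
  apply Complex.ext
  · rw [hexPoint, Complex.exp_ofReal_mul_I_re]
  · rw [hexPoint, Complex.exp_ofReal_mul_I_im]

theorem hexPoint_zero : hexPoint 0 = ⟨√3 / 2, 1 / 2⟩ := by
  rw [hexPoint_eq]; simp

theorem hexPoint_one : hexPoint 1 = ⟨0, 1⟩ := by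
  rw [hexPoint_eq, show Real.pi / 6 + (1 : ℕ) * (Real.pi / 3) = Real.pi / 2 by push_cast; ring]
  simp

theorem hexPoint_two : hexPoint 2 = ⟨-(√3 / 2), 1 / 2⟩ := by
  rw [hexPoint_eq, show Real.pi / 6 + (2 : ℕ) * (Real.pi / 3) = Real.pi - Real.pi / 6 by
    push_cast; ring, Real.cos_pi_sub, Real.sin_pi_sub]
  simp

theorem hexPoint_add_three (k : ℕ) : hexPoint (k + 3) = -hexPoint k := by
  rw [hexPoint_eq, hexPoint_eq, show Real.pi / 6 + (k + 3 : ℕ) * (Real.pi / 3) =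
    Real.pi / 6 + k * (Real.pi / 3) + Real.pi by push_cast; ring, Real.cos_add_pi, Real.sin_add_pi]
  rfl

theorem norm_hexPoint (k : ℕ) : ‖hexPoint k‖ = 1 := Complex.norm_exp_ofReal_mul_I _

theorem hexPoint_cube_re (k : ℕ) : (hexPoint k ^ 3).re = 0 := by
  rw [hexPoint, ← Complex.exp_nat_mul,
    show ((3 : ℕ) : ℂ) * (((Real.pi / 6 + k * (Real.pi / 3) : ℝ) : ℂ) * Complex.I) =
      ((Real.pi / 2 + k * Real.pi : ℝ) : ℂ) * Complex.I by push_cast; ring,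
    Complex.exp_ofReal_mul_I_re, Real.cos_add_nat_mul_pi, Real.cos_pi_div_two, mul_zero]

theorem mem_vertical_segment {a b : ℝ} (hb : 0 < b) {z : ℂ} :
    z ∈ segment ℝ (⟨a, b⟩ : ℂ) ⟨a, -b⟩ ↔ z.re = a ∧ |z.im| ≤ b := by
  constructor
  · rintro ⟨s, t, hs, ht, hst, rfl⟩
    simp only [Complex.add_re, Complex.add_im, Complex.smul_re, Complex.smul_im, smul_eq_mul]
    refine ⟨by rw [← add_mul, hst, one_mul], abs_le.2 ⟨?_, ?_⟩⟩ <;> nlinarith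
  · rintro ⟨h1, h2⟩
    rw [abs_le] at h2
    refine ⟨(1 + z.im / b) / 2, (1 - z.im / b) / 2, ?_, ?_, by ring, ?_⟩
    · have : -1 ≤ z.im / b := by rw [le_div_iff₀ hb]; linarith
      linarith
    · have : z.im / b ≤ 1 := by rw [div_le_iff₀ hb]; linarith
      linarith
    · apply Complex.ext
      · simp only [Complex.add_re, Complex.smul_re, smul_eq_mul]; rw [h1]; ring
      · simp only [Complex.add_im, Complex.smul_im, smul_eq_mul]; field_simp; ring

theorem mem_bypassCurve₀ {z : ℂ} : z ∈ bypassCurve₀ ↔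
    (z.re = √3 / 2 ∧ |z.im| ≤ 1 / 2) ∨ (z.re = 0 ∧ |z.im| ≤ 1) ∨
      (z.re = -(√3 / 2) ∧ |z.im| ≤ 1 / 2) ∨ ∃ k < 6, ∃ r : ℝ, 1 ≤ r ∧ z = r * hexPoint k := by
  have h3 : hexPoint 3 = ⟨-(√3 / 2), -(1 / 2)⟩ := by
    rw [hexPoint_add_three 0, hexPoint_zero]; rfl
  have h4 : hexPoint 4 = ⟨0, -1⟩ := by
    rw [hexPoint_add_three 1, hexPoint_one]; apply Complex.ext <;> simp
  have h5 : hexPoint 5 = ⟨√3 / 2, -(1 / 2)⟩ := by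
    rw [hexPoint_add_three 2, hexPoint_two]; apply Complex.ext <;> simp
  have hseg : segment ℝ (hexPoint 2) (hexPoint 3) =
      segment ℝ (⟨-(√3 / 2), 1 / 2⟩ : ℂ) ⟨-(√3 / 2), -(1 / 2)⟩ := by rw [hexPoint_two, h3]
  rw [bypassCurve₀, mem_union, mem_union, mem_union, hseg, hexPoint_zero, h5, hexPoint_one, h4,
    mem_vertical_segment one_half_pos, mem_vertical_segment one_pos,
    mem_vertical_segment one_half_pos, or_assoc, or_assoc]
  rfl

theorem sqrt_three_div_two_sq : (√3 / 2) ^ 2 = 3 / 4 := by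
  rw [div_pow, Real.sq_sqrt (by norm_num)]; norm_num

theorem re_sq_add_im_sq (z : ℂ) : z.re ^ 2 + z.im ^ 2 = ‖z‖ ^ 2 := by
  rw [← Complex.normSq_eq_norm_sq, Complex.normSq_apply]; ring

theorem cheb_re {z : ℂ} (hz : ‖z‖ = 1) : cheb z.re = (z ^ 3).re := by
  have := cheb_tcoord (u := 1) (by norm_num) hz
  simpa [tcoord] using this

theorem cheb_eq_zero_iff {s : ℝ} : cheb s = 0 ↔ s = √3 / 2 ∨ s = 0 ∨ s = -(√3 / 2) := by
  have h3 := sqrt_three_div_two_sq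
  constructor
  · intro h
    rcases cheb_eq_zero h with h | h
    · exact .inr (.inl h)
    · rw [← h3, sq_eq_sq_iff_eq_or_eq_neg] at h
      tauto
  · rintro (rfl | rfl | rfl)
    · unfold cheb; linear_combination (4 * (√3 / 2)) * h3
    · simp [cheb]
    · unfold cheb; linear_combination (-4 * (√3 / 2)) * h3

/-- The chords are the parts in the disc of the vertical lines over the roots of `cheb`; the rays
contribute only their starting points, which are endpoints of chords. -/
theorem mem_bypassCurve₀_inside {z : ℂ} (hz : ‖z‖ ≤ 1) :
    z ∈ bypassCurve₀ ↔ cheb z.re = 0 := by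
  have h3 := sqrt_three_div_two_sq
  have hn := re_sq_add_im_sq z
  have hz0 := norm_nonneg z
  rw [mem_bypassCurve₀]
  constructor
  · rintro (h | h | h | ⟨k, -, r, hr, rfl⟩)
    · exact cheb_eq_zero_iff.2 (.inl h.1)
    · exact cheb_eq_zero_iff.2 (.inr (.inl h.1))
    · exact cheb_eq_zero_iff.2 (.inr (.inr h.1))
    · rw [norm_mul, norm_hexPoint, mul_one, Complex.norm_real, Real.norm_eq_abs] at hz
      have : r = 1 := le_antisymm ((le_abs_self r).trans hz) hr
      rw [this, Complex.ofReal_one, one_mul, cheb_re (norm_hexPoint k), hexPoint_cube_re]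
  · rw [cheb_eq_zero_iff]
    rintro (h | h | h)
    · refine .inl ⟨h, abs_le_of_sq_le_sq (by rw [h, h3] at hn; nlinarith) (by norm_num)⟩
    · refine .inr (.inl ⟨h, abs_le_of_sq_le_sq (by rw [h] at hn; nlinarith) (by norm_num)⟩)
    · refine .inr (.inr (.inl ⟨h, abs_le_of_sq_le_sq (by rw [h, neg_sq, h3] at hn; nlinarith)
        (by norm_num)⟩))

theorem exists_hexPoint_of_cube_re {w : ℂ} (hw : ‖w‖ = 1) (h : (w ^ 3).re = 0) :
    ∃ k < 6, w = hexPoint k := by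
  have h3 := sqrt_three_div_two_sq
  have hn := re_sq_add_im_sq w
  rw [hw] at hn
  rw [← cheb_re hw, cheb_eq_zero_iff] at h
  rcases h with h | h | h
  · have him : w.im ^ 2 = (1 / 2) ^ 2 := by rw [h, h3] at hn; linarith
    rcases sq_eq_sq_iff_eq_or_eq_neg.1 him with h' | h'
    · exact ⟨0, by norm_num, by rw [hexPoint_zero]; exact Complex.ext h h'⟩
    · refine ⟨5, by norm_num, ?_⟩
      rw [hexPoint_add_three 2, hexPoint_two]
      apply Complex.ext <;> simp [h, h']
  · have him : w.im ^ 2 = 1 ^ 2 := by rw [h] at hn; linarith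
    rcases sq_eq_sq_iff_eq_or_eq_neg.1 him with h' | h'
    · exact ⟨1, by norm_num, by rw [hexPoint_one]; exact Complex.ext h h'⟩
    · refine ⟨4, by norm_num, ?_⟩
      rw [hexPoint_add_three 1, hexPoint_one]
      apply Complex.ext <;> simp [h, h']
  · have him : w.im ^ 2 = (1 / 2) ^ 2 := by rw [h, neg_sq, h3] at hn; linarith
    rcases sq_eq_sq_iff_eq_or_eq_neg.1 him with h' | h'
    · exact ⟨2, by norm_num, by rw [hexPoint_two]; exact Complex.ext h h'⟩
    · refine ⟨3, by norm_num, ?_⟩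
      rw [hexPoint_add_three 0, hexPoint_zero]
      apply Complex.ext <;> simp [h, h']

theorem mem_bypassCurve₀_outside {z : ℂ} (hz : 1 ≤ ‖z‖) :
    z ∈ bypassCurve₀ ↔ (z ^ 3).re = 0 := by
  have hz0 : (0 : ℝ) < ‖z‖ := by linarith
  constructor
  · intro h
    rcases le_or_gt ‖z‖ 1 with h1 | h1
    · rw [← cheb_re (le_antisymm h1 hz)]
      exact (mem_bypassCurve₀_inside h1).1 h
    · have h3 := sqrt_three_div_two_sq
      have hn := re_sq_add_im_sq z
      rcases mem_bypassCurve₀.1 h with ⟨h, h'⟩ | ⟨h, h'⟩ | ⟨h, h'⟩ | ⟨k, -, r, hr, rfl⟩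
      · have := sq_le_sq' (abs_le.1 h').1 (abs_le.1 h').2
        rw [h, h3] at hn; nlinarith
      · have := sq_le_sq' (abs_le.1 h').1 (abs_le.1 h').2
        rw [h] at hn; nlinarith
      · have := sq_le_sq' (abs_le.1 h').1 (abs_le.1 h').2
        rw [h, neg_sq, h3] at hn; nlinarith
      · rw [mul_pow, ← Complex.ofReal_pow, Complex.re_ofReal_mul, hexPoint_cube_re, mul_zero]
  · intro h
    have hw : z = (‖z‖ : ℂ) * ((‖z‖⁻¹ : ℝ) * z) := by
      rw [← mul_assoc, ← Complex.ofReal_mul, mul_inv_cancel₀ hz0.ne', Complex.ofReal_one, one_mul]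
    obtain ⟨k, hk, hk'⟩ := exists_hexPoint_of_cube_re (w := (‖z‖⁻¹ : ℝ) * z)
      (by rw [norm_mul, Complex.norm_real, norm_inv, norm_norm, inv_mul_cancel₀ hz0.ne'])
      (by rw [mul_pow, ← Complex.ofReal_pow, Complex.re_ofReal_mul, h, mul_zero])
    exact mem_bypassCurve₀.2 (.inr (.inr (.inr ⟨k, hk, ‖z‖, hz, hk' ▸ hw⟩)))

theorem mem_bypassCurve {i : Fin 3} {z : ℂ} :
    z ∈ bypassCurve i ↔ (starRingEnd ℂ) (zeta ^ (i : ℕ)) * z ∈ bypassCurve₀ := by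
  have h : Complex.exp (((2 * Real.pi / 3 * (i : ℕ) : ℝ) : ℂ) * Complex.I) = zeta ^ (i : ℕ) := by
    rw [zeta, ← Complex.exp_nat_mul]
    congr 1
    push_cast
    ring
  have hc : (starRingEnd ℂ) (zeta ^ (i : ℕ)) * zeta ^ (i : ℕ) = 1 := by
    rw [← Complex.normSq_eq_conj_mul_self, Complex.normSq_eq_norm_sq,
      norm_of_cube_eq_one (zeta_pow_cube i)]
    norm_num
  rw [bypassCurve, h]
  constructor
  · rintro ⟨w, hw, rfl⟩
    rwa [← mul_assoc, hc, one_mul]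
  · intro hz
    refine ⟨_, hz, ?_⟩
    simp only
    rw [← mul_assoc, mul_comm (zeta ^ (i : ℕ)), hc, one_mul]

theorem mem_bypassCurve_inside {i : Fin 3} {z : ℂ} (hz : ‖z‖ ≤ 1) :
    z ∈ bypassCurve i ↔ cheb (tcoord (zeta ^ (i : ℕ)) z) = 0 := by
  rw [mem_bypassCurve, mem_bypassCurve₀_inside, tcoord]
  rwa [norm_mul, Complex.norm_conj, norm_of_cube_eq_one (zeta_pow_cube i), one_mul]

/-- Outside the open disc the picture does not depend on `i`, since rotation by a cube root of unity
preserves `z³`. -/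
theorem mem_bypassCurve_outside {i : Fin 3} {z : ℂ} (hz : 1 ≤ ‖z‖) :
    z ∈ bypassCurve i ↔ (z ^ 3).re = 0 := by
  rw [mem_bypassCurve, mem_bypassCurve₀_outside, mul_pow, ← map_pow, zeta_pow_cube, map_one,
    one_mul]
  rwa [norm_mul, Complex.norm_conj, norm_of_cube_eq_one (zeta_pow_cube i), one_mul]

/-! ### Signs of the regions outside the bypass disc -/

namespace Sutures

variable {S : OccupiedSurface} (Γ : Sutures S)

theorem mem_curve_iff {x : S} : x ∈ Γ.curve ↔ x ∉ Γ.pos ∧ x ∉ Γ.neg := by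
  rw [curve, mem_compl_iff, mem_union, not_or]

/-- There are positive and negative points near each interior point of the sutures. -/
theorem exists_pos_neg_near {x : S} (hx : x ∈ Γ.curve) (hi : x ∈ S.inner) {U : Set S}
    (hU : U ∈ 𝓝 x) : (U ∩ Γ.pos).Nonempty ∧ (U ∩ Γ.neg).Nonempty := by
  obtain ⟨a, hxa, -, ha⟩ := Γ.inner_chart x hx hi
  have h0 : (a x).im = 0 := by
    have h1 := (mem_curve_iff Γ).1 hx
    rw [(ha x hxa).1, (ha x hxa).2] at h1
    linarith [h1.1, h1.2]
  have hev : ∀ᶠ w in 𝓝 (a x), a.symm w ∈ U ∧ w ∈ a.target := by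
    refine Filter.Eventually.and ?_ (a.open_target.mem_nhds (a.map_source hxa))
    refine (a.continuousAt_symm (a.map_source hxa)).eventually_mem ?_
    rwa [a.left_inv hxa]
  have hline : ∀ c : ℝ, Filter.Tendsto (fun t : ℝ => a x + (c * t : ℝ) * Complex.I) (𝓝[>] 0)
      (𝓝 (a x)) := fun c => by
    have : Continuous fun t : ℝ => a x + (c * t : ℝ) * Complex.I := by fun_prop
    simpa using (this.tendsto 0).mono_left (nhdsWithin_le_nhds (s := Ioi (0 : ℝ)))
  constructor
  · obtain ⟨t, ⟨h1, h2⟩, ht⟩ := (((hline 1).eventually hev).and self_mem_nhdsWithin).exists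
    refine ⟨_, h1, ((ha _ (a.map_target h2)).1).2 ?_⟩
    rw [a.right_inv h2]
    simpa [h0] using ht
  · obtain ⟨t, ⟨h1, h2⟩, ht⟩ := (((hline (-1)).eventually hev).and self_mem_nhdsWithin).exists
    refine ⟨_, h1, ((ha _ (a.map_target h2)).2).2 ?_⟩
    rw [a.right_inv h2]
    simpa [h0] using ht

end Sutures

/-- The signs of the regions of `Γ` at `e z` are given by the sign of `ε * re z³`. -/
def SignAt {S : OccupiedSurface} (Γ : Sutures S) (e : ℂ → S) (ε : ℝ) (z : ℂ) : Prop :=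
  (e z ∈ Γ.pos ↔ 0 < ε * (z ^ 3).re) ∧ (e z ∈ Γ.neg ↔ ε * (z ^ 3).re < 0)

theorem isPreconnected_norm_gt : IsPreconnected {z : ℂ | 1 < ‖z‖} := by
  have h : {z : ℂ | 1 < ‖z‖} = (fun p : ℝ × ℝ => (p.1 : ℂ) * Complex.exp (p.2 * Complex.I)) ''
      (Ioi 1 ×ˢ univ) := by
    ext z
    constructor
    · intro hz
      exact ⟨(‖z‖, Complex.arg z), ⟨hz, mem_univ _⟩, Complex.norm_mul_exp_arg_mul_I z⟩
    · rintro ⟨⟨r, θ⟩, ⟨hr, -⟩, rfl⟩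
      have hr' : (1 : ℝ) < r := hr
      rw [mem_ofPred_eq, norm_mul, Complex.norm_exp_ofReal_mul_I, mul_one, Complex.norm_real,
        Real.norm_eq_abs]
      exact hr'.trans_le (le_abs_self r)
  rw [h]
  exact (isPreconnected_Ioi.prod isPreconnected_univ).image _ (by fun_prop)

/-- Where both signs `ε = 1` and `ε = -1` were valid, `re y³` would vanish. Excluding this on open
sets makes the locally determined sign unique. -/
theorem not_eventually_cube_re_eq_zero {z : ℂ} (hz : z ≠ 0) :
    ¬∀ᶠ y in 𝓝 z, (y ^ 3).re = 0 := by
  intro h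
  have h0 : (z ^ 3).re = 0 := h.self_of_nhds
  have h1 : (z ^ 3).im ≠ 0 := fun h1 => pow_ne_zero 3 hz (Complex.ext h0 h1)
  -- Moving transversally to the ray through `z`: the cube of `1 + t i` has imaginary part `t (3 -
  -- t²)`, positive for small positive `t`.
  have hc : Continuous fun t : ℝ => z * (1 + t * Complex.I) := by fun_prop
  have hT : Filter.Tendsto (fun t : ℝ => z * (1 + t * Complex.I)) (𝓝[>] 0) (𝓝 z) := by
    simpa using (hc.tendsto 0).mono_left (nhdsWithin_le_nhds (s := Ioi (0 : ℝ)))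
  obtain ⟨t, ht, ht0, ht1⟩ := ((hT.eventually h).and
    (Ioo_mem_nhdsGT (show (0 : ℝ) < 1 by norm_num))).exists
  have h2 : ((1 + t * Complex.I) ^ 3 : ℂ).im = t * (3 - t ^ 2) := by
    simp [pow_succ]; ring
  rw [mul_pow, Complex.mul_re, h0, zero_mul, zero_sub, neg_eq_zero, h2] at ht
  have : 0 < t * (3 - t ^ 2) := mul_pos ht0 (by nlinarith)
  exact (mul_ne_zero h1 this.ne') ht

section Signs

variable {S : OccupiedSurface} {Γ : Sutures S} {e : ℂ → S}

theorem exists_signAt_near_of_ne (he : Continuous e) {z : ℂ}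
    (hz : (z ^ 3).re ≠ 0) (hc : e z ∉ Γ.curve) :
    ∃ ε : ℝ, (ε = 1 ∨ ε = -1) ∧ ∀ᶠ y in 𝓝 z, SignAt Γ e ε y := by
  have hcont : Continuous fun y : ℂ => (y ^ 3).re := by fun_prop
  have hd := Set.disjoint_left.1 Γ.disjoint
  have hpn : e z ∈ Γ.pos ∨ e z ∈ Γ.neg := by
    rw [Sutures.mem_curve_iff] at hc; tauto
  rcases hpn with hp | hp
  · obtain ⟨ε, hε, hpos⟩ : ∃ ε : ℝ, (ε = 1 ∨ ε = -1) ∧ 0 < ε * (z ^ 3).re := by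
      rcases lt_or_gt_of_ne hz with h | h
      exacts [⟨-1, .inr rfl, by linarith⟩, ⟨1, .inl rfl, by linarith⟩]
    refine ⟨ε, hε, ?_⟩
    filter_upwards [he.continuousAt.eventually_mem (Γ.isOpen_pos.mem_nhds hp),
      (continuous_const.mul hcont).continuousAt.eventually_const_lt hpos] with y hy hy'
    exact ⟨iff_of_true hy hy', iff_of_false (hd hy) hy'.not_gt⟩
  · obtain ⟨ε, hε, hpos⟩ : ∃ ε : ℝ, (ε = 1 ∨ ε = -1) ∧ ε * (z ^ 3).re < 0 := by
      rcases lt_or_gt_of_ne hz with h | h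
      exacts [⟨1, .inl rfl, by linarith⟩, ⟨-1, .inr rfl, by linarith⟩]
    refine ⟨ε, hε, ?_⟩
    filter_upwards [he.continuousAt.eventually_mem (Γ.isOpen_neg.mem_nhds hp),
      (continuous_const.mul hcont).continuousAt.eventually_lt_const hpos] with y hy hy'
    exact ⟨iff_of_false (fun h => hd h hy) hy'.not_gt, iff_of_true hy hy'⟩

/-- In the coordinate `w = y / z` near 1 the suture is the real axis. Each half of a small ball
avoids it and is convex, hence lies in one region. Regions of both signs accumulate at a suture, so
the halves have opposite signs, as does `re y³`, whose sign is that of `-c * w.im`. -/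
theorem exists_signAt_near_of_eq (he : IsOpenEmbedding e) (hi : range e ⊆ S.inner)
    (hc : ∀ z, 1 ≤ ‖z‖ → (e z ∈ Γ.curve ↔ (z ^ 3).re = 0)) {z : ℂ} (hz : 1 < ‖z‖)
    (h0 : (z ^ 3).re = 0) :
    ∃ ε : ℝ, (ε = 1 ∨ ε = -1) ∧ ∀ᶠ y in 𝓝 z, SignAt Γ e ε y := by
  have hz0 : z ≠ 0 := by rintro rfl; norm_num at hz
  have hd := Set.disjoint_left.1 Γ.disjoint
  set c := (z ^ 3).im with hcdef
  have hc0 : c ≠ 0 := fun h1 => pow_ne_zero 3 hz0 (Complex.ext h0 h1)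
  obtain ⟨ρ, hρ, hρ'⟩ : ∃ ρ > 0, ∀ w ∈ Metric.ball (1 : ℂ) ρ, 1 < ‖z * w‖ ∧ ‖w - 1‖ < 1 / 2 := by
    have h1 : Continuous fun w : ℂ => ‖z * w‖ := by fun_prop
    have h2 : Continuous fun w : ℂ => ‖w - 1‖ := by fun_prop
    have e1 : ∀ᶠ w in 𝓝 (1 : ℂ), 1 < ‖z * w‖ :=
      h1.continuousAt.eventually_const_lt (by simpa using hz)
    have e2 : ∀ᶠ w in 𝓝 (1 : ℂ), ‖w - 1‖ < 1 / 2 :=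
      h2.continuousAt.eventually_lt_const (by simp)
    exact Metric.eventually_nhds_iff_ball.1 (e1.and e2)
  have hre : ∀ w : ℂ, ((z * w) ^ 3).re = -c * (w ^ 3).im := fun w => by
    rw [mul_pow, Complex.mul_re, h0, ← hcdef]; ring
  -- The radius `1/2` ensures that `3 w.re² - w.im²` is positive: `w.re > 1/2` and `|w.im| < 1/2`.
  have him : ∀ w ∈ Metric.ball (1 : ℂ) ρ, ∃ q > 0, (w ^ 3).im = q * w.im := by
    intro w hw
    have h1 := (Complex.abs_re_le_norm (w - 1)).trans_lt (hρ' w hw).2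
    have h2 := (Complex.abs_im_le_norm (w - 1)).trans_lt (hρ' w hw).2
    rw [abs_lt] at h1 h2
    simp only [Complex.sub_re, Complex.sub_im, Complex.one_re, Complex.one_im] at h1 h2
    refine ⟨3 * w.re ^ 2 - w.im ^ 2, by nlinarith, ?_⟩
    simp [pow_succ]; ring
  have hcurve : ∀ w ∈ Metric.ball (1 : ℂ) ρ, e (z * w) ∈ Γ.curve ↔ w.im = 0 := by
    intro w hw
    obtain ⟨q, hq, hq'⟩ := him w hw
    rw [hc _ (hρ' w hw).1.le, hre, hq', mul_eq_zero, or_iff_right (neg_ne_zero.2 hc0), mul_eq_zero,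
      or_iff_right hq.ne']
  have hf : Continuous fun w : ℂ => e (z * w) := he.continuous.comp (by fun_prop)
  have hside : ∀ A : Set ℂ, Convex ℝ A → A ⊆ {w | w.im ≠ 0} →
      (∀ w ∈ Metric.ball (1 : ℂ) ρ ∩ A, e (z * w) ∈ Γ.pos) ∨
      (∀ w ∈ Metric.ball (1 : ℂ) ρ ∩ A, e (z * w) ∈ Γ.neg) := by
    intro A hA hA'
    refine (((convex_ball (1 : ℂ) ρ).inter hA).isPreconnected).subset_or_subset
      (Γ.isOpen_pos.preimage hf) (Γ.isOpen_neg.preimage hf)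
      (Γ.disjoint.preimage _) ?_
    intro w hw
    have := (hcurve w hw.1).not.2 (hA' hw.2)
    rw [Sutures.mem_curve_iff] at this
    change e (z * w) ∈ Γ.pos ∨ e (z * w) ∈ Γ.neg
    tauto
  have hup := hside {w | 0 < w.im} (convex_halfSpace_im_gt 0) fun w hw => ne_of_gt hw
  have hdn := hside {w | w.im < 0} (convex_halfSpace_im_lt 0) fun w hw => ne_of_lt hw
  have hnhds : (fun w => e (z * w)) '' Metric.ball 1 ρ ∈ 𝓝 (e z) := by
    have hop : IsOpenMap fun w : ℂ => e (z * w) :=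
      he.isOpenMap.comp (Homeomorph.mulLeft₀ z hz0).isOpenMap
    have := hop.image_mem_nhds (Metric.ball_mem_nhds (1 : ℂ) hρ)
    simpa using this
  obtain ⟨⟨_, ⟨wp, hwp, rfl⟩, hwp'⟩, ⟨_, ⟨wn, hwn, rfl⟩, hwn'⟩⟩ :=
    Γ.exists_pos_neg_near ((hc z hz.le).2 h0) (hi (mem_range_self z)) hnhds
  have hnz : ∀ w ∈ Metric.ball (1 : ℂ) ρ, (e (z * w) ∈ Γ.pos ∨ e (z * w) ∈ Γ.neg) →
      w.im < 0 ∨ 0 < w.im := by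
    intro w hw h
    have : w.im ≠ 0 := fun h' => by
      have := (Sutures.mem_curve_iff Γ).1 ((hcurve w hw).2 h')
      tauto
    exact lt_or_gt_of_ne this
  have hfin : ∀ ε : ℝ, (ε = 1 ∨ ε = -1) →
      (∀ w ∈ Metric.ball (1 : ℂ) ρ, SignAt Γ e ε (z * w)) →
      ∃ ε : ℝ, (ε = 1 ∨ ε = -1) ∧ ∀ᶠ y in 𝓝 z, SignAt Γ e ε y := by
    intro ε hε h
    refine ⟨ε, hε, ?_⟩
    have hd : ContinuousAt (fun y : ℂ => z⁻¹ * y) z := by fun_prop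
    have : ∀ᶠ y in 𝓝 z, z⁻¹ * y ∈ Metric.ball (1 : ℂ) ρ :=
      hd.eventually_mem (by rw [inv_mul_cancel₀ hz0]; exact Metric.ball_mem_nhds _ hρ)
    filter_upwards [this] with y hy
    simpa [mul_inv_cancel_left₀ hz0] using h _ hy
  have key : ∀ ε : ℝ, ∀ w ∈ Metric.ball (1 : ℂ) ρ,
      ((0 < ε * ((z * w) ^ 3).re ↔ 0 < (ε * -c) * w.im) ∧
        (ε * ((z * w) ^ 3).re < 0 ↔ (ε * -c) * w.im < 0)) := by
    intro ε w hw
    obtain ⟨q, hq, hq'⟩ := him w hw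
    have : ε * ((z * w) ^ 3).re = q * ((ε * -c) * w.im) := by rw [hre, hq']; ring
    rw [this]
    exact ⟨mul_pos_iff_of_pos_left hq, by
      rw [← neg_pos, ← mul_neg, mul_pos_iff_of_pos_left hq, neg_pos]⟩
  -- Equal signs on the two halves contradict the nearby points `wp`, `wn` of opposite sign. In the
  -- mixed cases `ε` is chosen by the sign of `c`.
  rcases hup with hup | hup <;> rcases hdn with hdn | hdn
  · rcases hnz wn hwn (.inr hwn') with h | h
    exacts [(hd (hdn wn ⟨hwn, h⟩) hwn').elim, (hd (hup wn ⟨hwn, h⟩) hwn').elim]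
  · obtain ⟨ε, hε, hεc⟩ : ∃ ε : ℝ, (ε = 1 ∨ ε = -1) ∧ 0 < ε * -c := by
      rcases lt_or_gt_of_ne hc0 with h | h
      exacts [⟨1, .inl rfl, by linarith⟩, ⟨-1, .inr rfl, by linarith⟩]
    refine hfin ε hε fun w hw => ?_
    have k1 : 0 < ε * -c * w.im ↔ 0 < w.im := mul_pos_iff_of_pos_left hεc
    have k2 : ε * -c * w.im < 0 ↔ w.im < 0 := by
      rw [← neg_pos, ← mul_neg, mul_pos_iff_of_pos_left hεc, neg_pos]
    rw [SignAt, (key ε w hw).1, (key ε w hw).2, k1, k2]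
    rcases lt_trichotomy w.im 0 with h | h | h
    · have hw' := hdn w ⟨hw, h⟩
      exact ⟨iff_of_false (fun h' => hd h' hw') h.not_gt, iff_of_true hw' h⟩
    · have := (Sutures.mem_curve_iff Γ).1 ((hcurve w hw).2 h)
      exact ⟨iff_of_false this.1 (by simp [h]), iff_of_false this.2 (by simp [h])⟩
    · have hw' := hup w ⟨hw, h⟩
      exact ⟨iff_of_true hw' h, iff_of_false (hd hw') h.not_gt⟩
  · obtain ⟨ε, hε, hεc⟩ : ∃ ε : ℝ, (ε = 1 ∨ ε = -1) ∧ ε * -c < 0 := by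
      rcases lt_or_gt_of_ne hc0 with h | h
      exacts [⟨-1, .inr rfl, by linarith⟩, ⟨1, .inl rfl, by linarith⟩]
    refine hfin ε hε fun w hw => ?_
    have k1 : 0 < ε * -c * w.im ↔ w.im < 0 := by
      rw [← neg_mul_neg, mul_pos_iff_of_pos_left (neg_pos.2 hεc), neg_pos]
    have k2 : ε * -c * w.im < 0 ↔ 0 < w.im := by
      rw [← neg_pos, ← neg_mul, mul_pos_iff_of_pos_left (neg_pos.2 hεc)]
    rw [SignAt, (key ε w hw).1, (key ε w hw).2, k1, k2]
    rcases lt_trichotomy w.im 0 with h | h | h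
    · have hw' := hdn w ⟨hw, h⟩
      exact ⟨iff_of_true hw' h, iff_of_false (hd hw') h.not_gt⟩
    · have := (Sutures.mem_curve_iff Γ).1 ((hcurve w hw).2 h)
      exact ⟨iff_of_false this.1 (by simp [h]), iff_of_false this.2 (by simp [h])⟩
    · have hw' := hup w ⟨hw, h⟩
      exact ⟨iff_of_false (fun h' => hd h' hw') h.not_gt, iff_of_true hw' h⟩
  · rcases hnz wp hwp (.inl hwp') with h | h
    exacts [(hd hwp' (hdn wp ⟨hwp, h⟩)).elim, (hd hwp' (hup wp ⟨hwp, h⟩)).elim]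

/-- If the sutures are radial outside the unit disc, as in a bypass triple, then the signs of the
regions there alternate. -/
theorem exists_signAt_outside (he : IsOpenEmbedding e) (hi : range e ⊆ S.inner)
    (hc : ∀ z, 1 ≤ ‖z‖ → (e z ∈ Γ.curve ↔ (z ^ 3).re = 0)) :
    ∃ ε : ℝ, (ε = 1 ∨ ε = -1) ∧ ∀ z, 1 ≤ ‖z‖ → SignAt Γ e ε z := by
  -- The sets where either sign is locally valid are open and disjoint, and cover the connected
  -- exterior of the closed disc; one of them is therefore everything.
  let G : ℝ → Set ℂ := fun ε => {z | 1 < ‖z‖} ∩ {z | ∀ᶠ y in 𝓝 z, SignAt Γ e ε y}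
  have hG : ∀ ε, IsOpen (G ε) := fun ε =>
    (isOpen_lt continuous_const continuous_norm).inter isOpen_setOfPred_eventually_nhds
  have hcov : {z : ℂ | 1 < ‖z‖} ⊆ G 1 ∪ G (-1) := by
    intro z hz
    have : ∃ ε : ℝ, (ε = 1 ∨ ε = -1) ∧ ∀ᶠ y in 𝓝 z, SignAt Γ e ε y := by
      by_cases h0 : (z ^ 3).re = 0
      · exact exists_signAt_near_of_eq he hi hc hz h0
      · exact exists_signAt_near_of_ne he.continuous h0
          ((hc z (le_of_lt hz)).not.2 h0)
    rcases this with ⟨ε, rfl | rfl, h⟩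
    exacts [.inl ⟨hz, h⟩, .inr ⟨hz, h⟩]
  have hdisj : Disjoint (G 1) (G (-1)) := by
    rw [Set.disjoint_left]
    rintro z ⟨hz, h1⟩ ⟨-, h2⟩
    have hz' : 1 < ‖z‖ := hz
    refine not_eventually_cube_re_eq_zero (z := z) (by rintro rfl; norm_num at hz') ?_
    filter_upwards [h1, h2] with y h1 h2
    have e1 := h1.1.symm.trans h2.1
    have e2 := h1.2.symm.trans h2.2
    rcases lt_trichotomy (y ^ 3).re 0 with h | h | h
    · have := e2.1 (by linarith); linarith
    · exact h
    · have := e1.1 (by linarith); linarith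
  have hall : ∃ ε : ℝ, (ε = 1 ∨ ε = -1) ∧ ∀ z, 1 < ‖z‖ → SignAt Γ e ε z := by
    rcases isPreconnected_norm_gt.subset_or_subset (hG 1) (hG (-1)) hdisj hcov with h | h
    · exact ⟨1, .inl rfl, fun z hz => (h hz).2.self_of_nhds⟩
    · exact ⟨-1, .inr rfl, fun z hz => (h hz).2.self_of_nhds⟩
  obtain ⟨ε, hε, hs⟩ := hall
  refine ⟨ε, hε, fun z hz => ?_⟩
  -- Points of the circle itself are reached along rays: regions are open, and scaling by `r > 1`
  -- multiplies `re z³` by the positive factor `r³`.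
  have hlim : ∀ U : Set S, IsOpen U → e z ∈ U → ∃ r : ℝ, 1 < r ∧ e (r * z) ∈ U := by
    intro U hU hzU
    have hcont : Continuous fun r : ℝ => e (r * z) := he.continuous.comp (by fun_prop)
    have h1 : ∀ᶠ r : ℝ in 𝓝 1, e (r * z) ∈ U :=
      hcont.continuousAt.eventually_mem (hU.mem_nhds (by simpa using hzU))
    have : ∀ᶠ r : ℝ in 𝓝[>] 1, e (r * z) ∈ U := h1.filter_mono nhdsWithin_le_nhds
    obtain ⟨r, hr, hr1⟩ := (this.and self_mem_nhdsWithin).exists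
    exact ⟨r, hr1, hr⟩
  have hscale : ∀ r : ℝ, 1 < r → 1 < ‖(r * z : ℂ)‖ ∧ 0 < r ^ 3 ∧
      ε * ((r * z : ℂ) ^ 3).re = r ^ 3 * (ε * (z ^ 3).re) := by
    intro r hr
    refine ⟨?_, by positivity, ?_⟩
    · rw [norm_mul, Complex.norm_real, Real.norm_eq_abs, abs_of_pos (by linarith)]
      nlinarith
    · rw [mul_pow, ← Complex.ofReal_pow, Complex.re_ofReal_mul]; ring
  have hp : e z ∈ Γ.pos → 0 < ε * (z ^ 3).re := by
    intro h
    obtain ⟨r, hr, h'⟩ := hlim _ Γ.isOpen_pos h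
    obtain ⟨h1, h2, h3⟩ := hscale r hr
    rw [(hs _ h1).1, h3] at h'
    exact (mul_pos_iff_of_pos_left h2).1 h'
  have hn : e z ∈ Γ.neg → ε * (z ^ 3).re < 0 := by
    intro h
    obtain ⟨r, hr, h'⟩ := hlim _ Γ.isOpen_neg h
    obtain ⟨h1, h2, h3⟩ := hscale r hr
    rw [(hs _ h1).2, h3] at h'
    nlinarith
  have hor : ε * (z ^ 3).re ≠ 0 → e z ∈ Γ.pos ∨ e z ∈ Γ.neg := by
    intro h
    have := (hc z hz).not.2 (right_ne_zero_of_mul h)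
    rw [Sutures.mem_curve_iff] at this
    tauto
  refine ⟨⟨hp, fun h => (hor h.ne').resolve_right fun h' => ?_⟩,
    ⟨hn, fun h => (hor h.ne).resolve_left fun h' => ?_⟩⟩
  · exact (hn h').not_gt h
  · exact (hp h').not_gt h

end Signs

/-! ### The complement of a disc -/

/-- An embedding of the plane in the interior of an occupied surface. -/
structure EmbeddedPlane (S : OccupiedSurface) where
  e : ℂ → S
  isOpenEmbedding : IsOpenEmbedding e
  range_subset : range e ⊆ S.inner

theorem OccupiedSurface.edge_mem_bdry (S : OccupiedSurface) (i : S.Edge) (t : I) :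
    S.edge i t ∈ S.bdry :=
  mem_iUnion.2 ⟨i, mem_range_self t⟩

theorem OccupiedSurface.isClosed_bdry (S : OccupiedSurface) : IsClosed S.bdry :=
  isClosed_iUnion_of_finite fun i => (isCompact_range (S.edge i).continuous).isClosed

namespace EmbeddedPlane

variable {S : OccupiedSurface} (D : EmbeddedPlane S)

/-- The complement of the open unit disc. -/
def ext : Set S := (D.e '' Metric.ball 0 1)ᶜ

/-- The complement of the closed unit disc. -/
def far : Set S := (D.e '' Metric.closedBall 0 1)ᶜ

theorem far_subset_ext : D.far ⊆ D.ext :=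
  compl_subset_compl.2 (image_mono Metric.ball_subset_closedBall)

theorem isOpen_far : IsOpen D.far :=
  ((isCompact_closedBall 0 1).image D.isOpenEmbedding.continuous).isClosed.isOpen_compl

theorem isClosed_ext : IsClosed D.ext :=
  (D.isOpenEmbedding.isOpenMap _ Metric.isOpen_ball).isClosed_compl

theorem mem_ext {z : ℂ} : D.e z ∈ D.ext ↔ 1 ≤ ‖z‖ := by
  rw [ext, mem_compl_iff, D.isOpenEmbedding.injective.mem_set_image, mem_ball_zero_iff, not_lt]

theorem notMem_bdry (z : ℂ) : D.e z ∉ S.bdry := D.range_subset (mem_range_self z)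

theorem ne_of_mem_bdry {x : S} (hx : x ∈ S.bdry) (z : ℂ) : x ≠ D.e z := by
  rintro rfl
  exact D.notMem_bdry z hx

theorem bdry_subset_far : S.bdry ⊆ D.far := by
  rintro x hx ⟨z, -, rfl⟩
  exact D.notMem_bdry z hx

theorem mem_far_or {x : S} (hx : x ∈ D.ext) : x ∈ D.far ∨ ∃ z, ‖z‖ = 1 ∧ x = D.e z := by
  by_cases h : x ∈ D.far
  · exact .inl h
  · obtain ⟨z, hz, rfl⟩ := not_not.1 h
    exact .inr ⟨z, le_antisymm (mem_closedBall_zero_iff.1 hz) (D.mem_ext.1 hx), rfl⟩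

theorem notMem_far {z : ℂ} (hz : ‖z‖ = 1) : D.e z ∉ D.far := fun h =>
  h ⟨z, mem_closedBall_zero_iff.2 hz.le, rfl⟩

/-- The boundary edges of the complement. -/
def edge : S.Edge ⊕ HexEdge → C(I, D.ext)
  | .inl i => ⟨fun t => ⟨S.edge i t, D.far_subset_ext (D.bdry_subset_far (S.edge_mem_bdry i t))⟩,
      by fun_prop⟩
  | .inr i => ⟨fun t => ⟨D.e (arc i t), D.mem_ext.2 (norm_arc i t).ge⟩,
      Continuous.subtype_mk (D.isOpenEmbedding.continuous.comp (by fun_prop)) _⟩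

theorem mem_iUnion_range_edge (x : D.ext) :
    x ∈ ⋃ i, range (D.edge i) ↔ x.1 ∈ S.bdry ∨ ∃ z, ‖z‖ = 1 ∧ x.1 = D.e z := by
  rw [mem_iUnion]
  constructor
  · rintro ⟨i | i, t, rfl⟩
    · exact .inl (S.edge_mem_bdry i t)
    · exact .inr ⟨arc i t, norm_arc i t, rfl⟩
  · rintro (h | ⟨z, hz, h⟩)
    · obtain ⟨i, t, ht⟩ := mem_iUnion.1 h
      exact ⟨.inl i, t, Subtype.ext ht⟩
    · obtain ⟨i, t, ht, rfl⟩ := exists_arc_eq hz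
      exact ⟨.inr i, ⟨t, ht⟩, Subtype.ext h.symm⟩

theorem mem_iUnion_range_edge_of_far {x : D.ext} (hx : x.1 ∈ D.far) :
    x ∈ ⋃ i, range (D.edge i) ↔ x.1 ∈ S.bdry := by
  rw [D.mem_iUnion_range_edge, or_iff_left]
  rintro ⟨z, hz, h⟩
  exact D.notMem_far hz (h ▸ hx)

/-- A chart of the complement near a point of the circle. -/
theorem exists_circle_chart (Ψ : OpenPartialHomeomorph ℂ ℂ)
    (hΨ : ∀ z, (Ψ z).im = -1 * (1 - ‖z‖ ^ 2)) {z₀ : ℂ} (hz₀ : z₀ ∈ Ψ.source) (x : D.ext)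
    (hx : x.1 = D.e z₀) :
    ∃ a : OpenPartialHomeomorph D.ext HalfPlane, x ∈ a.source ∧
      ∀ y ∈ a.source, ∃ z ∈ Ψ.source, 1 ≤ ‖z‖ ∧ y.1 = D.e z ∧ (a y : ℂ) = Ψ z := by
  let E := D.isOpenEmbedding.toOpenPartialHomeomorph D.e
  have hE : ∀ z, E.symm (D.e z) = z := fun z => E.left_inv (mem_univ z)
  have hsrc : ∀ y, y ∈ (E.symm.trans Ψ).source → ∃ z ∈ Ψ.source, y = D.e z := by
    rintro y ⟨h1, h2⟩
    exact ⟨E.symm y, h2, (E.right_inv h1).symm⟩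
  have hval : ∀ z, (E.symm.trans Ψ) (D.e z) = Ψ z := fun z => by
    rw [OpenPartialHomeomorph.trans_apply, hE]
  have hn : ∀ z : ℂ, 0 ≤ (Ψ z).im ↔ 1 ≤ ‖z‖ := fun z => by
    rw [hΨ]
    have := norm_nonneg z
    constructor <;> intro h <;> nlinarith
  obtain ⟨a, ha, ha'⟩ := exists_halfPlane_chart (E.symm.trans Ψ) (A := D.ext) (fun y hy => by
    obtain ⟨z, -, rfl⟩ := hsrc y hy
    rw [D.mem_ext, hval, hn]) x
  refine ⟨a, ?_, fun y hy => ?_⟩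
  · rw [ha]
    change x.1 ∈ (E.symm.trans Ψ).source
    rw [hx]
    refine ⟨E.map_source (mem_univ z₀), ?_⟩
    change E.symm (D.e z₀) ∈ Ψ.source
    rwa [hE]
  · have hy' : y.1 ∈ (E.symm.trans Ψ).source := by rw [ha] at hy; exact hy
    obtain ⟨z, hz, h⟩ := hsrc y.1 hy'
    refine ⟨z, hz, D.mem_ext.1 (h ▸ y.2), h, ?_⟩
    rw [ha' y hy, h, hval]

theorem norm_one_iff {z : ℂ} : ‖z‖ = 1 ↔ -1 * (1 - ‖z‖ ^ 2) = 0 := by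
  have := norm_nonneg z
  constructor <;> intro h
  · rw [h]; norm_num
  · nlinarith

/-- The complement of the open unit disc, with six new edges on the circle. -/
def complement : OccupiedSurface where
  carrier := D.ext
  compact := isCompact_iff_compactSpace.1 D.isClosed_ext.isCompact
  Edge := S.Edge ⊕ HexEdge
  edge := D.edge
  edge_injective i s t h := by
    rcases i with i | i
    · exact S.edge_injective i (congrArg Subtype.val h)
    · exact edgeMap_injective (some i) (D.isOpenEmbedding.injective (congrArg Subtype.val h))
  edge_disjoint i j hij s hs t h := by
    have h' := congrArg Subtype.val h
    rcases i with i | i <;> rcases j with j | j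
    · exact S.edge_disjoint i j (fun h => hij (congrArg _ h)) s hs t h'
    · exact D.ne_of_mem_bdry (S.edge_mem_bdry i s) _ h'
    · exact D.ne_of_mem_bdry (S.edge_mem_bdry j t) _ h'.symm
    · exact edgeMap_disjoint (i := some i) (j := some j)
        (fun h => hij (congrArg _ (Option.some_injective _ h))) hs t
        (D.isOpenEmbedding.injective h')
  sign_ne i j h := by
    have h' := congrArg Subtype.val h
    rcases i with i | i <;> rcases j with j | j
    · exact S.sign_ne i j h'
    · exact D.ne_of_mem_bdry (S.edge_mem_bdry i 0) _ h'
    · exact D.ne_of_mem_bdry (S.edge_mem_bdry j 1) _ h'.symm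
    · have h1 := edgeMap_zero_cube (some i)
      have h2 : edgeMap (some i) 0 = edgeMap (some j) 1 := D.isOpenEmbedding.injective h'
      rw [h2, edgeMap_one_cube] at h1
      norm_num at h1
  boundary_chart x hx := by
    rcases (D.mem_iUnion_range_edge x).1 hx with h | ⟨z, hz, h⟩
    · obtain ⟨a, hxa, ha⟩ := S.boundary_chart x.1 h
      obtain ⟨a', hs, ha'⟩ := exists_subtype_chart a D.isOpen_far D.far_subset_ext x
      refine ⟨a', ?_, fun y hy => ?_⟩
      · rw [hs]; exact ⟨hxa, D.bdry_subset_far h⟩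
      · rw [hs] at hy
        rw [D.mem_iUnion_range_edge_of_far hy.2, ha']
        exact ha y.1 hy.1
    -- `η = -1` puts the exterior of the circle, not the disc, in the upper half plane.
    · obtain ⟨Ψ, hΨ, hΨ'⟩ := exists_round_chart (u := Complex.I * (starRingEnd ℂ) z)
        (by simp [hz]) (z₀ := z) (by
          rw [mul_assoc, ← Complex.normSq_eq_conj_mul_self, Complex.normSq_eq_norm_sq, hz]; simp)
        0 one_ne_zero (η := -1) (by norm_num)
      obtain ⟨a, hxa, ha⟩ := D.exists_circle_chart Ψ (fun z => (hΨ' z).2) hΨ x h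
      refine ⟨a, hxa, fun y hy => ?_⟩
      obtain ⟨w, -, hw, hyw, haw⟩ := ha y hy
      rw [haw, (hΨ' w).2, ← norm_one_iff, D.mem_iUnion_range_edge, hyw,
        or_iff_right (D.notMem_bdry w)]
      constructor
      · rintro ⟨z, hz, h⟩
        rwa [D.isOpenEmbedding.injective h]
      · exact fun h => ⟨w, h, rfl⟩
  atlas := {a' | ∃ a ∈ S.atlas, ∀ y ∈ a'.source, y.1 ∈ D.far ∧ y.1 ∈ a.source ∧ a' y = a y.1}
  atlas_interior := by
    rintro a' ⟨a, ha, h⟩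
    rw [Set.disjoint_left]
    intro y hy hb
    obtain ⟨h1, h2, -⟩ := h y hy
    rw [D.mem_iUnion_range_edge_of_far h1] at hb
    exact Set.disjoint_left.1 (S.atlas_interior a ha) h2 hb
  atlas_cover x hx := by
    rw [D.mem_iUnion_range_edge, not_or] at hx
    have hf := (D.mem_far_or x.2).resolve_right hx.2
    obtain ⟨a, ha, hxa⟩ := S.atlas_cover x.1 hx.1
    obtain ⟨a', hs, ha'⟩ := exists_subtype_chart a D.isOpen_far D.far_subset_ext x
    refine ⟨a', ⟨a, ha, fun y hy => ?_⟩, ?_⟩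
    · rw [hs] at hy
      exact ⟨hy.2, hy.1, ha' y⟩
    · rw [hs]; exact ⟨hxa, hf⟩
  atlas_oriented := by
    rintro a' ⟨a, ha, haa⟩ b' ⟨b, hb, hbb⟩ x ⟨hxa, hxb⟩
    obtain ⟨-, hxa', hax⟩ := haa x hxa
    have h := S.atlas_oriented a ha b hb x.1 ⟨hxa', (hbb x hxb).2.1⟩
    rw [← hax] at h
    refine h.congr ?_
    have hc : ∀ᶠ z in 𝓝 (a' x), a'.symm z ∈ b'.source := by
      refine (a'.continuousAt_symm (a'.map_source hxa)).eventually_mem ?_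
      rw [a'.left_inv hxa]
      exact b'.open_source.mem_nhds hxb
    filter_upwards [hc, a'.open_target.mem_nhds (a'.map_source hxa)] with z hz hz'
    obtain ⟨-, h1, h2⟩ := haa _ (a'.map_target hz')
    rw [a'.right_inv hz'] at h2
    have h3 : a.symm z = (a'.symm z).1 := by
      conv_lhs => rw [h2]
      exact a.left_inv h1
    simp only [Function.comp_apply]
    rw [(hbb _ hz).2.2, h3]
  component_boundary x := by
    have : CompactSpace D.ext := isCompact_iff_compactSpace.1 D.isClosed_ext.isCompact
    by_contra hne
    have hbc : IsClosed (⋃ i, range (D.edge i)) :=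
      isClosed_iUnion_of_finite fun i => (isCompact_range (D.edge i).continuous).isClosed
    -- In a compact Hausdorff space a component is the intersection of its clopen neighbourhoods. If
    -- it missed the boundary, compactness would give a clopen `Z` missing it too. Away from the
    -- circle, `Z` is clopen in `S` as well, so it contains a component of `S` and hence a boundary
    -- point.
    rw [connectedComponent_eq_iInter_isClopen, not_nonempty_iff_eq_empty, inter_comm] at hne
    obtain ⟨⟨Z, hZ, hxZ⟩, hZb⟩ : ∃ Z : {s : Set D.ext // IsClopen s ∧ x ∈ s},
        (⋃ i, range (D.edge i)) ∩ Z = ∅ := by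
      have : Nonempty {s : Set D.ext // IsClopen s ∧ x ∈ s} := ⟨⟨univ, isClopen_univ, mem_univ x⟩⟩
      refine hbc.isCompact.elim_directed_family_closed
        (fun s : {s : Set D.ext // IsClopen s ∧ x ∈ s} => (s : Set D.ext))
        (fun s => s.2.1.isClosed) hne ?_
      rintro ⟨s, hs, hxs⟩ ⟨t, ht, hxt⟩
      exact ⟨⟨s ∩ t, hs.inter ht, hxs, hxt⟩, inter_subset_left, inter_subset_right⟩
    have hZ' : ∀ y : D.ext, y ∈ Z → y.1 ∉ S.bdry ∧ y.1 ∈ D.far := by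
      intro y hy
      have hyb : y ∉ ⋃ i, range (D.edge i) := fun h => by
        have : y ∈ (⋃ i, range (D.edge i)) ∩ Z := ⟨h, hy⟩
        rw [hZb] at this
        exact this
      rw [D.mem_iUnion_range_edge, not_or] at hyb
      exact ⟨hyb.1, (D.mem_far_or y.2).resolve_right hyb.2⟩
    have hclopen : IsClopen ((↑) '' Z : Set S) := by
      refine ⟨D.isClosed_ext.isClosedEmbedding_subtypeVal.isClosedMap _ hZ.isClosed, ?_⟩
      obtain ⟨W, hW, hWZ⟩ := isOpen_induced_iff.1 hZ.isOpen
      have : ((↑) '' Z : Set S) = W ∩ D.far := by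
        ext y
        constructor
        · rintro ⟨y, hy, rfl⟩
          refine ⟨?_, (hZ' y hy).2⟩
          rw [← hWZ] at hy
          exact hy
        · rintro ⟨h1, h2⟩
          refine ⟨⟨y, D.far_subset_ext h2⟩, ?_, rfl⟩
          rw [← hWZ]
          exact h1
      rw [this]
      exact hW.inter D.isOpen_far
    obtain ⟨y, hy, hyb⟩ := S.component_boundary x.1
    obtain ⟨y', hy', rfl⟩ := hclopen.connectedComponent_subset (mem_image_of_mem _ hxZ) hy
    exact (hZ' y' hy').1 hyb

theorem mem_bdry (x : D.complement) :
    x ∈ D.complement.bdry ↔ x.1 ∈ S.bdry ∨ ∃ z, ‖z‖ = 1 ∧ x.1 = D.e z :=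
  D.mem_iUnion_range_edge x

theorem mem_inner (x : D.complement) :
    x ∈ D.complement.inner ↔ x.1 ∈ S.inner ∧ x.1 ∈ D.far := by
  rw [OccupiedSurface.inner, mem_compl_iff, mem_bdry, not_or]
  refine and_congr_right fun _ => ⟨fun h => (D.mem_far_or x.2).resolve_right h, ?_⟩
  rintro h ⟨z, hz, h'⟩
  exact D.notMem_far hz (h' ▸ h)

theorem mem_F (x : D.complement) :
    x ∈ D.complement.F ↔ x.1 ∈ S.F ∨ ∃ i, x.1 = D.e (arc i mid) := by
  constructor
  · rintro ⟨i | i, rfl⟩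
    · exact .inl ⟨i, rfl⟩
    · exact .inr ⟨i, rfl⟩
  · rintro (⟨i, h⟩ | ⟨i, h⟩)
    · exact ⟨.inl i, Subtype.ext h⟩
    · exact ⟨.inr i, Subtype.ext h.symm⟩

theorem _root_.TwistedSQFT.arc_cube_re_signs (i : HexEdge) :
    0 < (arc i 1 ^ 3).re ∧ (arc i 0 ^ 3).re < 0 ∧
      ∀ t : I, (arc i t ^ 3).re = 0 ↔ t = mid := by
  have h := cheb_tcoord_edgeMap (u := 1) (by norm_num) (i := some i) (by simp)
  simp only [edgeMap_some, cheb_tcoord (u := 1) (by norm_num) (norm_arc _ _)] at h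
  exact h

/-- A chart near a point of the circle which straightens radial sutures. -/
theorem exists_radial_chart {z : ℂ} (hz : ‖z‖ = 1) (h0 : (z ^ 3).re = 0) :
    ∃ Ψ : OpenPartialHomeomorph ℂ ℂ, z ∈ Ψ.source ∧ (∀ w, (Ψ w).im = -1 * (1 - ‖w‖ ^ 2)) ∧
      ∀ w ∈ Ψ.source, (0 < (w ^ 3).re ↔ 0 < (Ψ w).re) ∧ ((w ^ 3).re < 0 ↔ (Ψ w).re < 0) := by
  have hz0 : z ≠ 0 := by rintro rfl; norm_num at hz
  set c := (z ^ 3).im with hc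
  have hc0 : c ≠ 0 := fun h1 => pow_ne_zero 3 hz0 (Complex.ext h0 h1)
  have hzz : (starRingEnd ℂ) z * z = 1 := by
    rw [← Complex.normSq_eq_conj_mul_self, Complex.normSq_eq_norm_sq, hz]; norm_num
  set u := Complex.I * (starRingEnd ℂ) z with hu
  have huz : u * z = Complex.I := by rw [hu, mul_assoc, hzz, mul_one]
  obtain ⟨Φ, hΦ, hΦ'⟩ := exists_round_chart (u := u) (by simp [hu, hz]) (z₀ := z)
    (by rw [huz]; simp) 0 hc0 (η := -1) (by norm_num)
  -- With `q = u w` and `c = im z³`, `re w³ = (3 q.im² - q.re²) * c * q.re`. Where the first factor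
  -- is positive, the sign is that of the linear coordinate `c * q.re`.
  have hev : ∀ᶠ w in 𝓝 z, (u * w).re ^ 2 < 3 * (u * w).im ^ 2 := by
    have h1 : Continuous fun w => (u * w).re ^ 2 := by fun_prop
    have h2 : Continuous fun w => 3 * (u * w).im ^ 2 := by fun_prop
    exact h1.continuousAt.eventually_lt h2.continuousAt (by rw [huz]; simp)
  obtain ⟨Ψ, h1, -, h2, h3⟩ := exists_chart_restr Φ hΦ hev
  refine ⟨Ψ, h1, fun w => by rw [h2, (hΦ' w).2], fun w hw => ?_⟩
  have hw' := h3 w hw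
  have hre : (Ψ w).re = c * (u * w).re := by rw [h2, (hΦ' w).1, sub_zero]
  have e1 : w = z * (-Complex.I * (u * w)) := by
    have : -Complex.I * (u * w) = (starRingEnd ℂ) z * w := by
      rw [hu]
      linear_combination (-(starRingEnd ℂ) z * w) * Complex.I_mul_I
    rw [this, ← mul_assoc, mul_comm z, hzz, one_mul]
  have e2 : (w ^ 3).re = (3 * (u * w).im ^ 2 - (u * w).re ^ 2) * (Ψ w).re := by
    rw [hre]
    generalize u * w = q at e1 ⊢
    rw [e1, mul_pow, Complex.mul_re, h0, ← hc]
    simp [pow_succ]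
    ring
  have hp := sub_pos.2 hw'
  rw [e2]
  refine ⟨mul_pos_iff_of_pos_left hp, ?_⟩
  rw [← neg_pos, ← mul_neg, mul_pos_iff_of_pos_left hp, neg_pos]

/-- The restriction to the complement of sutures which are radial near the circle. -/
def sutures (Γ : Sutures S) (hs : ∀ z, 1 ≤ ‖z‖ → SignAt Γ D.e 1 z) : Sutures D.complement where
  pos := {x | x.1 ∈ Γ.pos}
  neg := {x | x.1 ∈ Γ.neg}
  isOpen_pos := Γ.isOpen_pos.preimage continuous_subtype_val
  isOpen_neg := Γ.isOpen_neg.preimage continuous_subtype_val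
  disjoint := Γ.disjoint.preimage _
  Vpos_subset := by
    rintro _ ⟨i | i, rfl⟩
    · exact Γ.Vpos_subset ⟨i, rfl⟩
    -- The normalisation of the sign to 1 is needed here: the new positive vertices have cube 1 and
    -- must lie in the positive region.
    · refine (hs _ (norm_arc i 1).ge).1.2 ?_
      rw [one_mul]
      exact (arc_cube_re_signs i).1
  Vneg_subset := by
    rintro _ ⟨i | i, rfl⟩
    · exact Γ.Vneg_subset ⟨i, rfl⟩
    · refine (hs _ (norm_arc i 0).ge).2.2 ?_
      rw [one_mul]
      exact (arc_cube_re_signs i).2.1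
  inter_bdry := by
    have hF : ∀ x, x ∈ Γ.curve ∩ S.bdry ↔ x ∈ S.F := fun x => by
      rw [← Γ.inter_bdry]; rfl
    ext x
    rw [mem_F, ← hF]
    change (x.1 ∈ Γ.curve ∧ x ∈ D.complement.bdry) ↔ _
    rw [mem_bdry, and_or_left]
    refine or_congr Iff.rfl ⟨?_, ?_⟩
    · rintro ⟨h1, z, hz, h2⟩
      rw [h2, Sutures.mem_curve_iff, (hs z hz.ge).1, (hs z hz.ge).2] at h1
      obtain ⟨i, t, ht, rfl⟩ := exists_arc_eq hz
      have h3 : (arc i t ^ 3).re = 0 := by linarith [h1.1, h1.2]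
      have h4 := ((arc_cube_re_signs i).2.2 ⟨t, ht⟩).1 h3
      exact ⟨i, by rw [h2, ← h4]⟩
    · rintro ⟨i, h⟩
      refine ⟨?_, arc i mid, norm_arc i mid, h⟩
      have h3 := ((arc_cube_re_signs i).2.2 mid).2 rfl
      have h4 := hs _ (norm_arc i mid).ge
      rw [SignAt, h3, mul_zero] at h4
      rw [h, Sutures.mem_curve_iff, h4.1, h4.2]
      exact ⟨lt_irrefl _, lt_irrefl _⟩
  inner_chart x hx hxi := by
    rw [D.mem_inner] at hxi
    obtain ⟨a, hxa, hai, ha⟩ := Γ.inner_chart x.1 hx hxi.1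
    obtain ⟨a', hs, ha'⟩ := exists_subtype_chart a D.isOpen_far D.far_subset_ext x
    refine ⟨a', ?_, fun y hy => ?_, fun y hy => ?_⟩
    · rw [hs]; exact ⟨hxa, hxi.2⟩
    · rw [hs] at hy
      exact (D.mem_inner y).2 ⟨hai hy.1, hy.2⟩
    · rw [hs] at hy
      have h := ha y.1 hy.1
      rw [← ha' y] at h
      exact h
  bdry_chart x hx hxb := by
    rcases (D.mem_bdry x).1 hxb with h | ⟨z, hz, h⟩
    · obtain ⟨a, hxa, ha⟩ := Γ.bdry_chart x.1 hx h
      obtain ⟨a', hs, ha'⟩ := exists_subtype_chart a D.isOpen_far D.far_subset_ext x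
      refine ⟨a', ?_, fun y hy => ?_⟩
      · rw [hs]; exact ⟨hxa, D.bdry_subset_far h⟩
      · rw [hs] at hy
        have h := ha y.1 hy.1
        rw [← ha' y, ← D.mem_iUnion_range_edge_of_far hy.2] at h
        exact h
    · have hx' : x.1 ∈ Γ.curve := hx
      rw [h, Sutures.mem_curve_iff, (hs z hz.ge).1, (hs z hz.ge).2] at hx'
      obtain ⟨Ψ, h1, h2, h3⟩ := exists_radial_chart hz (by linarith [hx'.1, hx'.2])
      obtain ⟨a, hxa, ha⟩ := D.exists_circle_chart Ψ h2 h1 x h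
      refine ⟨a, hxa, fun y hy => ?_⟩
      obtain ⟨w, hw, hw1, hyw, haw⟩ := ha y hy
      have hbd : y ∈ D.complement.bdry ↔ (a y).1.im = 0 := by
        rw [mem_bdry, hyw, or_iff_right (D.notMem_bdry w), haw, h2, ← norm_one_iff]
        constructor
        · rintro ⟨z, hz, h⟩
          rwa [D.isOpenEmbedding.injective h]
        · exact fun h => ⟨w, h, rfl⟩
      have hsw := hs w hw1
      rw [SignAt, one_mul, (h3 w hw).1, (h3 w hw).2, ← hyw, ← haw] at hsw
      exact ⟨hbd, hsw⟩

end EmbeddedPlane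

/-! ### The inclusion of the hexagon as a decorated morphism -/

theorem hexagon_edge (i : hexagon.Edge) :
    ∃ j : HexEdge, i.1 = some j ∧ ∀ t, (hexagon.edge i t).1 = arc j t := by
  obtain ⟨_, j, rfl⟩ := i
  exact ⟨j, rfl, fun t => rfl⟩

theorem arc_disjoint {i j : HexEdge} (hij : i ≠ j) {s : I} (hs : s ∈ Ioo (0 : I) 1) (t : I) :
    arc i s ≠ arc j t :=
  edgeMap_disjoint (i := some i) (j := some j) (fun h => hij (Option.some_injective _ h)) hs t

theorem mid_mem_Ioo : mid ∈ Ioo (0 : I) 1 :=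
  ⟨show (0 : ℝ) < 1 / 2 by norm_num, show (1 / 2 : ℝ) < 1 by norm_num⟩

theorem EdgeMatch.exists_eq {X : Type} {α β : I → X} (h : EdgeMatch α β) (s : I) :
    ∃ t, α s = β t := by
  have : α s ∈ range β := h.1 ▸ mem_range_self s
  obtain ⟨t, ht⟩ := this
  exact ⟨t, ht.symm⟩

namespace EmbeddedPlane

variable {S : OccupiedSurface} (D : EmbeddedPlane S)

/-- The inclusion of the hexagon. -/
def hexMorphism (ho : ∀ b ∈ S.atlas, ∀ z, D.e z ∈ b.source → PosAt (b ∘ D.e) z) :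
    Morphism hexagon S where
  map := ⟨fun x => D.e x.1, D.isOpenEmbedding.continuous.comp continuous_subtype_val⟩
  map_inner x _ := D.range_subset (mem_range_self x.1)
  embedding := D.isOpenEmbedding.comp disc.isOpenEmbedding_inner
  oriented a ha b hb x hx hxb := by
    have h := ho b hb x.1 hxb
    have hax : a x = x.1 := ha.2 x hx
    rw [← hax] at h
    refine h.congr ?_
    filter_upwards [a.open_target.mem_nhds (a.map_source hx)] with z hz
    have e : z = (a.symm z).1 := (a.right_inv hz).symm.trans (ha.2 _ (a.map_target hz))
    exact congrArg (fun w => b (D.e w)) e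
  edge_injective i s t h := by
    have h' := D.isOpenEmbedding.injective h
    exact edgeMap_injective i.1 h'
  edge_edge i j := by
    by_cases hij : i = j
    · exact .inl (EdgeMatch.of_eq (by rw [hij]))
    · exact .inr fun s hs t h => edgeMap_disjoint (fun h => hij (Subtype.ext h)) hs t
        (D.isOpenEmbedding.injective h)
  edge_bdry i := .inr fun s _ => D.range_subset (mem_range_self _)
  map_Vneg x _ h := (D.notMem_bdry _ h).elim
  map_Vpos x _ h := (D.notMem_bdry _ h).elim
  sign_ne x hx y hy h := by
    have h1 : x.1 = y.1 := D.isOpenEmbedding.injective h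
    have h2 := disc.Vneg_cube hx
    rw [h1, disc.Vpos_cube hy] at h2
    norm_num at h2

theorem complement_Vneg {x : D.complement} (hx : x ∈ D.complement.Vneg) :
    x.1 ∈ S.Vneg ∨ ∃ z, z ^ 3 = -1 ∧ x.1 = D.e z := by
  obtain ⟨i | i, rfl⟩ := hx
  · exact .inl ⟨i, rfl⟩
  · exact .inr ⟨_, edgeMap_zero_cube (some i), rfl⟩

theorem complement_Vpos {x : D.complement} (hx : x ∈ D.complement.Vpos) :
    x.1 ∈ S.Vpos ∨ ∃ z, z ^ 3 = 1 ∧ x.1 = D.e z := by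
  obtain ⟨i | i, rfl⟩ := hx
  · exact .inl ⟨i, rfl⟩
  · exact .inr ⟨_, edgeMap_one_cube (some i), rfl⟩

theorem _root_.TwistedSQFT.OccupiedSurface.Vneg_subset_bdry (S : OccupiedSurface) :
    S.Vneg ⊆ S.bdry := by
  rintro _ ⟨i, rfl⟩; exact S.edge_mem_bdry i 0

theorem _root_.TwistedSQFT.OccupiedSurface.Vpos_subset_bdry (S : OccupiedSurface) :
    S.Vpos ⊆ S.bdry := by
  rintro _ ⟨i, rfl⟩; exact S.edge_mem_bdry i 1

theorem _root_.TwistedSQFT.OccupiedSurface.disjoint_Vneg_Vpos (S : OccupiedSurface) {x : S}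
    (h : x ∈ S.Vneg) (h' : x ∈ S.Vpos) : False := by
  obtain ⟨i, rfl⟩ := h
  obtain ⟨j, h⟩ := h'
  exact S.sign_ne i j h.symm

/-- The inclusion of the complement of the hexagon. -/
def complementMorphism : Morphism D.complement S where
  map := ⟨fun x => x.1, continuous_subtype_val⟩
  map_inner x hx := ((D.mem_inner x).1 hx).1
  embedding := by
    have h : IsEmbedding fun x : D.complement.inner => (x.1.1 : S) :=
      IsEmbedding.subtypeVal.comp IsEmbedding.subtypeVal
    refine ⟨h, ?_⟩
    have : range (fun x : D.complement.inner => (x.1.1 : S)) = S.inner ∩ D.far := by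
      ext y
      constructor
      · rintro ⟨x, rfl⟩
        exact (D.mem_inner x.1).1 x.2
      · intro hy
        exact ⟨⟨⟨y, D.far_subset_ext hy.2⟩, (D.mem_inner _).2 hy⟩, rfl⟩
    change IsOpen (range fun x : D.complement.inner => (x.1.1 : S))
    rw [this]
    exact S.isClosed_bdry.isOpen_compl.inter D.isOpen_far
  oriented := by
    rintro a' ⟨a, ha, haa⟩ b hb x hxa hxb
    obtain ⟨-, hxa', hax⟩ := haa x hxa
    have h := S.atlas_oriented a ha b hb x.1 ⟨hxa', hxb⟩
    rw [← hax] at h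
    refine h.congr ?_
    filter_upwards [a'.open_target.mem_nhds (a'.map_source hxa)] with z hz
    obtain ⟨-, h1, h2⟩ := haa _ (a'.map_target hz)
    have h3 : a.symm z = (a'.symm z).1 :=
      (congrArg a.symm ((a'.right_inv hz).symm.trans h2)).trans (a.left_inv h1)
    exact congrArg b h3
  edge_injective i s t h := D.complement.edge_injective i (Subtype.ext h)
  edge_edge i j := by
    by_cases hij : i = j
    · exact .inl (EdgeMatch.of_eq (by rw [hij]))
    · exact .inr fun s hs t h => D.complement.edge_disjoint i j hij s hs t (Subtype.ext h)
  edge_bdry i := by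
    rcases i with i | i
    · exact .inl ⟨i, EdgeMatch.of_eq rfl⟩
    · exact .inr fun s _ => D.range_subset (mem_range_self _)
  map_Vneg x hx hb := by
    rcases D.complement_Vneg hx with h | ⟨z, -, h⟩
    · exact h
    · exact (D.ne_of_mem_bdry hb z h).elim
  map_Vpos x hx hb := by
    rcases D.complement_Vpos hx with h | ⟨z, -, h⟩
    · exact h
    · exact (D.ne_of_mem_bdry hb z h).elim
  sign_ne x hx y hy h := D.complement.disjoint_Vneg_Vpos hx ((Subtype.ext h : x = y) ▸ hy)

theorem isComplement (ho : ∀ b ∈ S.atlas, ∀ z, D.e z ∈ b.source → PosAt (b ∘ D.e) z) :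
    IsComplement (D.hexMorphism ho) D.complementMorphism := by
  refine ⟨⟨?_, ?_, ?_, ?_⟩, ?_, ?_⟩
  · rw [Set.disjoint_left]
    rintro _ ⟨x, hx, rfl⟩ ⟨y, -, h⟩
    have h1 : D.e x.1 ∈ D.ext := by
      have h' : y.1 = D.e x.1 := h
      rw [← h']; exact y.2
    have h2 := mem_interior_disc.1 ((disc.mem_inner x).1 hx)
    exact (D.mem_ext.1 h1).not_gt h2
  · rintro i (j | j)
    · refine .inr fun s hs t => ⟨fun h => ?_, fun h => ?_⟩
      · exact D.ne_of_mem_bdry (S.edge_mem_bdry j t) _ h.symm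
      · exact D.ne_of_mem_bdry (S.edge_mem_bdry j s) _ h.symm
    · obtain ⟨k, hk, hi⟩ := hexagon_edge i
      by_cases hkj : k = j
      · subst hkj
        exact .inl (EdgeMatch.of_eq (funext fun t => congrArg D.e (hi t)))
      · refine .inr fun s hs t => ⟨fun h => ?_, fun h => ?_⟩
        · have h' := D.isOpenEmbedding.injective h
          rw [hi] at h'
          exact arc_disjoint hkj hs t h'
        · have h' := D.isOpenEmbedding.injective h
          rw [hi] at h'
          exact arc_disjoint (Ne.symm hkj) hs t h'.symm
  · intro x hx y hy h
    rcases D.complement_Vpos hy with h' | ⟨z, hz, h'⟩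
    · exact D.ne_of_mem_bdry (S.Vpos_subset_bdry h') _ h.symm
    · have h1 : x.1 = z := D.isOpenEmbedding.injective (h.trans h')
      have h2 := disc.Vneg_cube hx
      rw [h1, hz] at h2
      norm_num at h2
  · intro x hx y hy h
    rcases D.complement_Vneg hy with h' | ⟨z, hz, h'⟩
    · exact D.ne_of_mem_bdry (S.Vneg_subset_bdry h') _ h.symm
    · have h1 : x.1 = z := D.isOpenEmbedding.injective (h.trans h')
      have h2 := disc.Vpos_cube hx
      rw [h1, hz] at h2
      norm_num at h2
  · refine eq_univ_of_forall fun x => ?_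
    by_cases h : x ∈ D.ext
    · exact .inr ⟨⟨x, h⟩, rfl⟩
    · obtain ⟨z, hz, rfl⟩ := not_not.1 h
      exact .inl ⟨⟨z, mem_disc.2 (mem_ball_zero_iff.1 hz).le⟩, rfl⟩
  · intro i j h
    by_contra hij
    obtain ⟨t, ht⟩ := h.exists_eq mid
    exact D.complement.edge_disjoint i j hij mid mid_mem_Ioo t (Subtype.ext ht)

/-- The inclusion of the hexagon, with the sutures `Γ` on the complement. -/
def decorated (ho : ∀ b ∈ S.atlas, ∀ z, D.e z ∈ b.source → PosAt (b ∘ D.e) z) (Γ : Sutures S)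
    (hs : ∀ z, 1 ≤ ‖z‖ → SignAt Γ D.e 1 z) : DecoratedMorphism hexagon S where
  φ := D.hexMorphism ho
  C := D.complement
  κ := D.complementMorphism
  isComplement := D.isComplement ho
  Γc := D.sutures Γ hs

/-- One decorated morphism serves the whole triple: its complementary sutures come from a fixed `Γ`,
while the target `Γ'` need only agree with `Γ` outside the open disc and consist of chords inside.
-/
theorem decorated_sends (ho : ∀ b ∈ S.atlas, ∀ z, D.e z ∈ b.source → PosAt (b ∘ D.e) z)
    (Γ Γ' : Sutures S) (hs : ∀ z, 1 ≤ ‖z‖ → SignAt Γ D.e 1 z) {u : ℂ} (hu : u ^ 3 = 1)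
    (hin : ∀ z, ‖z‖ ≤ 1 → (D.e z ∈ Γ'.curve ↔ cheb (tcoord u z) = 0))
    (hout : Γ'.curve ∩ D.ext = Γ.curve ∩ D.ext) :
    (D.decorated ho Γ hs).Sends (hexSutures hu) Γ' := by
  have hφ : (D.decorated ho Γ hs).φ.map '' (hexSutures hu).curve =
      D.e '' {z | ‖z‖ ≤ 1 ∧ cheb (tcoord u z) = 0} := by
    ext y
    constructor
    · rintro ⟨x, hx, rfl⟩
      exact ⟨x.1, ⟨mem_disc.1 x.2, (disc.mem_curve hu _ _ x).1 hx⟩, rfl⟩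
    · rintro ⟨z, ⟨hz, hz'⟩, rfl⟩
      exact ⟨⟨z, mem_disc.2 hz⟩, (disc.mem_curve hu _ _ _).2 hz', rfl⟩
  have hκ : (D.decorated ho Γ hs).curve = Γ'.curve ∩ D.ext := by
    rw [hout]
    ext y
    constructor
    · rintro ⟨x, hx, rfl⟩
      exact ⟨hx, x.2⟩
    · rintro ⟨h1, h2⟩
      exact ⟨⟨y, h2⟩, h1, rfl⟩
  rw [DecoratedMorphism.Sends, hφ, hκ]
  ext y
  constructor
  · intro hy
    by_cases h : y ∈ D.ext
    · exact .inr ⟨hy, h⟩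
    · obtain ⟨z, hz, rfl⟩ := not_not.1 h
      have hz' := (mem_ball_zero_iff.1 hz).le
      exact .inl ⟨z, ⟨hz', (hin z hz').1 hy⟩, rfl⟩
  · rintro (⟨z, ⟨hz, hz'⟩, rfl⟩ | h)
    · exact (hin z hz).2 hz'
    · exact h.1

end EmbeddedPlane

/-! ### Normalising the signs by a half turn -/

theorem PosAt.comp_neg {f : ℂ → ℂ} {z : ℂ} (h : PosAt f (-z)) : PosAt (fun w => f (-w)) z := by
  unfold PosAt at *
  filter_upwards [h] with r ⟨g, hg, hp, he⟩
  -- The half turn shifts the angle by `π`. Periodicity of `g` is known only from 0 to `2π`, so on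
  -- that interval the new lift uses only values of `g` from it; the two formulas agree at `θ = π`
  -- by `hp`.
  refine ⟨fun θ => if θ ≤ Real.pi then g (θ + Real.pi) else g (θ - Real.pi) + 2 * Real.pi, ?_, ?_,
    fun θ => ?_⟩
  · refine Continuous.if_le (by fun_prop) (by fun_prop) continuous_id continuous_const ?_
    rintro θ rfl
    rw [sub_self, ← hp]
    ring_nf
  · have hpi := Real.pi_pos
    simp only
    rw [if_neg (by linarith), if_pos hpi.le]
    ring_nf
  · have e1 : ∀ θ' : ℝ, Complex.exp (θ' * Complex.I) = -Complex.exp (θ * Complex.I) →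
        f (-(z + r * Complex.exp (θ * Complex.I))) - f (-z) =
          ‖f (-(z + r * Complex.exp (θ * Complex.I))) - f (-z)‖ *
            Complex.exp (g θ' * Complex.I) := by
      intro θ' h'
      have := he θ'
      rw [h', show -z + r * -Complex.exp (θ * Complex.I) =
        -(z + r * Complex.exp (θ * Complex.I)) by ring] at this
      exact this
    have e2 : Complex.exp ((Real.pi : ℂ) * Complex.I) = -1 := Complex.exp_pi_mul_I
    simp only
    split_ifs with hθ
    · refine e1 _ ?_
      push_cast
      rw [add_mul, Complex.exp_add, e2, mul_neg_one]
    · have h3 : Complex.exp (((g (θ - Real.pi) + 2 * Real.pi : ℝ) : ℂ) * Complex.I) =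
          Complex.exp (g (θ - Real.pi) * Complex.I) := by
        push_cast
        rw [add_mul, Complex.exp_add, Complex.exp_two_pi_mul_I, mul_one]
      rw [h3]
      refine e1 _ ?_
      push_cast
      rw [sub_mul, Complex.exp_sub, e2, div_neg, div_one]

theorem tcoord_neg (u z : ℂ) : tcoord u (-z) = -tcoord u z := by
  simp [tcoord]

/-- The plane around the disc of a bypass triple, with the signs of the regions of the first of
the three sets of sutures normalised. -/
theorem exists_normalised_plane {S : OccupiedSurface} (Γ : Fin 3 → Sutures S)
    (τ : Equiv.Perm (Fin 3)) (e : ℂ → S) (he : IsOpenEmbedding e) (hr : range e ⊆ S.inner)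
    (ho : ∀ b ∈ S.atlas, ∀ z, e z ∈ b.source → PosAt (b ∘ e) z)
    (hcurve : ∀ i, e ⁻¹' (Γ i).curve = bypassCurve (τ i))
    (hout : ∀ i j, (Γ i).curve \ e '' Metric.ball 0 1 = (Γ j).curve \ e '' Metric.ball 0 1) :
    ∃ D : EmbeddedPlane S, (∀ b ∈ S.atlas, ∀ z, D.e z ∈ b.source → PosAt (b ∘ D.e) z) ∧
      (∀ z, 1 ≤ ‖z‖ → SignAt (Γ 0) D.e 1 z) ∧
      (∀ i z, ‖z‖ ≤ 1 → (D.e z ∈ (Γ i).curve ↔ cheb (tcoord (zeta ^ (τ i : ℕ)) z) = 0)) ∧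
      ∀ i, (Γ i).curve ∩ D.ext = (Γ 0).curve ∩ D.ext := by
  have hmem : ∀ i z, e z ∈ (Γ i).curve ↔ z ∈ bypassCurve (τ i) := fun i z => by
    rw [← hcurve]; rfl
  obtain ⟨ε, hε, hs⟩ := exists_signAt_outside (Γ := Γ 0) he hr fun z hz => by
    rw [hmem, mem_bypassCurve_outside hz]
  have hin : ∀ i z, ‖z‖ ≤ 1 → (e z ∈ (Γ i).curve ↔ cheb (tcoord (zeta ^ (τ i : ℕ)) z) = 0) :=
    fun i z hz => by rw [hmem, mem_bypassCurve_inside hz]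
  rcases hε with rfl | rfl
  · exact ⟨⟨e, he, hr⟩, ho, hs, hin, fun i => hout i 0⟩
  -- For `ε = -1` the plane is reparametrised by `z ↦ -z`. This keeps the orientation and the disc,
  -- changes the sign of `z³`, and keeps the chords because `cheb` is odd.
  · have hneg : (fun z => e (-z)) '' Metric.ball 0 1 = e '' Metric.ball 0 1 := by
      rw [show (fun z => e (-z)) = e ∘ Neg.neg from rfl, image_comp]
      congr 1
      simp
    refine ⟨⟨fun z => e (-z), he.comp (Homeomorph.neg ℂ).isOpenEmbedding, ?_⟩, ?_, ?_, ?_, ?_⟩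
    · rintro _ ⟨z, rfl⟩
      exact hr (mem_range_self _)
    · intro b hb z hz
      exact PosAt.comp_neg (f := b ∘ e) (ho b hb (-z) hz)
    · intro z hz
      have h := hs (-z) (by rwa [norm_neg])
      have h3 : -1 * ((-z) ^ 3).re = 1 * (z ^ 3).re := by
        rw [show (-z) ^ 3 = -z ^ 3 by ring, Complex.neg_re]; ring
      rw [SignAt, h3] at h
      exact h
    · intro i z hz
      rw [hin i (-z) (by rwa [norm_neg]), tcoord_neg, cheb_neg, neg_eq_zero]
    · intro i
      rw [EmbeddedPlane.ext, hneg]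
      exact hout i 0

end TwistedSQFT

end

/-! ### The bypass relation -/

theorem mainTheorem8 (𝒟 : TwistedSQFT.Theory) (S : TwistedSQFT.OccupiedSurface)
    (Γ : Fin 3 → TwistedSQFT.Sutures S) (hΓ : TwistedSQFT.IsBypassTriple Γ) :
    ∃ c₀ ∈ 𝒟.c (Γ 0), ∃ c₁ ∈ 𝒟.c (Γ 1), ∃ c₂ ∈ 𝒟.c (Γ 2), c₀ + c₁ + c₂ = 0 := by
  obtain ⟨Γ', τ, e, hiso, he, hr, ho, hcurve, hout⟩ := hΓ
  obtain ⟨D, ho, hs, hin, hext⟩ :=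
    TwistedSQFT.exists_normalised_plane Γ' τ e he hr ho hcurve hout
  obtain ⟨x, hx, hsum⟩ := 𝒟.hexagon_relation
  -- A single representative is used for all three elements, so the separate units on the graded
  -- summands cause no ambiguity.
  obtain ⟨f, -, hf⟩ := 𝒟.D_class (D.decorated ho (Γ' 0) hs)
  have hfD : f ∈ 𝒟.D (D.decorated ho (Γ' 0) hs) := by
    rw [hf]
    exact ⟨fun _ => 1, fun _ _ _ => by simp⟩
  have hc : ∀ i, f (x (τ i)) ∈ 𝒟.c (Γ i) := fun i => by
    rw [𝒟.c_isotopic _ _ (hiso i)]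
    exact 𝒟.D_suture _ _ _ (D.decorated_sends ho (Γ' 0) (Γ' i) hs (TwistedSQFT.zeta_pow_cube (τ i))
      (hin i) (hext i)) f hfD _ (hx (τ i))
  refine ⟨_, hc 0, _, hc 1, _, hc 2, ?_⟩
  -- Additivity of `f` transports the relation, and the sum over the triple does not depend on its
  -- order `τ`.
  rw [← map_add, ← map_add]
  have h := Equiv.sum_comp τ x
  rw [Fin.sum_univ_three, Fin.sum_univ_three, hsum] at h
  rw [h, map_zero]
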